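/- **Arrangements.** An arrangement $\mathcal A$ is a finite set of affine hyperplanes in a finite-dimensional vector space $V$ over a field $K$; it is central if all of them contain $0$. The cone $\mathbf c\mathcal A$ over an arrangement $\mathcal A$ in $V$ is the central arrangement in $V\times K$ (last coordinate $z$) consisting of $z=0$ and of the hyperplanes $\alpha(x)=az$ for all hyperplanes $\alpha(x)=a$ of $\mathcal A$. For a central $\mathcal A$, let $L(\mathcal A)$ be the set of intersections of subsets of $\mathcal A$ (with $V$ as the empty intersection), and for $X\in L(\mathcal A)$ let $\mathcal A^X=\{H\cap X : H\in\mathcal A,\ X\not\subseteq H\}$, an arrangement in $X$. Let $S=S(V^*)$ and $Q=\prod_{H\in\mathcal A}\alpha_H$ with $H=\ker\alpha_H$. Then $\mathcal A$ is free with exponents $\exp(\mathcal A)=(e_1,\dots,e_n)$ (a multiset) if the $S$-module $D(\mathcal A)=\{\theta\in\mathrm{Der}_K(S) : \theta(Q)\in QS\}$ has a basis of homogeneous derivations of degrees $e_1,\dots,e_n$ (a derivation is homogeneous of degree $d$ if it maps linear forms to homogeneous polynomials of degree $d$). The class of inductively free arrangements is the smallest class that contains all empty arrangements, and contains $\mathcal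 A$ whenever for some $H\in\mathcal A$ the arrangements $\mathcal A^H$ and $\mathcal A\setminus\{H\}$ are in the class and $\exp(\mathcal A^H)\subseteq\exp(\mathcal A\setminus\{H\})$. A central arrangement $\mathcal A$ in $V$, $n=\dim V$, is *ind-flag-accurate* if it is inductively free, it is free with exponents $e_1\le\dots\le e_n$, and there are $X_1\subseteq X_2\subseteq\dots\subseteq X_n=V$ in $L(\mathcal A)$ with $\dim X_d=d$ such that for every $1\le d\le n$ the restriction $\mathcal A^{X_d}$ is inductively free, and free with exponents $(e_1,\dots,e_d)$. **Catalan descendants.** For a digraph $G$ on $[\ell]=\{1,\dots,\ell\}$ without loops and a map $\psi$ from $[\ell]$ to the finite subsets of $\mathbb Z$, let $\mathcal A(G,\psi)$ be the arrangement in $\mathbb R^\ell$ consisting of the hyperplanes $x_i-x_j=0$ ($i<j$), $x_i-x_j=1$ ($(i,j)$ an edge of $G$) and $x_i=a$ ($i\in[\ell]$, $a\in\psi(i)$). Let $m\ge0$, $c\ge1$, $1\le k\le\ell$ and $0\le p\le\ell$ be integers. Pairs $(G^k,\psi^k)$ and $(\widehat G^k,\widehat\psi^k)$ are defined recursively as follows.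 * $G^1$ is the complete digraph on $[\ell]$ (all edges $(i,j)$ with $i\ne j$), $\psi^1(i)=[-c,m]$ for $i\le p$ and $\psi^1(i)=[-c,m+1]$ for $i>p$ (integer intervals). * With $v=\ell-k+1$, the pair $(\widehat G^k,\widehat\psi^k)$ is obtained from $(G^k,\psi^k)$ by removing all edges $(i,v)$ with $i<v$ and lowering the left end point of $\psi^k(i)$ by $1$ for all $i<v$. * For $k<\ell$ and $v=\ell-k+1$, the pair $(G^{k+1},\psi^{k+1})$ is obtained from $(\widehat G^k,\widehat\psi^k)$ by removing all edges $(v,i)$ with $i<v$ and raising the right end point of $\widehat\psi^k(i)$ by $1$ for all $i<v$. Put $\mathcal R^{p,k}_\ell(c,m)=\mathcal A(G^k,\psi^k)$ and $\widehat{\mathcal R}^{p,k}_\ell(c,m)=\mathcal A(\widehat G^k,\widehat\psi^k)$. (For $k=\ell$ nothing changes in the second step, so $\widehat{\mathcal R}^{p,\ell}_\ell(c,m)=\mathcal R^{p,\ell}_\ell(c,m)$.) **Theorem.** For all integers $m\ge 0$, $c\ge 1$, $1\le k\le\ell$ and $0\le p\le\ell$, the cones $\mathbf c\mathcal R^{p,k}_\ell(c,m)$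 and $\mathbf c\widehat{\mathcal R}^{p,k}_\ell(c,m)$ are ind-flag-accurate, and both are free with the multiset of exponents $$(1,\ \ell-p+1,\ 2,\ 3,\ \dots,\ \ell)+\bigl(0,\ (m+\ell+c-1)^{\ell}\bigr),$$ that is, with the $\ell+1$ exponents $1$, $(\ell-p+1)+N$, $2+N,\ 3+N,\ \dots,\ \ell+N$, where $N=m+\ell+c-1$. -/

import Mathlib

open Module

noncomputable section

namespace Arr

universe u v

/-! ### Affine and central hyperplane arrangements -/

section Arrangements

variable (K : Type u) [Field K] (V : Type v) [AddCommGroup V] [Module K V]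

/-- A linear hyperplane: the kernel of a non-zero linear form. -/
def IsLinearHyperplane {K : Type u} [Field K] {V : Type v} [AddCommGroup V] [Module K V]
    (H : Submodule K V) : Prop :=
  ∃ α : Dual K V, α ≠ 0 ∧ LinearMap.ker α = H

/-- A central arrangement: a finite collection of linear hyperplanes in `V`. -/
structure CentralArrangement where
  hyps : Finset (Submodule K V)
  isHyperplane : ∀ H ∈ hyps, IsLinearHyperplane H

variable {K V}

/-- The affine subspace `{x | α x = a}`. -/
def affineLevel (α : Dual K V) (a : K) : AffineSubspace K V where
  carrier := {x | α x = a}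
  smul_vsub_vadd_mem' := by
    intro c p₁ p₂ p₃ h₁ h₂ h₃
    simp only [Set.mem_ofPred_eq] at h₁ h₂ h₃ ⊢
    simp [h₁, h₂, h₃]

/-- An affine hyperplane: `{x | α x = a}` for a non-zero linear form `α`. -/
def IsAffineHyperplane (H : AffineSubspace K V) : Prop :=
  ∃ (α : Dual K V) (a : K), α ≠ 0 ∧ H = affineLevel α a

variable (K V) in
/-- An arrangement: a finite collection of affine hyperplanes in `V`. -/
structure AffineArrangement where
  hyps : Finset (AffineSubspace K V)
  isHyperplane : ∀ H ∈ hyps, IsAffineHyperplane H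

/-- The linear hyperplane of `V × K` over an affine hyperplane `H` of `V`: the span of `H × {1}`.
For `H = {x | α x = a}` this is the zero set `{(x, z) | α x - a z = 0}` of the homogenized
equation, see `coneHyperplane_affineLevel`. -/
def coneHyperplane (H : AffineSubspace K V) : Submodule K (V × K) :=
  Submodule.span K ((fun x : V => (x, (1 : K))) '' (H : Set V))

theorem coneHyperplane_affineLevel (α : Dual K V) (a : K) (hα : α ≠ 0) :
    coneHyperplane (affineLevel α a)
      = LinearMap.ker (α ∘ₗ LinearMap.fst K V K - a • LinearMap.snd K V K) := by
  apply le_antisymm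
  · refine Submodule.span_le.2 ?_
    rintro _ ⟨x, hx, rfl⟩
    have hx' : α x = a := hx
    simp [hx']
  · rintro ⟨y, z⟩ hy
    have hy' : α y = a * z := by
      simpa [sub_eq_zero] using hy
    obtain ⟨x₀, hx₀⟩ := LinearMap.surjective hα a
    have h₁ : ((x₀ + (y - z • x₀), 1) : V × K) ∈ coneHyperplane (affineLevel α a) := by
      refine Submodule.subset_span ⟨x₀ + (y - z • x₀), ?_, rfl⟩
      change α _ = a
      simp only [map_add, map_sub, map_smul, hx₀, hy', smul_eq_mul]
      ring
    have h₂ : ((x₀, 1) : V × K) ∈ coneHyperplane (affineLevel α a) :=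
      Submodule.subset_span ⟨x₀, hx₀, rfl⟩
    have h₃ := Submodule.add_mem _ (Submodule.sub_mem _ h₁ h₂) (Submodule.smul_mem _ z h₂)
    have h₄ : ((x₀ + (y - z • x₀), 1) : V × K) - (x₀, 1) + z • ((x₀, 1) : V × K) = (y, z) := by
      ext <;> simp
    rwa [h₄] at h₃

open scoped Classical in
/-- The cone over an affine arrangement in `V`: the central arrangement in `V × K` consisting of
the hyperplane at infinity `z = 0` and of the homogenizations of all hyperplanes. -/
def AffineArrangement.cone (A : AffineArrangement K V) : CentralArrangement K (V × K) where
  hyps := insert (LinearMap.ker (LinearMap.snd K V K)) (A.hyps.image coneHyperplane)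
  isHyperplane := by
    intro H hH
    rcases Finset.mem_insert.1 hH with rfl | hH
    · refine ⟨LinearMap.snd K V K, fun h => ?_, rfl⟩
      simpa using LinearMap.congr_fun h (0, 1)
    · obtain ⟨H₀, hH₀, rfl⟩ := Finset.mem_image.1 hH
      obtain ⟨α, a, hα, rfl⟩ := A.isHyperplane H₀ hH₀
      refine ⟨_, fun h => hα ?_, (coneHyperplane_affineLevel α a hα).symm⟩
      ext x
      simpa using LinearMap.congr_fun h (x, 0)

namespace CentralArrangement

/-- `X` belongs to the intersection lattice `L(A)`; the empty intersection is `V`. -/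
def IsFlat (A : CentralArrangement K V) (X : Submodule K V) : Prop :=
  ∃ B ⊆ A.hyps, X = B.inf id

open scoped Classical in
/-- The deletion `A \ {H}`. -/
def delete (A : CentralArrangement K V) (H : Submodule K V) : CentralArrangement K V where
  hyps := A.hyps.erase H
  isHyperplane := fun H' h => A.isHyperplane H' (Finset.mem_of_mem_erase h)

open scoped Classical in
/-- The restriction `A^X = {H ∩ X | H ∈ A, X ⊄ H}`, an arrangement in `X`. -/
def restrict (A : CentralArrangement K V) (X : Submodule K V) : CentralArrangement K X where
  hyps := (A.hyps.filter fun H => ¬ X ≤ H).image fun H => H.comap X.subtype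
  isHyperplane := by
    intro H' h
    obtain ⟨H, hH, rfl⟩ := Finset.mem_image.1 h
    obtain ⟨hA, hX⟩ := Finset.mem_filter.1 hH
    obtain ⟨α, -, rfl⟩ := A.isHyperplane H hA
    refine ⟨α ∘ₗ X.subtype, fun h0 => hX fun x hx => ?_, LinearMap.ker_comp _ _⟩
    simpa using LinearMap.congr_fun h0 ⟨x, hx⟩

end CentralArrangement

/-! ### Derivations, freeness and exponents -/

variable (K V) in
/-- The algebra `S = S(V*)` of polynomial functions on `V`. -/
abbrev PolyAlg : Type (max u v) := SymmetricAlgebra K (Dual K V)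

variable (K V) in
/-- The homogeneous component `S_d`, spanned by the products of `d` linear forms. -/
def homogComp (d : ℕ) : Submodule K (PolyAlg K V) :=
  (LinearMap.range (SymmetricAlgebra.ι K (Dual K V))) ^ d

/-- A derivation of `S` is homogeneous of degree `d` if it is non-zero and all its coefficients,
that is, its values at linear forms, lie in `S_d`. -/
def IsHomogeneousDer (θ : Derivation K (PolyAlg K V) (PolyAlg K V)) (d : ℕ) : Prop :=
  θ ≠ 0 ∧ ∀ α : Dual K V, θ (SymmetricAlgebra.ι K (Dual K V) α) ∈ homogComp K V d

/-- A chosen linear form `α_H` with kernel `H` (meaningful if `H` is a linear hyperplane). -/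
def linForm (H : Submodule K V) : Dual K V :=
  Classical.epsilon fun α : Dual K V => LinearMap.ker α = H

theorem ker_linForm {H : Submodule K V} (hH : IsLinearHyperplane H) :
    LinearMap.ker (linForm H) = H := by
  obtain ⟨α, -, h⟩ := hH
  exact Classical.epsilon_spec (p := fun α : Dual K V => LinearMap.ker α = H) ⟨α, h⟩

namespace CentralArrangement

/-- The defining polynomial `Q(A) = ∏ α_H` (well defined up to a non-zero scalar). -/
def definingPoly (A : CentralArrangement K V) : PolyAlg K V :=
  ∏ H ∈ A.hyps, SymmetricAlgebra.ι K (Dual K V) (linForm H)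

/-- The `S`-module `D(A) = {θ ∈ Der(S) | θ(Q(A)) ∈ Q(A) S}` of `A`-derivations. -/
def derivations (A : CentralArrangement K V) :
    Submodule (PolyAlg K V) (Derivation K (PolyAlg K V) (PolyAlg K V)) where
  carrier := {θ | A.definingPoly ∣ θ A.definingPoly}
  zero_mem' := by simp
  add_mem' := by
    intro θ η hθ hη
    simpa using dvd_add hθ hη
  smul_mem' := by
    intro f θ hθ
    simpa using Dvd.dvd.mul_left hθ f

/-- `A` is free with multiset of exponents `E`: the `S`-module `D(A)` has a basis of homogeneous
derivations whose degrees form the multiset `E`. -/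
def IsFreeWithExp (A : CentralArrangement K V) (E : Multiset ℕ) : Prop :=
  ∃ (n : ℕ) (b : Basis (Fin n) (PolyAlg K V) A.derivations) (d : Fin n → ℕ),
    (∀ i, IsHomogeneousDer (b i : Derivation K (PolyAlg K V) (PolyAlg K V)) (d i)) ∧
    E = (Finset.univ : Finset (Fin n)).val.map d

end CentralArrangement

/-- The class of inductively free arrangements: the smallest class of arrangements that contains
the empty arrangements and contains `A` whenever there is `H ∈ A` such that `A^H` and `A \ {H}`
are in the class and `exp(A^H) ⊆ exp(A \ {H})`. -/
inductive IsInductivelyFree {K : Type u} [Field K] :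
    ∀ {V : Type v} [AddCommGroup V] [Module K V], CentralArrangement K V → Prop
  | empty {V : Type v} [AddCommGroup V] [Module K V] [FiniteDimensional K V]
      (A : CentralArrangement K V) (hA : A.hyps = ∅) : IsInductivelyFree A
  | step {V : Type v} [AddCommGroup V] [Module K V]
      (A : CentralArrangement K V) (H : Submodule K V) (hH : H ∈ A.hyps)
      (hres : IsInductivelyFree (A.restrict H)) (hdel : IsInductivelyFree (A.delete H))
      (Eres Edel : Multiset ℕ) (hEres : (A.restrict H).IsFreeWithExp Eres)
      (hEdel : (A.delete H).IsFreeWithExp Edel) (hE : Eres ≤ Edel) : IsInductivelyFree A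

/-! ### Flag-accuracy -/

namespace CentralArrangement

/-- `(X_1, …, X_n)`, `n = dim V`, is a witness for the accuracy of `A`: `A` is free with exponents
`e_1 ≤ … ≤ e_n`, and each `X_d` is a flat of dimension `d` such that `A^{X_d}` is free with
exponents `e_1, …, e_d`. Here `X_d` is written `X i` with `d = i + 1`. -/
def IsAccuracyWitness (A : CentralArrangement K V)
    (X : Fin (finrank K V) → Submodule K V) : Prop :=
  ∃ e : Fin (finrank K V) → ℕ, Monotone e ∧
    A.IsFreeWithExp ((Finset.univ : Finset (Fin (finrank K V))).val.map e) ∧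
    ∀ i, A.IsFlat (X i) ∧ finrank K (X i) = (i : ℕ) + 1 ∧
      (A.restrict (X i)).IsFreeWithExp ((Finset.Iic i).val.map e)

/-- A witness for flag-accuracy: a witness for accuracy that is a flag `X_1 ⊆ … ⊆ X_n`. -/
def IsFlagAccuracyWitness (A : CentralArrangement K V)
    (X : Fin (finrank K V) → Submodule K V) : Prop :=
  A.IsAccuracyWitness X ∧ Monotone X

def IsFlagAccurate (A : CentralArrangement K V) : Prop :=
  ∃ X, A.IsFlagAccuracyWitness X

/-- `A` is ind-flag-accurate: it is inductively free and flag-accurate, and some witness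
`(X_1, …, X_n)` for the flag-accuracy is such that every `A^{X_d}` is inductively free. -/
def IsIndFlagAccurate (A : CentralArrangement K V) : Prop :=
  IsInductivelyFree A ∧ A.IsFlagAccurate ∧
    ∃ X, A.IsFlagAccuracyWitness X ∧ ∀ i, IsInductivelyFree (A.restrict (X i))

end CentralArrangement

end Arrangements

/-! ### Digraphic arrangements

The vertex set `[ℓ] = {1, …, ℓ}` is modelled by `Fin ℓ`; the vertex `i : Fin ℓ` has the label
`i + 1`. -/

/-- The label in `{1, …, ℓ}` of a vertex. -/
def label {ℓ : ℕ} (i : Fin ℓ) : ℕ := (i : ℕ) + 1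

/-- The `i`-th coordinate function `x_i` on `ℝ^ℓ`. -/
def coord {ℓ : ℕ} (i : Fin ℓ) : Dual ℝ (Fin ℓ → ℝ) := LinearMap.proj i

theorem coord_ne_zero {ℓ : ℕ} (i : Fin ℓ) : coord i ≠ 0 := by
  intro h
  simpa [coord] using LinearMap.congr_fun h (Pi.single i 1)

theorem coord_sub_coord_ne_zero {ℓ : ℕ} {i j : Fin ℓ} (hij : i ≠ j) :
    coord i - coord j ≠ 0 := by
  intro h
  simpa [coord, hij.symm] using LinearMap.congr_fun h (Pi.single i 1)

open scoped Classical in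
/-- The `ψ`-digraphic arrangement in `ℝ^ℓ`, consisting of the hyperplanes `x_i - x_j = 0` for
`i < j`, `x_i - x_j = 1` for the edges `(i, j)`, and `x_i = a` for `a ∈ ψ(i)`.
(Loops play no role: digraphs here have edges between distinct vertices only.) -/
def digraphicArrangement {ℓ : ℕ} (G : Digraph (Fin ℓ)) (ψ : Fin ℓ → Finset ℤ) :
    AffineArrangement ℝ (Fin ℓ → ℝ) where
  hyps :=
    ((Finset.univ.filter fun q : Fin ℓ × Fin ℓ => q.1 < q.2).image
      fun q => affineLevel (coord q.1 - coord q.2) 0) ∪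
    ((Finset.univ.filter fun q : Fin ℓ × Fin ℓ => q.1 ≠ q.2 ∧ G.Adj q.1 q.2).image
      fun q => affineLevel (coord q.1 - coord q.2) 1) ∪
    (Finset.univ.biUnion fun i => (ψ i).image fun a : ℤ => affineLevel (coord i) (a : ℝ))
  isHyperplane := by
    intro H hH
    rcases Finset.mem_union.1 hH with hH | hH
    · rcases Finset.mem_union.1 hH with hH | hH
      · obtain ⟨q, hq, rfl⟩ := Finset.mem_image.1 hH
        exact ⟨_, _, coord_sub_coord_ne_zero (Finset.mem_filter.1 hq).2.ne, rfl⟩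
      · obtain ⟨q, hq, rfl⟩ := Finset.mem_image.1 hH
        exact ⟨_, _, coord_sub_coord_ne_zero (Finset.mem_filter.1 hq).2.1, rfl⟩
    · obtain ⟨i, -, hi⟩ := Finset.mem_biUnion.1 hH
      obtain ⟨a, -, rfl⟩ := Finset.mem_image.1 hi
      exact ⟨_, _, coord_ne_zero i, rfl⟩

/-- A digraph on `[ℓ]` with an interval weight `ψ(i) = [lo i, hi i] ⊆ ℤ`. -/
@[ext]
structure IntervalDigraph (ℓ : ℕ) where
  graph : Digraph (Fin ℓ)
  lo : Fin ℓ → ℤ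
  hi : Fin ℓ → ℤ

namespace IntervalDigraph

variable {ℓ : ℕ}

/-- The associated digraphic arrangement. -/
def arrangement (W : IntervalDigraph ℓ) : AffineArrangement ℝ (Fin ℓ → ℝ) :=
  digraphicArrangement W.graph fun i => Finset.Icc (W.lo i) (W.hi i)

/-- Mutation with respect to the vertex `v`, as a sink of the subgraph induced on `[v]`: all edges
`(i, v)` with `i ∈ [v] \ {v}` are removed, and `[a_i, b_i]` becomes `[a_i - 1, b_i]` for all
`i ∈ [v] \ {v}`. Everything else is unchanged. -/
def sinkMutation (W : IntervalDigraph ℓ) (v : ℕ) : IntervalDigraph ℓ where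
  graph := { Adj := fun i j => W.graph.Adj i j ∧ ¬ (label i < v ∧ label j = v) }
  lo := fun i => if label i < v then W.lo i - 1 else W.lo i
  hi := W.hi

/-- Mutation with respect to the vertex `v`, as a source of the subgraph induced on `[v]`: all
edges `(v, i)` with `i ∈ [v] \ {v}` are removed, and `[a_i, b_i]` becomes `[a_i, b_i + 1]` for all
`i ∈ [v] \ {v}`. Everything else is unchanged. -/
def sourceMutation (W : IntervalDigraph ℓ) (v : ℕ) : IntervalDigraph ℓ where
  graph := { Adj := fun i j => W.graph.Adj i j ∧ ¬ (label i = v ∧ label j < v) }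
  lo := W.lo
  hi := fun i => if label i < v then W.hi i + 1 else W.hi i

end IntervalDigraph

/-! ### Catalan descendants -/

/-- The origin of the Catalan descendant sequence: the complete digraph on `[ℓ]` with the weight
`[-c, m]` at the vertices `1, …, p` and `[-c, m + 1]` at the vertices `p + 1, …, ℓ`. -/
def catalanOrigin (ℓ p c m : ℕ) : IntervalDigraph ℓ where
  graph := { Adj := fun i j => i ≠ j }
  lo := fun _ => -(c : ℤ)
  hi := fun i => if label i ≤ p then (m : ℤ) else (m : ℤ) + 1

/-- The weighted digraph of the Catalan descendant `R^{p,k}_ℓ(c,m)`, for `k ≥ 1`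
(the value at `k = 0` is irrelevant). The `(k + 1)`-st one is obtained from the `k`-th one by
mutation with respect to the sink `ℓ - k + 1` of the subgraph induced on `[ℓ - k + 1]`, followed by
mutation with respect to the source `ℓ - k + 1` of the resulting subgraph. -/
def catalanDigraph (ℓ p c m : ℕ) : ℕ → IntervalDigraph ℓ
  | 0 => catalanOrigin ℓ p c m
  | 1 => catalanOrigin ℓ p c m
  | k + 2 => ((catalanDigraph ℓ p c m (k + 1)).sinkMutation (ℓ - (k + 1) + 1)).sourceMutation
      (ℓ - (k + 1) + 1)

/-- The weighted digraph of the intermediate Catalan descendant `R̂^{p,k}_ℓ(c,m)`. -/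
def catalanDigraphHat (ℓ p c m k : ℕ) : IntervalDigraph ℓ :=
  (catalanDigraph ℓ p c m k).sinkMutation (ℓ - k + 1)

/-- The Catalan descendant `R^{p,k}_ℓ(c,m)`, an arrangement in `ℝ^ℓ`. -/
def catalanDescendant (ℓ p k c m : ℕ) : AffineArrangement ℝ (Fin ℓ → ℝ) :=
  (catalanDigraph ℓ p c m k).arrangement

/-- The Catalan descendant `R̂^{p,k}_ℓ(c,m)`, an arrangement in `ℝ^ℓ`. -/
def catalanDescendantHat (ℓ p k c m : ℕ) : AffineArrangement ℝ (Fin ℓ → ℝ) :=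
  (catalanDigraphHat ℓ p c m k).arrangement

/-- The multiset `(1, ℓ - p + 1, 2, 3, …, ℓ) + (0, (m + ℓ + c - 1)^ℓ)` (for `p ≤ ℓ`, `1 ≤ c`). -/
def catalanExponents (ℓ p c m : ℕ) : Multiset ℕ :=
  1 ::ₘ ((ℓ - p + 1) ::ₘ (Finset.Icc 2 ℓ).val).map fun e => e + (m + ℓ + c - 1)

end Arr

end

/-! The proof works with inductive freeness that records exponents (`IsIndFree`): if the restriction
to H has exponents E and the deletion has d and E, then putting H back raises d to d + 1. That these
numbers are the degrees of an actual basis is Terao's addition theorem, `IsFreeWithExp.addition`.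
For θ in D(A') the values θ(α_H), restricted to H, are all multiples of one polynomial of degree
|A'| - |A''| = d. Counting basis elements of degree at most d shows that one of degree d is not
tangent to H; suitable multiples of it make the others tangent, and it is itself multiplied by α_H.

Two operations build the cones over digraphic arrangements. Adding x_i = a z is an addition step
whose restriction is again digraphic: the vertex i disappears and the other weights gain a and,
along edges at i, a + 1 or a - 1 (`hypSet_pullForms_insertCoord`). A last vertex without incoming
edges whose hyperplanes are pairwise compatible with the rest is a modular coatom and contributes
its number of hyperplanes as an exponent (`FormsIndFree.fiber`).

For the complete digraph with intervals of length L (`formsIndFree_complete`), all intervals are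
lengthened by one point, one vertex at a time. All these restrictions have the same exponents, so a
single exponent moves, and stopping after some of the vertices gives the arrangements with the
parameter p. Length 0 is the Catalan arrangement, which modulo translations is the case of one
vertex less and length 3. After the first sink mutation, the last vertex is a modular coatom, and
the same lengthening applies (`formsIndFree_sink`).

Flags come in two ways. With no source mutation yet, the hyperplane through the left end point of
the first vertex has a restriction of the same kind, which lacks exactly the largest exponent
(`formsFlagAccurate_complete`, `formsFlagAccurate_sink`). After a source mutation the last vertex is
isolated, and its coatom has the smallest exponent after 1; there the flag is lifted by taking X ×
K, and a line is inserted below (`FormsFlagAccurate.fiber`). The fibre hyperplanes must stay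
distinct on every member of the flag, so the induction in `exists_formsFlagAccurate_descendant`
carries a generator of the line with distinct coordinates, none above the left end point of the last
vertex. -/

open Module

noncomputable section

namespace Arr

universe u v w

/-! ### Polynomial functions: grading, pullback, divisibility by linear forms. -/

section Polynomials

variable {K : Type u} [Field K] {V : Type v} [AddCommGroup V] [Module K V]
  {W : Type w} [AddCommGroup W] [Module K W]

variable (K V) in
/-- The inclusion of linear forms into polynomial functions. -/
abbrev lin : Dual K V →ₗ[K] PolyAlg K V := SymmetricAlgebra.ι K (Dual K V)

/-- Evaluation of polynomial functions at a vector. -/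
def evalAt (x : V) : PolyAlg K V →ₐ[K] K := SymmetricAlgebra.lift (Dual.eval K V x)

@[simp] theorem evalAt_lin (x : V) (α : Dual K V) : evalAt x (lin K V α) = α x := by
  simp [evalAt]

theorem lin_ne_zero {α : Dual K V} (hα : α ≠ 0) : lin K V α ≠ 0 := by
  intro h
  apply hα
  ext x
  simpa using congrArg (evalAt x) h

theorem lin_eq_zero_iff {α : Dual K V} : lin K V α = 0 ↔ α = 0 :=
  ⟨fun h => by_contra fun h' => lin_ne_zero h' h, fun h => by simp [h]⟩

/-- A basis of the dual space makes this a polynomial ring; no finiteness is needed. Unique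
factorization lets coprime linear forms be multiplied in divisibility statements. -/
instance : UniqueFactorizationMonoid (PolyAlg K V) :=
  MulEquiv.uniqueFactorizationMonoid
    (SymmetricAlgebra.equivMvPolynomial (Basis.ofVectorSpace K (Dual K V))).symm.toMulEquiv
    inferInstance

/-! ### The grading -/

/-- The algebra map `α ↦ α t` that records the grading. -/
def gradeHom : PolyAlg K V →ₐ[K] Polynomial (PolyAlg K V) :=
  SymmetricAlgebra.lift
    (LinearMap.mulLeft K Polynomial.X ∘ₗ
      (Polynomial.CAlgHom (R := K) (A := PolyAlg K V)).toLinearMap ∘ₗ lin K V)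

@[simp] theorem gradeHom_lin (α : Dual K V) :
    gradeHom (lin K V α) = Polynomial.X * Polynomial.C (lin K V α) := by
  simp [gradeHom]

theorem gradeHom_of_mem {d : ℕ} {f : PolyAlg K V} (hf : f ∈ homogComp K V d) :
    gradeHom f = Polynomial.C f * Polynomial.X ^ d := by
  unfold homogComp at hf
  induction d generalizing f with
  | zero =>
    rw [pow_zero, Submodule.mem_one] at hf
    obtain ⟨c, rfl⟩ := hf
    simp [Polynomial.algebraMap_apply]
  | succ d ih =>
    rw [pow_succ] at hf
    induction hf using Submodule.mul_induction_on' with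
    | mem_mul_mem m hm n hn =>
      obtain ⟨α, rfl⟩ := hn
      rw [map_mul, ih hm, gradeHom_lin, Polynomial.C_mul]
      ring
    | add x _ y _ hx hy => rw [map_add, hx, hy, Polynomial.C_add, add_mul]

/-- The homogeneous component of degree `d` of a polynomial. -/
def homogPart (d : ℕ) : PolyAlg K V →ₗ[K] PolyAlg K V :=
  (Polynomial.lcoeff (PolyAlg K V) d).restrictScalars K ∘ₗ gradeHom.toLinearMap

theorem homogPart_apply (d : ℕ) (f : PolyAlg K V) : homogPart d f = (gradeHom f).coeff d := rfl

theorem homogPart_mem (d : ℕ) (f : PolyAlg K V) : homogPart d f ∈ homogComp K V d := by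
  simp only [homogPart_apply]
  induction f using SymmetricAlgebra.induction generalizing d with
  | algebraMap c =>
    rw [AlgHom.commutes, Polynomial.algebraMap_apply, Polynomial.coeff_C]
    split_ifs with h
    · subst h
      exact Submodule.algebraMap_mem c
    · exact zero_mem _
  | ι α =>
    rw [gradeHom_lin, mul_comm, Polynomial.coeff_C_mul, Polynomial.coeff_X]
    split_ifs with h
    · subst h
      simp [homogComp]
    · simp
  | mul f g hf hg =>
    rw [map_mul, Polynomial.coeff_mul]
    refine Submodule.sum_mem _ fun x hx => ?_
    rw [← Finset.HasAntidiagonal.mem_antidiagonal.1 hx, homogComp, pow_add]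
    exact Submodule.mul_mem_mul (hf _) (hg _)
  | add f g hf hg =>
    rw [map_add, Polynomial.coeff_add]
    exact add_mem (hf _) (hg _)

theorem homogPart_of_mem {d : ℕ} {f : PolyAlg K V} (hf : f ∈ homogComp K V d) :
    homogPart d f = f := by
  simp [homogPart_apply, gradeHom_of_mem hf]

theorem homogPart_mul_of_le {d e : ℕ} (h : e ≤ d) (f : PolyAlg K V) {g : PolyAlg K V}
    (hg : g ∈ homogComp K V e) : homogPart d (f * g) = homogPart (d - e) f * g := by
  obtain ⟨k, rfl⟩ := Nat.exists_eq_add_of_le' h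
  rw [homogPart_apply, map_mul, gradeHom_of_mem hg, ← mul_assoc, Polynomial.coeff_mul_X_pow,
    Polynomial.coeff_mul_C, Nat.add_sub_cancel, homogPart_apply]

theorem homogPart_mul_of_lt {d e : ℕ} (h : d < e) (f : PolyAlg K V) {g : PolyAlg K V}
    (hg : g ∈ homogComp K V e) : homogPart d (f * g) = 0 := by
  rw [homogPart_apply, map_mul, gradeHom_of_mem hg, ← mul_assoc, Polynomial.coeff_mul_X_pow',
    if_neg (by omega)]

theorem mul_mem_homogComp {d e : ℕ} {f g : PolyAlg K V} (hf : f ∈ homogComp K V d)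
    (hg : g ∈ homogComp K V e) : f * g ∈ homogComp K V (d + e) := by
  rw [homogComp, pow_add]
  exact Submodule.mul_mem_mul hf hg

theorem lin_mem_homogComp (α : Dual K V) : lin K V α ∈ homogComp K V 1 := by
  simp [homogComp]

theorem mem_homogComp_zero {f : PolyAlg K V} (hf : f ∈ homogComp K V 0) :
    ∃ c : K, algebraMap K (PolyAlg K V) c = f := by
  rw [homogComp, pow_zero, Submodule.mem_one] at hf
  exact hf

theorem pow_mem_homogComp {d : ℕ} {f : PolyAlg K V} (hf : f ∈ homogComp K V d) (n : ℕ) :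
    f ^ n ∈ homogComp K V (d * n) := by
  rw [homogComp, pow_mul]
  exact Submodule.pow_mem_pow _ hf n

theorem prod_mem_homogComp {ι : Type*} (s : Finset ι) (f : ι → PolyAlg K V) (d : ι → ℕ)
    (h : ∀ i ∈ s, f i ∈ homogComp K V (d i)) : ∏ i ∈ s, f i ∈ homogComp K V (∑ i ∈ s, d i) := by
  classical
  induction s using Finset.induction_on with
  | empty =>
    rw [Finset.prod_empty, Finset.sum_empty, homogComp, pow_zero]
    exact Submodule.one_le.1 le_rfl
  | insert i s his ih =>
    rw [Finset.prod_insert his, Finset.sum_insert his]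
    exact mul_mem_homogComp (h i (Finset.mem_insert_self i s))
      (ih fun j hj => h j (Finset.mem_insert_of_mem hj))

/-! ### Pullback of polynomial functions -/

/-- Pullback of polynomial functions along a linear map. -/
def pull (f : W →ₗ[K] V) : PolyAlg K V →ₐ[K] PolyAlg K W :=
  SymmetricAlgebra.lift (lin K W ∘ₗ f.dualMap)

@[simp] theorem pull_lin (f : W →ₗ[K] V) (α : Dual K V) :
    pull f (lin K V α) = lin K W (α ∘ₗ f) := by
  rw [pull, SymmetricAlgebra.lift_ι_apply]; rfl

theorem pull_pull_of_comp_eq_id (f : W →ₗ[K] V) (g : V →ₗ[K] W) (h : g ∘ₗ f = LinearMap.id)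
    (x : PolyAlg K W) : pull f (pull g x) = x := by
  have : (pull f).comp (pull g) = AlgHom.id K (PolyAlg K W) := by
    apply SymmetricAlgebra.algHom_ext
    ext1 α
    simp [LinearMap.comp_assoc, h]
  exact DFunLike.congr_fun this x

theorem pull_mem_homogComp (f : W →ₗ[K] V) {d : ℕ} {x : PolyAlg K V} (hx : x ∈ homogComp K V d) :
    pull f x ∈ homogComp K W d := by
  have h1 : (LinearMap.range (lin K V)).map (pull f).toLinearMap ≤ LinearMap.range (lin K W) := by
    rintro _ ⟨_, ⟨α, rfl⟩, rfl⟩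
    exact ⟨α ∘ₗ f, (pull_lin f α).symm⟩
  have h2 := Submodule.mem_map_of_mem (f := (pull f).toLinearMap) hx
  rw [homogComp, Submodule.map_pow] at h2
  exact pow_le_pow_left' h1 d h2

theorem exists_proj (H : Submodule K V) : ∃ π : V →ₗ[K] H, π ∘ₗ H.subtype = LinearMap.id :=
  H.exists_isCompl.elim fun q hq =>
    ⟨H.projectionOnto q hq, Submodule.projectionOnto_comp_subtype hq⟩

theorem exists_smul_of_ker_le {α β : Dual K V} (h : LinearMap.ker α ≤ LinearMap.ker β) :
    ∃ c : K, β = c • α := by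
  have := (Submodule.mem_span_singleton (R := K) (x := β) (y := α)).1
    (by
      have := mem_span_of_iInf_ker_le_ker (ι := Unit) (L := fun _ => α) (K := β) (by simpa using h)
      simpa using this)
  obtain ⟨c, hc⟩ := this
  exact ⟨c, hc.symm⟩

section Hyperplane

variable {H : Submodule K V} {α : Dual K V} (hα : LinearMap.ker α = H)
  {π : V →ₗ[K] H} (hπ : π ∘ₗ H.subtype = LinearMap.id)

include hα in
theorem exists_smul_of_comp_subtype_eq_zero {β : Dual K V} (h : β ∘ₗ H.subtype = 0) :
    ∃ c : K, β = c • α := by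
  apply exists_smul_of_ker_le
  rw [hα]
  intro x hx
  exact LinearMap.congr_fun h ⟨x, hx⟩

include hα hπ in
theorem exists_sub_proj_eq_smul (β : Dual K V) :
    ∃ c : K, β - (β ∘ₗ H.subtype) ∘ₗ π = c • α := by
  apply exists_smul_of_comp_subtype_eq_zero hα
  rw [LinearMap.sub_comp, LinearMap.comp_assoc, hπ, LinearMap.comp_id, sub_self]

include hα hπ in
-- Modulo α, the identity and restriction to H followed by π are algebra maps that agree on linear
-- forms, hence everywhere.
theorem lin_dvd_sub_pull_pull (f : PolyAlg K V) :
    lin K V α ∣ f - pull π (pull H.subtype f) := by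
  rw [← Ideal.mem_span_singleton]
  let I : Ideal (PolyAlg K V) := Ideal.span {lin K V α}
  have : (Ideal.Quotient.mkₐ K I) =
      (Ideal.Quotient.mkₐ K I).comp ((pull π).comp (pull H.subtype)) := by
    apply SymmetricAlgebra.algHom_ext
    ext1 β
    obtain ⟨c, hc⟩ := exists_sub_proj_eq_smul hα hπ β
    change Ideal.Quotient.mk I (lin K V β) =
      Ideal.Quotient.mk I (pull π (pull H.subtype (lin K V β)))
    rw [pull_lin, pull_lin, Ideal.Quotient.eq, ← map_sub, hc, map_smul]
    exact Submodule.smul_of_tower_mem I c (Ideal.mem_span_singleton_self _)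
  have h := DFunLike.congr_fun this f
  exact Ideal.Quotient.eq.1 h

include hα in
-- This translates tangency to H, a divisibility, into a vanishing statement on H; all later
-- arguments on H pass through it.
theorem pull_subtype_eq_zero_iff {f : PolyAlg K V} :
    pull H.subtype f = 0 ↔ lin K V α ∣ f := by
  obtain ⟨π, hπ⟩ := exists_proj H
  constructor
  · intro h
    simpa [h] using lin_dvd_sub_pull_pull hα hπ f
  · rintro ⟨g, rfl⟩
    have : α ∘ₗ H.subtype = 0 := by
      ext x
      exact hα.ge x.2
    rw [map_mul, pull_lin, this, map_zero, zero_mul]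

end Hyperplane

/-- The ideal of α is the kernel of restriction to its hyperplane, whose ring of polynomial
functions is a domain. -/
theorem prime_lin {α : Dual K V} (hα : α ≠ 0) : Prime (lin K V α) := by
  refine ⟨lin_ne_zero hα, fun h => ?_, fun f g h => ?_⟩
  · have := h.map (evalAt (0 : V))
    simp at this
  · rw [← pull_subtype_eq_zero_iff rfl] at h ⊢
    rw [← pull_subtype_eq_zero_iff rfl]
    simpa using h

theorem ker_eq_of_lin_dvd_lin {α β : Dual K V} (hβ : β ≠ 0) (h : lin K V α ∣ lin K V β) :
    LinearMap.ker α = LinearMap.ker β := by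
  have h1 := (pull_subtype_eq_zero_iff (H := LinearMap.ker α) rfl).2 h
  rw [pull_lin, lin_eq_zero_iff] at h1
  obtain ⟨c, hc⟩ := exists_smul_of_comp_subtype_eq_zero rfl h1
  have hc0 : c ≠ 0 := by
    rintro rfl
    exact hβ (by simpa using hc)
  rw [hc, LinearMap.ker_smul _ _ hc0]

end Polynomials

/-! ### Bases of submodules as independent spanning families. -/

section Bases

variable {S : Type u} {M : Type v} {ι : Type w} [CommRing S] [AddCommGroup M] [Module S M]
  {N : Submodule S M}

theorem linearIndependent_coe_basis (b : Basis ι S N) : LinearIndependent S fun i => (b i : M) :=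
  b.linearIndependent.map' N.subtype (Submodule.ker_subtype _)

theorem span_range_coe_basis (b : Basis ι S N) :
    Submodule.span S (Set.range fun i => (b i : M)) = N := by
  have := congrArg (Submodule.map N.subtype) b.span_eq
  rw [Submodule.map_span, Submodule.map_top, Submodule.range_subtype, ← Set.range_comp] at this
  exact this

theorem exists_coe_basis {v : ι → M} (hli : LinearIndependent S v)
    (hspan : Submodule.span S (Set.range v) = N) : ∃ b : Basis ι S N, ∀ i, (b i : M) = v i := by
  subst hspan
  exact ⟨Basis.span hli, fun i => congrArg Subtype.val (Basis.span_apply hli i)⟩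

theorem sum_sub_mul_smul [Fintype ι] (g k : ι → S) (a : S) (v : ι → M) :
    ∑ i, (g i - a * k i) • v i = ∑ i, g i • v i - a • ∑ i, k i • v i := by
  simp only [sub_smul, Finset.sum_sub_distrib, Finset.smul_sum, mul_smul]

end Bases

/-! ### Derivations of the polynomial algebra and the module D(A). -/

section Derivations

variable {K : Type u} [Field K] {V : Type v} [AddCommGroup V] [Module K V]

variable (K V) in
/-- Derivations of the algebra of polynomial functions. -/
abbrev Der : Type (max u v) := Derivation K (PolyAlg K V) (PolyAlg K V)

theorem Der.ext_lin {θ η : Der K V} (h : ∀ α, θ (lin K V α) = η (lin K V α)) : θ = η := by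
  ext f
  induction f using SymmetricAlgebra.induction with
  | algebraMap c => simp
  | ι α => exact h α
  | mul f g hf hg => simp [hf, hg]
  | add f g hf hg => simp [hf, hg]

/-- The derivation with prescribed values at the linear forms. -/
theorem Der.exists_lin (L : Dual K V →ₗ[K] PolyAlg K V) :
    ∃ θ : Der K V, ∀ α, θ (lin K V α) = L α := by
  -- A derivation θ is the same as the algebra map f ↦ f + ε θ(f) with ε² = 0, and algebra maps may
  -- be prescribed freely on linear forms.
  let M : Dual K V →ₗ[K] TrivSqZeroExt (PolyAlg K V) (PolyAlg K V) :=
    (TrivSqZeroExt.inlAlgHom K (PolyAlg K V) (PolyAlg K V)).toLinearMap ∘ₗ lin K V +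
      ((TrivSqZeroExt.inrHom (PolyAlg K V) (PolyAlg K V)).restrictScalars K) ∘ₗ L
  let F : PolyAlg K V →ₐ[K] TrivSqZeroExt (PolyAlg K V) (PolyAlg K V) := SymmetricAlgebra.lift M
  have hF : ∀ α, F (lin K V α) = TrivSqZeroExt.inl (lin K V α) + TrivSqZeroExt.inr (L α) :=
    fun α => SymmetricAlgebra.lift_ι_apply M α
  have hfst : ∀ f, (F f).fst = f := by
    have : (TrivSqZeroExt.fstHom K (PolyAlg K V) (PolyAlg K V)).comp F = AlgHom.id K _ := by
      apply SymmetricAlgebra.algHom_ext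
      ext1 α
      change (F (lin K V α)).fst = lin K V α
      simp [hF]
    exact DFunLike.congr_fun this
  refine ⟨Derivation.mk'
    (((TrivSqZeroExt.sndHom (PolyAlg K V) (PolyAlg K V)).restrictScalars K) ∘ₗ F.toLinearMap)
    ?_, ?_⟩
  · intro a b
    change (F (a * b)).snd = a • (F b).snd + b • (F a).snd
    rw [map_mul, TrivSqZeroExt.snd_mul, hfst, hfst, op_smul_eq_smul]
  · intro α
    change (F (lin K V α)).snd = L α
    simp [hF]

theorem Der.sum_apply {ι : Type*} (s : Finset ι) (θ : ι → Der K V) (f : PolyAlg K V) :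
    (∑ i ∈ s, θ i) f = ∑ i ∈ s, θ i f := by
  classical
  induction s using Finset.induction_on with
  | empty => simp
  | insert i s his ih => rw [Finset.sum_insert his, Finset.sum_insert his, Derivation.add_apply, ih]

theorem dvd_derivation_congr (θ : Der K V) {α β : Dual K V} (h : LinearMap.ker α = LinearMap.ker β)
    (hα : lin K V α ∣ θ (lin K V α)) : lin K V β ∣ θ (lin K V β) := by
  obtain ⟨c, hc⟩ := exists_smul_of_ker_le h.le
  obtain ⟨c', hc'⟩ := exists_smul_of_ker_le h.ge
  have h1 : lin K V β ∣ lin K V α := by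
    rw [hc', map_smul, Algebra.smul_def]
    exact dvd_mul_left _ _
  rw [show θ (lin K V β) = c • θ (lin K V α) by rw [hc, map_smul, Derivation.map_smul],
    Algebra.smul_def]
  exact (h1.trans hα).mul_left _

theorem derivation_apply_smul_lin_add (θ : Der K V) (c b : K) (α β : Dual K V) :
    θ (lin K V (c • α + b • β)) = c • θ (lin K V α) + b • θ (lin K V β) := by
  simp

theorem IsLinearHyperplane.linForm_ne_zero {H : Submodule K V} (hH : IsLinearHyperplane H) :
    linForm H ≠ 0 := by
  intro h
  have h1 := ker_linForm hH
  obtain ⟨α, hα, rfl⟩ := hH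
  rw [h, LinearMap.ker_zero, eq_comm, LinearMap.ker_eq_top] at h1
  exact hα h1

theorem IsLinearHyperplane.eq_of_le {H H' : Submodule K V} (hH : IsLinearHyperplane H)
    (hH' : IsLinearHyperplane H') (h : H ≤ H') : H = H' := by
  obtain ⟨α, hα, rfl⟩ := hH
  obtain ⟨β, hβ, rfl⟩ := hH'
  obtain ⟨c, rfl⟩ := exists_smul_of_ker_le h
  rw [LinearMap.ker_smul]
  rintro rfl
  simp at hβ

theorem IsLinearHyperplane.prime {H : Submodule K V} (hH : IsLinearHyperplane H) :
    Prime (lin K V (linForm H)) := prime_lin hH.linForm_ne_zero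

theorem IsLinearHyperplane.not_dvd {H H' : Submodule K V} (hH : IsLinearHyperplane H)
    (hH' : IsLinearHyperplane H') (h : H ≠ H') :
    ¬ lin K V (linForm H) ∣ lin K V (linForm H') := by
  intro hd
  have := ker_eq_of_lin_dvd_lin hH'.linForm_ne_zero hd
  rw [ker_linForm hH, ker_linForm hH'] at this
  exact h this

theorem IsLinearHyperplane.isRelPrime {H H' : Submodule K V} (hH : IsLinearHyperplane H)
    (hH' : IsLinearHyperplane H') (h : H ≠ H') :
    IsRelPrime (lin K V (linForm H)) (lin K V (linForm H')) :=
  hH.prime.irreducible.isRelPrime_iff_not_dvd.2 (hH.not_dvd hH' h)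

theorem prod_dvd_derivation_prod {ι : Type*} (s : Finset ι) (f : ι → PolyAlg K V) (θ : Der K V)
    (h : ∀ i ∈ s, f i ∣ θ (f i)) : ∏ i ∈ s, f i ∣ θ (∏ i ∈ s, f i) := by
  classical
  induction s using Finset.induction_on with
  | empty => simp
  | insert i s his ih =>
    rw [Finset.prod_insert his, Derivation.leibniz, smul_eq_mul, smul_eq_mul]
    refine dvd_add (mul_dvd_mul_left _ (ih fun j hj => h j (Finset.mem_insert_of_mem hj))) ?_
    rw [mul_comm]
    exact mul_dvd_mul_left _ (h i (Finset.mem_insert_self i s))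

namespace CentralArrangement

/-- Expand θ(Q) by the Leibniz rule: modulo α_H only θ(α_H) times the product of the other forms
survives, and the prime α_H divides none of those forms. -/
theorem mem_derivations_iff (A : CentralArrangement K V) (θ : Der K V) :
    θ ∈ A.derivations ↔ ∀ H ∈ A.hyps, lin K V (linForm H) ∣ θ (lin K V (linForm H)) := by
  classical
  constructor
  · intro (h : A.definingPoly ∣ θ A.definingPoly) H hH
    have hHl := A.isHyperplane H hH
    rw [definingPoly, ← Finset.mul_prod_erase _ _ hH, Derivation.leibniz, smul_eq_mul,
      smul_eq_mul] at h
    have h1 := (dvd_add_right (dvd_mul_right _ _)).1 ((dvd_mul_right _ _).trans h)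
    refine (hHl.prime.dvd_or_dvd h1).resolve_left fun h2 => ?_
    obtain ⟨H', hH', h3⟩ := (hHl.prime.dvd_finsetProd_iff _).1 h2
    exact hHl.not_dvd (A.isHyperplane H' (Finset.mem_of_mem_erase hH'))
      (Finset.ne_of_mem_erase hH').symm h3
  · exact prod_dvd_derivation_prod _ _ θ

end CentralArrangement

/-- The values of `θ` at linear forms are homogeneous of degree `d`. -/
def HasDegree (θ : Der K V) (d : ℕ) : Prop := ∀ α, θ (lin K V α) ∈ homogComp K V d

theorem HasDegree.sub {θ η : Der K V} {d : ℕ} (hθ : HasDegree θ d) (hη : HasDegree η d) :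
    HasDegree (θ - η) d := fun α => sub_mem (hθ α) (hη α)

theorem HasDegree.smul {θ : Der K V} {d e : ℕ} {f : PolyAlg K V} (hf : f ∈ homogComp K V e)
    (hθ : HasDegree θ d) : HasDegree (f • θ) (e + d) := fun α => mul_mem_homogComp hf (hθ α)

namespace CentralArrangement

/-- Bases are handled as families in the ambient module of derivations; that their members are
non-zero follows from independence. -/
theorem isFreeWithExp_iff (A : CentralArrangement K V) (E : Multiset ℕ) :
    A.IsFreeWithExp E ↔ ∃ (n : ℕ) (b : Fin n → Der K V) (d : Fin n → ℕ),
      LinearIndependent (PolyAlg K V) b ∧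
      Submodule.span (PolyAlg K V) (Set.range b) = A.derivations ∧
      (∀ i, HasDegree (b i) (d i)) ∧ E = (Finset.univ : Finset (Fin n)).val.map d := by
  constructor
  · rintro ⟨n, b, d, h, hE⟩
    refine ⟨n, fun i => b i, d, ?_, ?_, fun i => (h i).2, hE⟩
    · exact linearIndependent_coe_basis b
    · exact span_range_coe_basis b
  · rintro ⟨n, b, d, hli, hspan, h, hE⟩
    obtain ⟨c, hc⟩ := exists_coe_basis hli hspan
    refine ⟨n, c, d, fun i => ?_, hE⟩
    rw [hc]
    exact ⟨hli.ne_zero i, h i⟩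

/-- The partial derivatives in a system of coordinates form a basis, with constant coefficients. -/
theorem isFreeWithExp_of_hyps_eq_empty [FiniteDimensional K V] (A : CentralArrangement K V)
    (hA : A.hyps = ∅) : A.IsFreeWithExp (Multiset.replicate (finrank K V) 0) := by
  let β := (finBasis K V).dualBasis
  choose θ hθ using fun i =>
    Der.exists_lin (β.constr K (fun j => if j = i then (1 : PolyAlg K V) else 0))
  have hθβ : ∀ i j, θ i (lin K V (β j)) = if j = i then 1 else 0 := fun i j => by
    rw [hθ, Basis.constr_basis]
  have key : ∀ (g : Fin (finrank K V) → PolyAlg K V) j,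
      (∑ i, g i • θ i) (lin K V (β j)) = g j := by
    intro g j
    simp [Der.sum_apply, hθβ]
  refine (A.isFreeWithExp_iff _).2 ⟨_, θ, fun _ => 0, ?_, ?_, ?_, by simp⟩
  · rw [Fintype.linearIndependent_iff]
    intro g hg i
    rw [← key g i, hg, Derivation.zero_apply]
  · refine le_antisymm (fun η _ => ?_) (fun η _ => ?_)
    · rw [mem_derivations_iff, hA]
      simp
    · refine (Submodule.mem_span_range_iff_exists_fun _).2 ⟨fun i => η (lin K V (β i)), ?_⟩
      apply Der.ext_lin
      intro α
      have : (∑ i, η (lin K V (β i)) • θ i : Der K V).toLinearMap ∘ₗ lin K V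
          = η.toLinearMap ∘ₗ lin K V := by
        refine β.ext fun j => ?_
        exact key _ j
      exact LinearMap.congr_fun this α
  · intro i α
    rw [hθ]
    have : LinearMap.range (β.constr K (fun j => if j = i then (1 : PolyAlg K V) else 0))
        ≤ homogComp K V 0 := by
      rw [Basis.constr_range, Submodule.span_le]
      rintro _ ⟨j, rfl⟩
      simp only
      split_ifs
      · exact Submodule.one_le.1 (by rw [homogComp, pow_zero])
      · exact zero_mem _
    exact this ⟨α, rfl⟩

end CentralArrangement

end Derivations

/-! ### Terao's divisibility and the restriction of derivations to a hyperplane. -/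

section Restriction

variable {K : Type u} [Field K] {V : Type v} [AddCommGroup V] [Module K V]

theorem lin_dvd_lin_of_ker_le {α β : Dual K V} (h : LinearMap.ker α ≤ LinearMap.ker β) :
    lin K V α ∣ lin K V β := by
  obtain ⟨c, rfl⟩ := exists_smul_of_ker_le h
  rw [map_smul, Algebra.smul_def]
  exact dvd_mul_left _ _

namespace CentralArrangement

variable {A : CentralArrangement K V} {H : Submodule K V}

open scoped Classical in
-- A hyperplane containing the hyperplane H equals H, so the only member discarded in the
-- restriction is H itself.
theorem restrict_hyps (hH : H ∈ A.hyps) :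
    (A.restrict H).hyps = (A.delete H).hyps.image fun H' => H'.comap H.subtype := by
  ext X
  simp only [restrict, delete, Finset.mem_image, Finset.mem_filter, Finset.mem_erase]
  constructor
  · rintro ⟨H', ⟨h1, h2⟩, h3⟩
    exact ⟨H', ⟨fun h => h2 h.ge, h1⟩, h3⟩
  · rintro ⟨H', ⟨h1, h2⟩, h3⟩
    exact ⟨H', ⟨h2, fun h =>
      h1 ((A.isHyperplane H hH).eq_of_le (A.isHyperplane H' h2) h).symm⟩, h3⟩

theorem ker_linForm_comp_subtype {H' : Submodule K V} (h : H' ∈ A.hyps) :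
    LinearMap.ker (linForm H' ∘ₗ H.subtype) = H'.comap H.subtype := by
  rw [LinearMap.ker_comp, ker_linForm (A.isHyperplane H' h)]

/-- The local factor at X of Terao's polynomial. Fix H₁ in F with form α₁. The expression θ(α) α₁ -
α θ(α₁) is divisible by the forms of all members of F. On H its second term vanishes and all these
forms become multiples of the form of X, one of which cancels against α₁. -/
theorem linForm_pow_dvd (hH : H ∈ A.hyps) {θ : Der K V} (hθ : θ ∈ (A.delete H).derivations)
    {X : Submodule K H} (hX : IsLinearHyperplane X) (F : Finset (Submodule K V))
    (hF : ∀ H' ∈ F, H' ∈ (A.delete H).hyps ∧ H'.comap H.subtype = X) :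
    lin K H (linForm X) ^ (F.card - 1) ∣ pull H.subtype (θ (lin K V (linForm H))) := by
  obtain rfl | ⟨H₁, hH₁⟩ := F.eq_empty_or_nonempty
  · simp
  have hα := ker_linForm (A.isHyperplane H hH)
  have hker : ∀ H' ∈ F, LinearMap.ker (linForm H' ∘ₗ H.subtype) = LinearMap.ker (linForm X) := by
    intro H' h
    rw [ker_linForm_comp_subtype (hF H' h).1, (hF H' h).2, ker_linForm hX]
  have hdvd : ∏ H' ∈ F, lin K V (linForm H') ∣
      θ (lin K V (linForm H)) * lin K V (linForm H₁) -
        lin K V (linForm H) * θ (lin K V (linForm H₁)) := by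
    refine Finset.prod_dvd_of_isRelPrime (fun a ha b hb hab => ?_) (fun H' h => ?_)
    · exact ((A.delete H).isHyperplane a (hF a ha).1).isRelPrime
        ((A.delete H).isHyperplane b (hF b hb).1) hab
    -- On H the forms of H₁ and H' are proportional, so α₁ = c α' + b α. The expression is
    -- alternating in α and α₁, so the term b α drops out and only c (θ(α) α' - α θ(α')) is left.
    · obtain ⟨c, hc⟩ := exists_smul_of_ker_le ((hker H' h).trans (hker H₁ hH₁).symm).le
      have h0 : (linForm H₁ - c • linForm H') ∘ₗ H.subtype = 0 := by
        rw [LinearMap.sub_comp, hc, LinearMap.smul_comp, sub_self]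
      obtain ⟨b, hb⟩ := exists_smul_of_comp_subtype_eq_zero hα h0
      have h1 : linForm H₁ = c • linForm H' + b • linForm H := by rw [← hb]; abel
      have h2 := (mem_derivations_iff _ θ).1 hθ H' (hF H' h).1
      have h3 : θ (lin K V (linForm H)) * lin K V (linForm H₁) -
          lin K V (linForm H) * θ (lin K V (linForm H₁)) =
          algebraMap K _ c * (θ (lin K V (linForm H)) * lin K V (linForm H') -
            lin K V (linForm H) * θ (lin K V (linForm H'))) := by
        rw [h1]
        rw [derivation_apply_smul_lin_add, map_add, map_smul, map_smul]
        simp only [Algebra.smul_def]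
        ring
      rw [h3]
      exact ((dvd_mul_left _ _).sub (h2.mul_left _)).mul_left _
  have h4 := map_dvd (pull H.subtype) hdvd
  rw [map_sub, map_mul, map_mul,
    (pull_subtype_eq_zero_iff hα (f := lin K V (linForm H))).2 dvd_rfl, zero_mul, sub_zero,
    map_prod] at h4
  have h5 : lin K H (linForm X) ^ F.card ∣ ∏ H' ∈ F, pull H.subtype (lin K V (linForm H')) := by
    rw [← Finset.prod_const]
    refine Finset.prod_dvd_prod_of_dvd _ _ fun H' h => ?_
    rw [pull_lin]
    exact lin_dvd_lin_of_ker_le (hker H' h).ge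
  have h6 : pull H.subtype (lin K V (linForm H₁)) ∣ lin K H (linForm X) := by
    rw [pull_lin]
    exact lin_dvd_lin_of_ker_le (hker H₁ hH₁).le
  have h7 := (h5.trans h4).trans (mul_dvd_mul_left _ h6)
  obtain ⟨k, hk⟩ := Nat.exists_eq_succ_of_ne_zero (Finset.card_ne_zero_of_mem hH₁)
  rw [hk, Nat.succ_eq_add_one, pow_succ] at h7
  rw [hk, Nat.succ_eq_add_one, Nat.add_sub_cancel]
  exact (mul_dvd_mul_iff_right (lin_ne_zero hX.linForm_ne_zero)).1 h7

/-- Terao's polynomial `B`, restricted to `H`. -/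
theorem exists_dvd_pull_derivation (hH : H ∈ A.hyps) :
    ∃ B : PolyAlg K H, B ≠ 0 ∧
      B ∈ homogComp K H ((A.delete H).hyps.card - (A.restrict H).hyps.card) ∧
      ∀ θ ∈ (A.delete H).derivations, B ∣ pull H.subtype (θ (lin K V (linForm H))) := by
  classical
  let F : Submodule K H → Finset (Submodule K V) := fun X =>
    (A.delete H).hyps.filter fun H' => H'.comap H.subtype = X
  have hF : ∀ X, ∀ H' ∈ F X, H' ∈ (A.delete H).hyps ∧ H'.comap H.subtype = X := fun X H' h =>
    Finset.mem_filter.1 h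
  -- `F X` collects the hyperplanes that cut H in X. The exponents `(F X).card - 1` add up to |A'| -
  -- |A''|, because every `F X` is non-empty.
  refine ⟨∏ X ∈ (A.restrict H).hyps, lin K H (linForm X) ^ ((F X).card - 1), ?_, ?_, ?_⟩
  · exact Finset.prod_ne_zero_iff.2 fun X hX =>
      pow_ne_zero _ (lin_ne_zero ((A.restrict H).isHyperplane X hX).linForm_ne_zero)
  · have h1 : (A.delete H).hyps.card - (A.restrict H).hyps.card =
        ∑ X ∈ (A.restrict H).hyps, 1 * ((F X).card - 1) := by
      have h2 : (A.delete H).hyps.card = ∑ X ∈ (A.restrict H).hyps, (F X).card := by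
        rw [Finset.card_eq_sum_card_image (fun H' => H'.comap H.subtype) (A.delete H).hyps,
          restrict_hyps hH]
      have h3 : ∀ X ∈ (A.restrict H).hyps, (F X).card = 1 * ((F X).card - 1) + 1 := by
        intro X hX
        rw [restrict_hyps hH] at hX
        obtain ⟨H', h', rfl⟩ := Finset.mem_image.1 hX
        have h4 : H' ∈ F (H'.comap H.subtype) := Finset.mem_filter.2 ⟨h', rfl⟩
        have := Finset.card_pos.2 ⟨H', h4⟩
        omega
      rw [h2, Finset.sum_congr rfl h3, Finset.sum_add_distrib]
      simp
    rw [h1]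
    exact prod_mem_homogComp _ _ _ fun X _ => pow_mem_homogComp (lin_mem_homogComp _) _
  · intro θ hθ
    refine Finset.prod_dvd_of_isRelPrime (fun X hX Y hY hXY => ?_) fun X hX => ?_
    · exact (((A.restrict H).isHyperplane X hX).isRelPrime
        ((A.restrict H).isHyperplane Y hY) hXY).pow
    · exact linForm_pow_dvd hH hθ ((A.restrict H).isHyperplane X hX) (F X) (hF X)

end CentralArrangement

/-- The restriction of a derivation along `H ⊆ V` and a projection `V → H`. -/
def Der.restrict (H : Submodule K V) (π : V →ₗ[K] H) (hπ : π ∘ₗ H.subtype = LinearMap.id)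
    (θ : Der K V) : Der K H :=
  Derivation.mk' ((pull H.subtype).toLinearMap ∘ₗ θ.toLinearMap ∘ₗ (pull π).toLinearMap) (by
    intro a b
    change pull H.subtype (θ (pull π (a * b))) =
      a * pull H.subtype (θ (pull π b)) + b * pull H.subtype (θ (pull π a))
    rw [map_mul, Derivation.leibniz, smul_eq_mul, smul_eq_mul, map_add, map_mul, map_mul,
      pull_pull_of_comp_eq_id _ _ hπ, pull_pull_of_comp_eq_id _ _ hπ])

section

variable {H : Submodule K V} {π : V →ₗ[K] H} (hπ : π ∘ₗ H.subtype = LinearMap.id)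

theorem Der.restrict_apply (θ : Der K V) (f : PolyAlg K H) :
    θ.restrict H π hπ f = pull H.subtype (θ (pull π f)) := rfl

theorem HasDegree.restrict {θ : Der K V} {d : ℕ} (h : HasDegree θ d) :
    HasDegree (θ.restrict H π hπ) d := by
  intro α
  rw [Der.restrict_apply, pull_lin]
  exact pull_mem_homogComp _ (h _)

/-- A derivation killing the equation of `H` modulo itself is determined on `H` by its
restriction. -/
theorem Der.restrict_comp_subtype {θ : Der K V} {α : Dual K V} (hα : LinearMap.ker α = H)
    (h : pull H.subtype (θ (lin K V α)) = 0) (β : Dual K V) :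
    θ.restrict H π hπ (lin K H (β ∘ₗ H.subtype)) = pull H.subtype (θ (lin K V β)) := by
  obtain ⟨c, hc⟩ := exists_sub_proj_eq_smul hα hπ β
  rw [Der.restrict_apply, pull_lin]
  have h1 : β = c • α + (β ∘ₗ H.subtype) ∘ₗ π := by rw [← hc]; abel
  conv_rhs => rw [h1]
  rw [map_add, map_smul, map_add, Derivation.map_smul, map_add, map_smul, h, smul_zero, zero_add]

theorem CentralArrangement.restrict_mem_derivations {A : CentralArrangement K V} (hH : H ∈ A.hyps)
    {θ : Der K V} (hθ : θ ∈ (A.delete H).derivations)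
    (h : pull H.subtype (θ (lin K V (linForm H))) = 0) :
    θ.restrict H π hπ ∈ (A.restrict H).derivations := by
  classical
  rw [mem_derivations_iff]
  intro X hX
  have hXl := ker_linForm ((A.restrict H).isHyperplane X hX)
  rw [restrict_hyps hH] at hX
  obtain ⟨H', h', rfl⟩ := Finset.mem_image.1 hX
  have h1 := ker_linForm_comp_subtype (A := A.delete H) (H := H) h'
  refine dvd_derivation_congr _ (h1.trans hXl.symm) ?_
  rw [Der.restrict_comp_subtype hπ (ker_linForm (A.isHyperplane H hH)) h, ← pull_lin]
  exact map_dvd _ ((mem_derivations_iff _ θ).1 hθ H' h')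

end

/-- A derivation all of whose values are divisible by a linear form can be divided. -/
theorem Der.exists_eq_smul {θ : Der K V} {α : Dual K V} (hα : α ≠ 0)
    (h : ∀ β, lin K V α ∣ θ (lin K V β)) : ∃ η : Der K V, θ = lin K V α • η := by
  have h0 := lin_ne_zero hα
  have h1 : ∀ f, lin K V α ∣ θ f := by
    intro f
    induction f using SymmetricAlgebra.induction with
    | algebraMap c => simp
    | ι β => exact h β
    | mul f g hf hg =>
      rw [Derivation.leibniz]
      exact dvd_add (hg.mul_left _) (hf.mul_left _)
    | add f g hf hg =>
      rw [map_add]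
      exact dvd_add hf hg
  choose g hg using h1
  refine ⟨Derivation.mk' ⟨⟨g, fun x y => ?_⟩, fun c x => ?_⟩ fun x y => ?_, ?_⟩
  · apply mul_left_cancel₀ h0
    rw [mul_add, ← hg, ← hg, ← hg, map_add]
  · apply mul_left_cancel₀ h0
    rw [RingHom.id_apply, mul_smul_comm, ← hg, ← hg, Derivation.map_smul]
  · apply mul_left_cancel₀ h0
    change _ * g (x * y) = _ * (x * g y + y * g x)
    rw [← hg, Derivation.leibniz, hg x, hg y, smul_eq_mul, smul_eq_mul]
    ring
  · ext f
    exact hg f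

/-- The prime forms of the remaining hyperplanes do not divide α_H, so α_H can be cancelled in each
tangency condition. -/
theorem CentralArrangement.mem_derivations_of_smul_mem {A : CentralArrangement K V}
    {H : Submodule K V} (hH : H ∈ A.hyps) {η : Der K V}
    (h : lin K V (linForm H) • η ∈ (A.delete H).derivations) : η ∈ (A.delete H).derivations := by
  classical
  rw [mem_derivations_iff] at h ⊢
  intro H' h'
  have hne : H' ≠ H := Finset.ne_of_mem_erase h'
  have h1 := (A.delete H).isHyperplane H' h'
  exact (h1.prime.dvd_or_dvd (h H' h')).resolve_left (h1.not_dvd (A.isHyperplane H hH) hne)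

/-- A derivation of degree `d` is a combination of the basis elements of degree at most `d`. -/
theorem HasDegree.mem_span {n : ℕ} {b : Fin n → Der K V} {e : Fin n → ℕ}
    (hb : ∀ i, HasDegree (b i) (e i)) {θ : Der K V} {d : ℕ} (hθ : HasDegree θ d)
    (hmem : θ ∈ Submodule.span (PolyAlg K V) (Set.range b)) :
    θ ∈ Submodule.span (PolyAlg K V) (Set.range fun i : {i // e i ≤ d} => b i) := by
  obtain ⟨g, hg⟩ := (Submodule.mem_span_range_iff_exists_fun _).1 hmem
  -- Take the component of degree d of the expansion of θ: each coefficient is replaced by its part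
  -- of degree d - e_i, and the terms with e_i > d disappear.
  have h1 : θ = ∑ i, (if e i ≤ d then homogPart (d - e i) (g i) else 0) • b i := by
    refine Der.ext_lin fun α => ?_
    rw [← homogPart_of_mem (hθ α), ← hg, Der.sum_apply, Der.sum_apply, map_sum]
    refine Finset.sum_congr rfl fun i _ => ?_
    rw [Derivation.smul_apply, Derivation.smul_apply, smul_eq_mul, smul_eq_mul]
    split_ifs with h
    · exact homogPart_mul_of_le h _ (hb i α)
    · rw [homogPart_mul_of_lt (not_le.1 h) _ (hb i α), zero_mul]
  rw [h1]
  refine Submodule.sum_mem _ fun i _ => ?_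
  split_ifs with h
  · exact Submodule.smul_mem _ _ (Submodule.subset_span ⟨⟨i, h⟩, rfl⟩)
  · rw [zero_smul]
    exact zero_mem _

end Restriction

/-! ### The addition theorem. -/

section Addition

variable {K : Type u} [Field K] {V : Type v} [AddCommGroup V] [Module K V]

namespace CentralArrangement

variable {A : CentralArrangement K V} {H : Submodule K V}

theorem mem_derivations_of_delete {θ : Der K V}
    (hθ : θ ∈ (A.delete H).derivations)
    (h : lin K V (linForm H) ∣ θ (lin K V (linForm H))) : θ ∈ A.derivations := by
  classical
  rw [mem_derivations_iff] at hθ ⊢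
  intro H' h'
  by_cases hne : H' = H
  · rwa [hne]
  · exact hθ H' (Finset.mem_erase.2 ⟨hne, h'⟩)

theorem derivations_le_delete : A.derivations ≤ (A.delete H).derivations := by
  intro θ hθ
  rw [mem_derivations_iff] at hθ ⊢
  exact fun H' h' => hθ H' (Finset.mem_of_mem_erase h')

/-- Restrictions of independent derivations tangent to `H` are independent. -/
theorem linearIndependent_restrict (hH : H ∈ A.hyps) {π : V →ₗ[K] H}
    (hπ : π ∘ₗ H.subtype = LinearMap.id) {n : ℕ} {b : Fin n → Der K V}
    (hli : LinearIndependent (PolyAlg K V) b)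
    (hspan : Submodule.span (PolyAlg K V) (Set.range b) = (A.delete H).derivations)
    (p : Fin n → Prop) (hp : ∀ i, p i → pull H.subtype (b i (lin K V (linForm H))) = 0) :
    LinearIndependent (PolyAlg K H) fun i : {i // p i} => (b i).restrict H π hπ := by
  classical
  have hα := ker_linForm (A.isHyperplane H hH)
  rw [Fintype.linearIndependent_iff]
  intro f hf i
  let g : Fin n → PolyAlg K V := fun i => if h : p i then pull π (f ⟨i, h⟩) else 0
  have hg : ∀ i : {i // p i}, g i = pull π (f i) := fun i => dif_pos i.2
  have hsum : ∀ γ, pull H.subtype ((∑ i, g i • b i) (lin K V γ)) = 0 := by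
    intro γ
    have h1 := DFunLike.congr_fun hf (lin K H (γ ∘ₗ H.subtype))
    rw [Der.sum_apply] at h1
    rw [Der.sum_apply, map_sum, ← Finset.sum_filter_add_sum_filter_not _ p,
      Finset.sum_eq_zero (s := Finset.univ.filter fun i => ¬ p i), add_zero,
      Finset.sum_subtype (p := p) _ (by simp)]
    · refine Eq.trans (Finset.sum_congr rfl fun i _ => ?_) h1
      rw [Derivation.smul_apply, Derivation.smul_apply, hg, smul_eq_mul, smul_eq_mul, map_mul,
        pull_pull_of_comp_eq_id _ _ hπ, Der.restrict_comp_subtype hπ hα (hp i i.2)]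
    · intro i hi
      simp [g, (Finset.mem_filter.1 hi).2]
  -- The lifted relation vanishes on H, so it is α_H times a derivation, which again lies in D(A').
  -- Expanding that one in the basis shows that α_H divides every lifted coefficient, so the
  -- coefficients on H are zero.
  obtain ⟨η, hη⟩ := Der.exists_eq_smul (A.isHyperplane H hH).linForm_ne_zero
    fun β => (pull_subtype_eq_zero_iff hα).1 (hsum β)
  have hηmem : η ∈ (A.delete H).derivations := by
    apply mem_derivations_of_smul_mem hH
    rw [← hη, ← hspan]
    exact (Submodule.mem_span_range_iff_exists_fun _).2 ⟨g, rfl⟩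
  rw [← hspan] at hηmem
  obtain ⟨k, rfl⟩ := (Submodule.mem_span_range_iff_exists_fun _).1 hηmem
  have h2 : ∑ i, (g i - lin K V (linForm H) * k i) • b i = 0 := by
    refine (sum_sub_mul_smul g k _ b).trans ?_
    rw [hη, sub_self]
  have h3 := Fintype.linearIndependent_iff.1 hli _ h2 i
  rw [hg, sub_eq_zero] at h3
  rw [← pull_pull_of_comp_eq_id _ _ hπ (f i), h3, pull_subtype_eq_zero_iff hα]
  exact dvd_mul_right _ _

/-- If `A'` and `A''` are free with exponents `{d} ∪ E` and `E`, then some basis element of degree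
`d` is not tangent to `H`. -/
theorem exists_pull_ne_zero (hH : H ∈ A.hyps) {E : Multiset ℕ} {d : ℕ}
    (hres : (A.restrict H).IsFreeWithExp E) {n : ℕ} {b : Fin n → Der K V} {e : Fin n → ℕ}
    (hli : LinearIndependent (PolyAlg K V) b)
    (hspan : Submodule.span (PolyAlg K V) (Set.range b) = (A.delete H).derivations)
    (hdeg : ∀ i, HasDegree (b i) (e i)) (hE : d ::ₘ E = (Finset.univ : Finset (Fin n)).val.map e)
    (hlow : ∀ i, e i < d → pull H.subtype (b i (lin K V (linForm H))) = 0) :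
    ∃ j, e j = d ∧ pull H.subtype (b j (lin K V (linForm H))) ≠ 0 := by
  classical
  by_contra! hne
  obtain ⟨m, c, e', cli, cspan, cdeg, rfl⟩ := (isFreeWithExp_iff _ _).1 hres
  obtain ⟨π, hπ⟩ := exists_proj H
  have hz : ∀ i, e i ≤ d → pull H.subtype (b i (lin K V (linForm H))) = 0 := fun i hi =>
    hi.lt_or_eq.elim (hlow i) (hne i)
  have h1 := linearIndependent_restrict hH hπ hli hspan (fun i => e i ≤ d) hz
  have h2 : Set.range (fun i : {i // e i ≤ d} => (b i).restrict H π hπ) ⊆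
      Submodule.span (PolyAlg K H) (Set.range fun i : {i // e' i ≤ d} => c i) := by
    rintro _ ⟨i, rfl⟩
    have h3 : (b i).restrict H π hπ ∈ Submodule.span (PolyAlg K H) (Set.range c) := by
      rw [cspan]
      refine restrict_mem_derivations hπ hH ?_ (hz i i.2)
      rw [← hspan]
      exact Submodule.subset_span ⟨i, rfl⟩
    refine Submodule.span_mono ?_ (HasDegree.mem_span cdeg ((hdeg i).restrict hπ) h3)
    rintro _ ⟨k, rfl⟩
    exact ⟨⟨k, k.2.trans i.2⟩, rfl⟩
  -- If all basis elements of degree at most d were tangent, their restrictions would be independent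
  -- in the span of the basis elements of D(A'') of degree at most d, of which there is one fewer.
  have h3 := linearIndependent_le_span' _ h1 _ h2
  rw [Set.card_range_of_injective (f := fun i : {i // e' i ≤ d} => c i)
    (cli.injective.comp Subtype.val_injective),
    Cardinal.mk_fintype, Nat.cast_le, Fintype.card_subtype, Fintype.card_subtype] at h3
  have h4 := congrArg (Multiset.countP (· ≤ d)) hE
  rw [Multiset.countP_cons_of_pos (p := (· ≤ d)) _ le_rfl, Multiset.countP_map,
    Multiset.countP_map] at h4
  change _ + 1 = (Finset.univ.filter fun i => e i ≤ d).card at h4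
  change (Finset.univ.filter fun i => e' i ≤ d).card + 1 = _ at h4
  omega

/-- **Addition theorem** (Terao). -/
theorem IsFreeWithExp.addition (hH : H ∈ A.hyps) {E : Multiset ℕ} {d : ℕ}
    (hres : (A.restrict H).IsFreeWithExp E) (hdel : (A.delete H).IsFreeWithExp (d ::ₘ E))
    (hcard : (A.delete H).hyps.card = (A.restrict H).hyps.card + d) :
    A.IsFreeWithExp ((d + 1) ::ₘ E) := by
  classical
  obtain ⟨n, b, e, bli, bspan, bdeg, hE⟩ := (isFreeWithExp_iff _ _).1 hdel
  obtain ⟨B, hB0, hBd, hB⟩ := exists_dvd_pull_derivation hH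
  rw [hcard, Nat.add_sub_cancel_left] at hBd
  obtain ⟨π, hπ⟩ := exists_proj H
  have hα := ker_linForm (A.isHyperplane H hH)
  set α := linForm H with hαdef
  have hα0 : lin K V α ≠ 0 := lin_ne_zero (A.isHyperplane H hH).linForm_ne_zero
  have bmem : ∀ i, b i ∈ (A.delete H).derivations := fun i =>
    bspan ▸ Submodule.subset_span ⟨i, rfl⟩
  have hr : ∀ i, pull H.subtype (b i (lin K V α)) ∈ homogComp K H (e i) := fun i =>
    pull_mem_homogComp _ (bdeg i α)
  have hlow : ∀ i, e i < d → pull H.subtype (b i (lin K V α)) = 0 := by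
    intro i hi
    obtain ⟨f, hf⟩ := hB _ (bmem i)
    rw [← homogPart_of_mem (hr i), hf, mul_comm, homogPart_mul_of_lt hi _ hBd]
  have hhigh : ∀ i, d ≤ e i → ∃ f ∈ homogComp K H (e i - d),
      pull H.subtype (b i (lin K V α)) = f * B := by
    intro i hi
    obtain ⟨f, hf⟩ := hB _ (bmem i)
    refine ⟨_, homogPart_mem (e i - d) f, ?_⟩
    rw [← homogPart_of_mem (hr i), hf, mul_comm, homogPart_mul_of_le hi _ hBd]
  obtain ⟨j, hj, hj0⟩ := exists_pull_ne_zero hH hres bli bspan bdeg hE hlow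
  obtain ⟨f, hf, hfj⟩ := hhigh j hj.ge
  rw [hj, Nat.sub_self] at hf
  obtain ⟨a, rfl⟩ := mem_homogComp_zero hf
  have ha : a ≠ 0 := by
    rintro rfl
    rw [map_zero, zero_mul] at hfj
    exact hj0 hfj
  -- On H, b_j(α) is a B with a non-zero constant a, and b_i(α) is a multiple g B. Lifting g / a
  -- along π gives the multiplier that makes b_i - u_i b_j tangent to H without spoiling its degree;
  -- below degree d the multiplier is 0.
  have hu : ∀ i, ∃ u : PolyAlg K V, HasDegree (u • b j) (e i) ∧
      pull H.subtype (b i (lin K V α)) = pull H.subtype (u * b j (lin K V α)) := by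
    intro i
    rcases lt_or_ge (e i) d with hi | hi
    · refine ⟨0, fun β => ?_, ?_⟩
      · simp
      · rw [hlow i hi, zero_mul, map_zero]
    · obtain ⟨g, hg, hgi⟩ := hhigh i hi
      refine ⟨algebraMap K _ a⁻¹ * pull π g, ?_, ?_⟩
      · have h1 : algebraMap K (PolyAlg K V) a⁻¹ * pull π g ∈ homogComp K V (e i - d) := by
          rw [← Algebra.smul_def]
          exact Submodule.smul_mem _ _ (pull_mem_homogComp _ hg)
        have h2 := (bdeg j).smul h1
        rwa [hj, Nat.sub_add_cancel hi] at h2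
      · rw [map_mul, map_mul, pull_pull_of_comp_eq_id _ _ hπ, AlgHom.commutes, hgi, hfj]
        have : algebraMap K (PolyAlg K H) a⁻¹ * algebraMap K (PolyAlg K H) a = 1 := by
          rw [← map_mul, inv_mul_cancel₀ ha, map_one]
        linear_combination (-(g * B)) * this
  choose u hudeg hu using hu
  let u' : Fin n → PolyAlg K V := fun i => if i = j then 0 else u i
  let w : Fin n → Der K V := b + fun i => (-u' i) • b j
  have hwj : w j = b j := by simp [w, u']
  have hw : ∀ i, i ≠ j → w i = b i - u i • b j := fun i hi =>
    Derivation.ext fun f => by simp [w, u', hi, sub_eq_add_neg]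
  have wli : LinearIndependent (PolyAlg K V) w :=
    (linearIndependent_add_smul_iff (by simp [u'])).2 bli
  have hwα : ∀ i, i ≠ j → pull H.subtype (w i (lin K V α)) = 0 := by
    intro i hi
    rw [hw i hi, Derivation.sub_apply, Derivation.smul_apply, smul_eq_mul, map_sub, hu, sub_self]
  have wmem : ∀ i, w i ∈ (A.delete H).derivations := fun i =>
    add_mem (bmem i) (Submodule.smul_mem _ _ (bmem j))
  have wspan : (A.delete H).derivations ≤ Submodule.span (PolyAlg K V) (Set.range w) := by
    rw [← bspan, Submodule.span_le]
    rintro _ ⟨i, rfl⟩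
    have : b i = w i + u' i • w j := by
      rw [hwj]
      exact Derivation.ext fun f => by simp [w]
    rw [this]
    exact add_mem (Submodule.subset_span ⟨i, rfl⟩)
      (Submodule.smul_mem _ _ (Submodule.subset_span ⟨j, rfl⟩))
  have wdeg : ∀ i, HasDegree (w i) (e i) := by
    intro i
    by_cases hi : i = j
    · rw [hi, hwj]
      exact bdeg j
    · rw [hw i hi]
      exact (bdeg i).sub (hudeg i)
  -- Only the j-th element still fails to be tangent to H, and multiplication by α repairs it.
  let x : Fin n → PolyAlg K V := fun i => if i = j then lin K V α else 1
  have hx : ∀ i, x i ≠ 0 := by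
    intro i
    simp only [x]
    split_ifs
    · exact hα0
    · exact one_ne_zero
  refine (isFreeWithExp_iff _ _).2 ⟨n, fun i => x i • w i, fun i => if i = j then d + 1 else e i,
    ?_, le_antisymm ?_ fun θ hθ => ?_, fun i => ?_, ?_⟩
  · rw [Fintype.linearIndependent_iff] at wli ⊢
    intro g hg i
    simp only [smul_smul] at hg
    exact (mul_eq_zero.1 (wli _ hg i)).resolve_right (hx i)
  · rw [Submodule.span_le]
    rintro _ ⟨i, rfl⟩
    refine mem_derivations_of_delete (Submodule.smul_mem _ _ (wmem i)) ?_
    rw [← hαdef, ← pull_subtype_eq_zero_iff hα, Derivation.smul_apply, smul_eq_mul, map_mul]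
    by_cases hi : i = j
    · rw [show x i = lin K V α from if_pos hi, (pull_subtype_eq_zero_iff hα).2 dvd_rfl, zero_mul]
    · rw [hwα i hi, mul_zero]
  · obtain ⟨g, rfl⟩ := (Submodule.mem_span_range_iff_exists_fun _).1
      (wspan (derivations_le_delete hθ))
    -- Evaluated at α and restricted to H, only the j-th term of the expansion survives. Hence its
    -- coefficient vanishes on H and is a multiple of α.
    have h1 := (pull_subtype_eq_zero_iff hα).2 ((mem_derivations_iff _ _).1 hθ H hH)
    rw [Der.sum_apply, map_sum, Finset.sum_eq_single j (fun i _ hi => by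
      rw [Derivation.smul_apply, smul_eq_mul, map_mul, ← hαdef, hwα i hi, mul_zero])
      (fun h => absurd (Finset.mem_univ j) h), Derivation.smul_apply, smul_eq_mul, map_mul,
      hwj, mul_eq_zero, or_iff_left hj0, pull_subtype_eq_zero_iff hα] at h1
    obtain ⟨k, hk⟩ := h1
    refine (Submodule.mem_span_range_iff_exists_fun _).2 ⟨fun i => if i = j then k else g i,
      Finset.sum_congr rfl fun i _ => ?_⟩
    by_cases hi : i = j
    · subst hi
      simp only [x, if_true, smul_smul, hk, mul_comm]
    · simp [x, hi]
  · by_cases hi : i = j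
    · simp only [x, if_pos hi]
      subst hi
      rw [add_comm, ← hj]
      exact (wdeg i).smul (lin_mem_homogComp α)
    · simp only [x, if_neg hi, one_smul]
      exact wdeg i
  · have h1 : (Finset.univ : Finset (Fin n)).val = j ::ₘ (Finset.univ.erase j).val := by
      rw [← Finset.insert_val_of_notMem (Finset.notMem_erase j _),
        Finset.insert_erase (Finset.mem_univ j)]
    rw [h1, Multiset.map_cons, hj, Multiset.cons_inj_right] at hE
    rw [h1, Multiset.map_cons, if_pos rfl, hE]
    congr 1
    exact Multiset.map_congr rfl fun i (hi : i ∈ Finset.univ.erase j) =>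
      (if_neg (Finset.ne_of_mem_erase hi)).symm

end CentralArrangement

end Addition

/-! ### Inductive freeness with exponents, and arrangements given by linear forms. -/

section InductiveFreeness

/-- Inductive freeness with a record of the exponents. -/
inductive IsIndFree {K : Type u} [Field K] :
    ∀ {V : Type v} [AddCommGroup V] [Module K V], CentralArrangement K V → Multiset ℕ → Prop
  | empty {V : Type v} [AddCommGroup V] [Module K V] [FiniteDimensional K V]
      (A : CentralArrangement K V) (hA : A.hyps = ∅) :
      IsIndFree A (Multiset.replicate (finrank K V) 0)
  | step {V : Type v} [AddCommGroup V] [Module K V]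
      (A : CentralArrangement K V) (H : Submodule K V) (hH : H ∈ A.hyps) (E : Multiset ℕ) (d : ℕ)
      (hres : IsIndFree (A.restrict H) E) (hdel : IsIndFree (A.delete H) (d ::ₘ E)) :
      IsIndFree A ((d + 1) ::ₘ E)

variable {K : Type u} [Field K] {V : Type v} [AddCommGroup V] [Module K V]

/-- The three conclusions need a joint induction: that the exponents sum to the number of
hyperplanes is what supplies the cardinality hypothesis of the addition theorem. -/
theorem IsIndFree.isInductivelyFree_and {A : CentralArrangement K V} {E : Multiset ℕ}
    (h : IsIndFree A E) :
    IsInductivelyFree A ∧ A.IsFreeWithExp E ∧ A.hyps.card = E.sum := by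
  classical
  induction h with
  | empty A hA =>
    exact ⟨.empty A hA, A.isFreeWithExp_of_hyps_eq_empty hA, by simp [hA]⟩
  | step A H hH E d hres hdel ihres ihdel =>
    obtain ⟨r1, r2, r3⟩ := ihres
    obtain ⟨d1, d2, d3⟩ := ihdel
    refine ⟨.step A H hH r1 d1 _ _ r2 d2 (Multiset.le_cons_self E d),
      CentralArrangement.IsFreeWithExp.addition hH r2 d2 ?_, ?_⟩
    · rw [d3, r3, Multiset.sum_cons, add_comm]
    · have : (A.delete H).hyps.card = A.hyps.card - 1 := Finset.card_erase_of_mem hH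
      have h1 := Finset.card_pos.2 ⟨H, hH⟩
      rw [Multiset.sum_cons] at d3 ⊢
      omega

/-- Pullback along a surjection preserves inductive freeness and adds exponents `0`. -/
theorem IsIndFree.comap {A : CentralArrangement K V} {E : Multiset ℕ} (h : IsIndFree A E)
    {W : Type v} [AddCommGroup W] [Module K W] [FiniteDimensional K W] (f : W →ₗ[K] V)
    (hf : Function.Surjective f) (B : CentralArrangement K W)
    (hB : ∀ X, X ∈ B.hyps ↔ ∃ H ∈ A.hyps, H.comap f = X) :
    IsIndFree B (Multiset.replicate (finrank K (LinearMap.ker f)) 0 + E) := by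
  classical
  induction h generalizing W with
  | empty A hA =>
    have h1 : B.hyps = ∅ := Finset.eq_empty_of_forall_notMem fun X hX => by
      simpa [hA] using (hB X).1 hX
    have h2 := IsIndFree.empty B h1
    rwa [← LinearMap.finrank_range_add_finrank_ker f, LinearMap.range_eq_top.2 hf, finrank_top,
      add_comm, Multiset.replicate_add] at h2
  | @step V _ _ A H hH E d hres hdel ihres ihdel =>
    have hinj : Function.Injective (Submodule.comap f) := Submodule.comap_injective_of_surjective hf
    rw [Multiset.add_cons]
    refine .step B (H.comap f) ((hB _).2 ⟨H, hH, rfl⟩) _ _ ?_ ?_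
    · let f' : H.comap f →ₗ[K] H := f.restrict fun _ h => h
      have hf' : Function.Surjective f' := by
        rintro ⟨y, hy⟩
        obtain ⟨x, rfl⟩ := hf y
        exact ⟨⟨x, hy⟩, rfl⟩
      have hker : finrank K (LinearMap.ker f') = finrank K (LinearMap.ker f) := by
        have h1 : LinearMap.ker f' = (LinearMap.ker f).comap (H.comap f).subtype := by
          ext x
          simp [f', Subtype.ext_iff]
        rw [h1]
        refine (Submodule.comapSubtypeEquivOfLe fun x hx => ?_).finrank_eq
        rw [Submodule.mem_comap, LinearMap.mem_ker.1 hx]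
        exact zero_mem H
      have h1 := ihres f' hf' (B.restrict (H.comap f)) fun X => ?_
      · rwa [hker] at h1
      simp only [CentralArrangement.restrict, Finset.mem_image, Finset.mem_filter]
      constructor
      · rintro ⟨Y, ⟨hY, hYH⟩, rfl⟩
        obtain ⟨H', h', rfl⟩ := (hB Y).1 hY
        exact ⟨_, ⟨H', ⟨h', fun hle => hYH (Submodule.comap_mono hle)⟩, rfl⟩, rfl⟩
      · rintro ⟨_, ⟨H', ⟨h', hle⟩, rfl⟩, rfl⟩
        exact ⟨_, ⟨(hB _).2 ⟨H', h', rfl⟩,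
          fun hle' => hle ((Submodule.comap_le_comap_iff_of_surjective hf).1 hle')⟩, rfl⟩
    · rw [← Multiset.add_cons]
      refine ihdel f hf _ fun X => ?_
      simp only [CentralArrangement.delete, Finset.mem_erase, hB]
      constructor
      · rintro ⟨hX, H', h', rfl⟩
        exact ⟨H', ⟨fun h => hX (h ▸ rfl), h'⟩, rfl⟩
      · rintro ⟨H', ⟨hne, h'⟩, rfl⟩
        exact ⟨fun h => hne (hinj h), H', h', rfl⟩

/-! ### Arrangements given by linear forms -/

/-- The hyperplanes defined by the non-zero elements of a set of linear forms. -/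
def hypSet (Φ : Set (Dual K V)) : Set (Submodule K V) :=
  {H | ∃ α ∈ Φ, α ≠ 0 ∧ LinearMap.ker α = H}

/-- The pullback of a set of linear forms. -/
def pullForms {W : Type w} [AddCommGroup W] [Module K W] (f : W →ₗ[K] V) (Φ : Set (Dual K V)) :
    Set (Dual K W) := (fun α => α ∘ₗ f) '' Φ

/-- The arrangement defined by a set of linear forms is inductively free with exponents `E`. -/
def FormsIndFree (Φ : Set (Dual K V)) (E : Multiset ℕ) : Prop :=
  ∃ A : CentralArrangement K V, (A.hyps : Set (Submodule K V)) = hypSet Φ ∧ IsIndFree A E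

theorem pullForms_comp {W : Type*} [AddCommGroup W] [Module K W] {U : Type*} [AddCommGroup U]
    [Module K U] (f : W →ₗ[K] V) (g : U →ₗ[K] W) (Φ : Set (Dual K V)) :
    pullForms g (pullForms f Φ) = pullForms (f ∘ₗ g) Φ := by
  rw [pullForms, pullForms, Set.image_image]
  rfl

theorem CentralArrangement.ext_hyps {A B : CentralArrangement K V} (h : A.hyps = B.hyps) :
    A = B := by
  cases A; cases B; cases h; rfl

theorem FormsIndFree.isIndFree {Φ : Set (Dual K V)} {E : Multiset ℕ} (h : FormsIndFree Φ E)
    {A : CentralArrangement K V} (hA : (A.hyps : Set (Submodule K V)) = hypSet Φ) :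
    IsIndFree A E := by
  obtain ⟨B, hB, hE⟩ := h
  rwa [CentralArrangement.ext_hyps (Finset.coe_injective (hA.trans hB.symm))]

theorem FormsIndFree.congr {Φ Ψ : Set (Dual K V)} {E : Multiset ℕ} (h : FormsIndFree Φ E)
    (hΨ : hypSet Φ = hypSet Ψ) : FormsIndFree Ψ E := by
  obtain ⟨B, hB, hE⟩ := h
  exact ⟨B, hB.trans hΨ, hE⟩

theorem comp_ne_zero_of_surjective {W : Type w} [AddCommGroup W] [Module K W] {f : W →ₗ[K] V}
    (hf : Function.Surjective f) {α : Dual K V} (hα : α ≠ 0) : α ∘ₗ f ≠ 0 := fun h =>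
  hα (by
    ext x
    obtain ⟨y, rfl⟩ := hf x
    exact LinearMap.congr_fun h y)

theorem FormsIndFree.pull {Φ : Set (Dual K V)} {E : Multiset ℕ} (h : FormsIndFree Φ E)
    {W : Type v} [AddCommGroup W] [Module K W] [FiniteDimensional K W] (f : W →ₗ[K] V)
    (hf : Function.Surjective f) :
    FormsIndFree (pullForms f Φ) (Multiset.replicate (finrank K (LinearMap.ker f)) 0 + E) := by
  classical
  obtain ⟨A, hA, hE⟩ := h
  have hA' : ∀ H, H ∈ A.hyps ↔ ∃ α ∈ Φ, α ≠ 0 ∧ LinearMap.ker α = H := fun H => by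
    rw [← Finset.mem_coe, hA]; rfl
  let B : CentralArrangement K W := ⟨A.hyps.image fun H => H.comap f, by
    intro X hX
    obtain ⟨H, hH, rfl⟩ := Finset.mem_image.1 hX
    obtain ⟨α, -, h0, rfl⟩ := (hA' H).1 hH
    exact ⟨α ∘ₗ f, comp_ne_zero_of_surjective hf h0, LinearMap.ker_comp _ _⟩⟩
  refine ⟨B, ?_, hE.comap f hf B fun X => Finset.mem_image⟩
  ext X
  simp only [B, Finset.coe_image, Set.mem_image, hA, hypSet, pullForms]
  constructor
  · rintro ⟨_, ⟨α, hα, h0, rfl⟩, rfl⟩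
    exact ⟨_, ⟨α, hα, rfl⟩, comp_ne_zero_of_surjective hf h0, LinearMap.ker_comp _ _⟩
  · rintro ⟨_, ⟨α, hα, rfl⟩, h0, rfl⟩
    exact ⟨_, ⟨α, hα, fun h => h0 (by rw [h, LinearMap.zero_comp]), rfl⟩,
      (LinearMap.ker_comp _ _).symm⟩

theorem FormsIndFree.pull_equiv {Φ : Set (Dual K V)} {E : Multiset ℕ} (h : FormsIndFree Φ E)
    {W : Type v} [AddCommGroup W] [Module K W] [FiniteDimensional K W] (f : W ≃ₗ[K] V) :
    FormsIndFree (pullForms f.toLinearMap Φ) E := by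
  have := h.pull f.toLinearMap f.surjective
  rwa [LinearEquiv.ker, finrank_bot, Multiset.replicate_zero, zero_add] at this

theorem hypSet_restrict {A : CentralArrangement K V} {Φ : Set (Dual K V)}
    (hA : (A.hyps : Set (Submodule K V)) = hypSet Φ) (X : Submodule K V) :
    ((A.restrict X).hyps : Set (Submodule K X)) = hypSet (pullForms X.subtype Φ) := by
  classical
  have hA' : ∀ H, H ∈ A.hyps ↔ ∃ α ∈ Φ, α ≠ 0 ∧ LinearMap.ker α = H := fun H => by
    rw [← Finset.mem_coe, hA]; rfl
  ext Y
  simp only [CentralArrangement.restrict, Finset.coe_image, Finset.coe_filter, Set.mem_image,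
    hypSet, pullForms, Set.mem_ofPred_eq, hA']
  constructor
  · rintro ⟨_, ⟨⟨α, hα, h0, rfl⟩, hle⟩, rfl⟩
    refine ⟨_, ⟨α, hα, rfl⟩, fun h => hle fun x hx => LinearMap.congr_fun h ⟨x, hx⟩,
      LinearMap.ker_comp _ _⟩
  · rintro ⟨_, ⟨α, hα, rfl⟩, h0, rfl⟩
    refine ⟨_, ⟨⟨α, hα, fun h => h0 (by rw [h, LinearMap.zero_comp]), rfl⟩, fun h => h0 ?_⟩,
      (LinearMap.ker_comp _ _).symm⟩
    ext x
    exact h x.2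

/-- Adding a hyperplane. -/
theorem FormsIndFree.addForm [FiniteDimensional K V] {Φ : Set (Dual K V)} {E : Multiset ℕ} {d : ℕ}
    (hdel : FormsIndFree Φ (d ::ₘ E)) {W : Type v} [AddCommGroup W] [Module K W]
    {ι : W →ₗ[K] V} (hι : Function.Injective ι) (hres : FormsIndFree (pullForms ι Φ) E)
    {α : Dual K V} (h0 : α ≠ 0) (hker : LinearMap.ker α = LinearMap.range ι)
    (hnew : LinearMap.ker α ∉ hypSet Φ) :
    FormsIndFree (insert α Φ) ((d + 1) ::ₘ E) := by
  classical
  obtain ⟨A, hA, hE⟩ := hdel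
  let B : CentralArrangement K V := ⟨insert (LinearMap.ker α) A.hyps, by
    intro X hX
    obtain rfl | hX := Finset.mem_insert.1 hX
    · exact ⟨α, h0, rfl⟩
    · exact A.isHyperplane X hX⟩
  have hB : (B.hyps : Set (Submodule K V)) = hypSet (insert α Φ) := by
    simp only [B, Finset.coe_insert, hA]
    ext X
    simp only [hypSet, Set.mem_insert_iff, Set.mem_ofPred_eq]
    constructor
    · rintro (rfl | ⟨β, hβ, h⟩)
      · exact ⟨α, Or.inl rfl, h0, rfl⟩
      · exact ⟨β, Or.inr hβ, h⟩
    · rintro ⟨β, rfl | hβ, h, rfl⟩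
      · exact Or.inl rfl
      · exact Or.inr ⟨β, hβ, h, rfl⟩
  refine ⟨B, hB, .step B (LinearMap.ker α) (Finset.mem_insert_self _ _) _ _ ?_ ?_⟩
  -- The restriction lives on the subspace ker α; it is transported from the parametrization ι, on
  -- which it can be computed in coordinates.
  · let e : W ≃ₗ[K] LinearMap.ker α :=
      (LinearEquiv.ofInjective ι hι).trans (LinearEquiv.ofEq _ _ hker.symm)
    have he : ι ∘ₗ e.symm.toLinearMap = (LinearMap.ker α).subtype := by
      ext x
      obtain ⟨y, rfl⟩ := e.surjective x
      simp [e]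
    have h1 := hres.pull_equiv e.symm
    rw [pullForms_comp, he] at h1
    refine h1.isIndFree ((hypSet_restrict hB _).trans ?_)
    ext X
    simp only [hypSet, pullForms, Set.image_insert_eq, Set.mem_insert_iff, Set.mem_ofPred_eq]
    constructor
    · rintro ⟨β, rfl | hβ, h, rfl⟩
      · exact absurd (LinearMap.comp_ker_subtype α) h
      · exact ⟨β, hβ, h, rfl⟩
    · rintro ⟨β, hβ, h⟩
      exact ⟨β, Or.inr hβ, h⟩
  · have : B.delete (LinearMap.ker α) = A := by
      apply CentralArrangement.ext_hyps
      apply Finset.erase_insert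
      rwa [← Finset.mem_coe, hA]
    rwa [this]

end InductiveFreeness

/-! ### Modular coatoms and flags. -/

section Fibers

variable {K : Type u} [Field K] {V W : Type u} [AddCommGroup V] [Module K V]
  [AddCommGroup W] [Module K W]

theorem mem_hypSet_iff {Φ : Set (Dual K V)} {H : Submodule K V} :
    H ∈ hypSet Φ ↔ H ≠ ⊤ ∧ ∃ α ∈ Φ, LinearMap.ker α = H := by
  constructor
  · rintro ⟨α, hα, h0, rfl⟩
    exact ⟨fun h => h0 (LinearMap.ker_eq_top.1 h), α, hα, rfl⟩
  · rintro ⟨h, α, hα, rfl⟩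
    exact ⟨α, hα, fun h0 => h (LinearMap.ker_eq_top.2 h0), rfl⟩

theorem hypSet_pullForms_mono (f : W →ₗ[K] V) {Φ Ψ : Set (Dual K V)} (h : hypSet Φ ⊆ hypSet Ψ) :
    hypSet (pullForms f Φ) ⊆ hypSet (pullForms f Ψ) := by
  intro H hH
  obtain ⟨hH, _, ⟨α, hα, rfl⟩, rfl⟩ := mem_hypSet_iff.1 hH
  rw [LinearMap.ker_comp] at hH ⊢
  obtain ⟨-, β, hβ, hαβ⟩ := mem_hypSet_iff.1 (h (mem_hypSet_iff.2
    ⟨fun h' => hH (by rw [h', Submodule.comap_top]), α, hα, rfl⟩))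
  exact mem_hypSet_iff.2 ⟨hH, _, ⟨β, hβ, rfl⟩, by rw [LinearMap.ker_comp, hαβ]⟩

theorem hypSet_pullForms_congr (f : W →ₗ[K] V) {Φ Ψ : Set (Dual K V)}
    (h : hypSet Φ = hypSet Ψ) : hypSet (pullForms f Φ) = hypSet (pullForms f Ψ) :=
  (hypSet_pullForms_mono f h.le).antisymm (hypSet_pullForms_mono f h.ge)

/-- The forms `φ(w)` for `φ ∈ Φ` and `z - γ(w)` for `γ ∈ Γ` on `W × K`. -/
def fiberForms (Φ Γ : Set (Dual K W)) : Set (Dual K (W × K)) :=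
  pullForms (LinearMap.fst K W K) Φ ∪
    (fun γ => LinearMap.snd K W K - γ ∘ₗ LinearMap.fst K W K) '' Γ

theorem pullForms_section_fiberForms (Φ Γ : Set (Dual K W)) (γ : Dual K W) :
    pullForms (LinearMap.prod LinearMap.id γ) (fiberForms Φ Γ) =
      Φ ∪ (fun δ => γ - δ) '' Γ := by
  rw [fiberForms, pullForms, Set.image_union, pullForms, Set.image_image, Set.image_image]
  congr 1
  exact Set.image_id' Φ

/-- Restriction to z = γ turns z - δ into γ - δ, whose hyperplane is already present. Every addition
step along the fibre therefore has the base arrangement as its restriction. -/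
theorem hypSet_section_fiberForms {Φ Γ : Set (Dual K W)} {γ : Dual K W}
    (hγ : ∀ δ ∈ Γ, γ ≠ δ → LinearMap.ker (γ - δ) ∈ hypSet Φ) :
    hypSet (pullForms (LinearMap.prod LinearMap.id γ) (fiberForms Φ Γ)) = hypSet Φ := by
  rw [pullForms_section_fiberForms]
  ext H
  constructor
  · rintro ⟨α, hα | ⟨δ, hδ, rfl⟩, h0, rfl⟩
    · exact ⟨α, hα, h0, rfl⟩
    · exact hγ δ hδ (sub_ne_zero.1 h0)
  · rintro ⟨α, hα, h⟩
    exact ⟨α, Or.inl hα, h⟩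

theorem prod_id_injective (γ : Dual K W) :
    Function.Injective (LinearMap.prod (LinearMap.id : W →ₗ[K] W) γ) := fun _ _ h =>
  congrArg Prod.fst h

theorem range_prod_id (γ : Dual K W) :
    LinearMap.ker (LinearMap.snd K W K - γ ∘ₗ LinearMap.fst K W K) =
      LinearMap.range (LinearMap.prod (LinearMap.id : W →ₗ[K] W) γ) := by
  ext ⟨x, z⟩
  simp [sub_eq_zero, eq_comm (a := z)]

theorem snd_sub_ne_zero (γ : Dual K W) :
    LinearMap.snd K W K - γ ∘ₗ LinearMap.fst K W K ≠ 0 := by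
  intro h
  simpa using LinearMap.congr_fun h (0, 1)

/-- Adding hyperplanes that form a modular coatom. -/
theorem FormsIndFree.fiber [FiniteDimensional K W] {Φ : Set (Dual K W)} {E : Multiset ℕ}
    (h : FormsIndFree Φ E) (Γ : Finset (Dual K W))
    (hΓ : ∀ γ ∈ Γ, ∀ δ ∈ Γ, γ ≠ δ → LinearMap.ker (γ - δ) ∈ hypSet Φ) :
    FormsIndFree (fiberForms Φ Γ) (Γ.card ::ₘ E) := by
  classical
  induction Γ using Finset.induction_on with
  | empty =>
    have h1 := h.pull (LinearMap.fst K W K) Prod.fst_surjective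
    have h2 : finrank K (LinearMap.ker (LinearMap.fst K W K)) = 1 := by
      rw [LinearMap.ker_fst, LinearMap.finrank_range_of_inj LinearMap.inr_injective, finrank_self]
    rw [h2, Multiset.replicate_one, Multiset.singleton_add] at h1
    simpa [fiberForms] using h1
  | insert γ Γ hγ ih =>
    have h1 := ih fun a ha b hb =>
      hΓ a (Finset.mem_insert_of_mem ha) b (Finset.mem_insert_of_mem hb)
    have h2 : FormsIndFree (pullForms (LinearMap.prod LinearMap.id γ) (fiberForms Φ Γ)) E :=
      h.congr (hypSet_section_fiberForms fun δ hδ => hΓ γ (Finset.mem_insert_self _ _) δ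
        (Finset.mem_insert_of_mem hδ)).symm
    have h3 := h1.addForm (prod_id_injective γ) h2 (snd_sub_ne_zero γ) (range_prod_id γ) ?_
    · rw [Finset.card_insert_of_notMem hγ]
      convert h3 using 1
      rw [fiberForms, fiberForms, Finset.coe_insert, Set.image_insert_eq, Set.union_insert]
    -- The hyperplane z = γ is new: forms from the base vanish on the fibre direction (0, 1), and
    -- the graphs of distinct γ and δ differ.
    · intro hmem
      obtain ⟨-, β, hβ, hker⟩ := mem_hypSet_iff.1 hmem
      obtain ⟨φ, hφ, rfl⟩ | ⟨δ, hδ, rfl⟩ := hβ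
      · have : ((0, 1) : W × K) ∈ LinearMap.ker (φ ∘ₗ LinearMap.fst K W K) := by simp
        rw [hker] at this
        simp at this
      · apply hγ
        have : γ = δ := by
          ext x
          have hx : ((x, γ x) : W × K) ∈
              LinearMap.ker (LinearMap.snd K W K - γ ∘ₗ LinearMap.fst K W K) := by simp
          rw [← hker] at hx
          simpa [sub_eq_zero] using hx
        rwa [this]

/-! ### Flags -/

/-- `X` is an intersection of hyperplanes of the arrangement defined by `Φ`. -/
def FormsFlat (Φ : Set (Dual K V)) (X : Submodule K V) : Prop :=
  ∃ Ψ ⊆ Φ, ∀ x, x ∈ X ↔ ∀ α ∈ Ψ, α x = 0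

/-- The arrangement defined by `Φ` has exponents `E` and a flag witnessing ind-flag-accuracy whose
line is spanned by `w`. -/
def FormsFlagAccurate (Φ : Set (Dual K V)) (E : Multiset ℕ) (w : V) : Prop :=
  0 < finrank K V ∧ ∃ (X : ℕ → Submodule K V) (e : ℕ → ℕ), Monotone e ∧ Monotone X ∧
    E = (Multiset.range (finrank K V)).map e ∧ X 0 = Submodule.span K {w} ∧
    ∀ i < finrank K V, FormsFlat Φ (X i) ∧ finrank K (X i) = i + 1 ∧
      FormsIndFree (pullForms (X i).subtype Φ) ((Multiset.range (i + 1)).map e)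

theorem FormsIndFree.restrict_top {Φ : Set (Dual K V)} {E : Multiset ℕ} [FiniteDimensional K V]
    (h : FormsIndFree Φ E) : FormsIndFree (pullForms (⊤ : Submodule K V).subtype Φ) E :=
  h.pull_equiv Submodule.topEquiv

theorem FormsIndFree.of_restrict_top {Φ : Set (Dual K V)} {E : Multiset ℕ} [FiniteDimensional K V]
    (h : FormsIndFree (pullForms (⊤ : Submodule K V).subtype Φ) E) : FormsIndFree Φ E := by
  have := h.pull_equiv Submodule.topEquiv.symm
  rw [pullForms_comp] at this
  convert this using 1
  exact (Set.image_id' Φ).symm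

theorem FormsIndFree.restrict_map {Φ : Set (Dual K V)} {E : Multiset ℕ} [FiniteDimensional K V]
    {ι : W →ₗ[K] V} (hι : Function.Injective ι) {X : Submodule K W}
    (h : FormsIndFree (pullForms X.subtype (pullForms ι Φ)) E) :
    FormsIndFree (pullForms (X.map ι).subtype Φ) E := by
  let e := X.equivMapOfInjective ι hι
  have h1 := h.pull_equiv e.symm
  rw [pullForms_comp, pullForms_comp] at h1
  convert h1 using 2
  ext x
  obtain ⟨y, rfl⟩ := e.surjective x
  simp [e]

theorem FormsFlat.top (Φ : Set (Dual K V)) : FormsFlat Φ ⊤ :=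
  ⟨∅, Set.empty_subset _, by simp⟩

/-- A flat of the restriction to a member hyperplane is cut out in V by lifts of its equations
together with the equation of that hyperplane. -/
theorem FormsFlat.map {Φ : Set (Dual K V)} {ι : W →ₗ[K] V} {α : Dual K V} (hα : α ∈ Φ)
    (hker : LinearMap.ker α = LinearMap.range ι) {X : Submodule K W}
    (h : FormsFlat (pullForms ι Φ) X) : FormsFlat Φ (X.map ι) := by
  obtain ⟨Ψ, hΨ, hX⟩ := h
  refine ⟨insert α {β ∈ Φ | β ∘ₗ ι ∈ Ψ}, ?_, fun x => ?_⟩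
  · rintro β (rfl | hβ)
    exacts [hα, hβ.1]
  · constructor
    · rintro ⟨y, hy, rfl⟩ β (rfl | hβ)
      · exact hker.ge ⟨y, rfl⟩
      · exact (hX y).1 hy _ hβ.2
    · intro h
      obtain ⟨y, rfl⟩ := hker.le (h α (Or.inl rfl))
      refine ⟨y, (hX y).2 fun γ hγ => ?_, rfl⟩
      obtain ⟨β, hβ, rfl⟩ := hΨ hγ
      exact h β (Or.inr ⟨hβ, hγ⟩)

theorem FormsFlagAccurate.of_finrank_eq_one [FiniteDimensional K V] (hV : finrank K V = 1)
    {Φ : Set (Dual K V)} {x : ℕ} (h : FormsIndFree Φ {x}) {w : V} (hw : w ≠ 0) :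
    FormsFlagAccurate Φ {x} w := by
  refine ⟨by omega, fun _ => ⊤, fun _ => x, monotone_const, monotone_const, ?_, ?_, ?_⟩
  · simp [hV]
  · exact ((finrank_eq_one_iff_of_nonzero w hw).1 hV).symm
  · intro i hi
    obtain rfl : i = 0 := by omega
    refine ⟨FormsFlat.top Φ, by simpa using hV, ?_⟩
    simpa using h.restrict_top

/-- A flag of a member hyperplane is extended by the whole space. This is a witness because the
additional exponent is a largest one; beyond the dimension both sequences are continued constantly.
-/
theorem FormsFlagAccurate.addTop [FiniteDimensional K V] [FiniteDimensional K W]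
    {Φ : Set (Dual K V)} {ι : W →ₗ[K] V} (hι : Function.Injective ι) {α : Dual K V} (hα : α ∈ Φ)
    (h0 : α ≠ 0) (hker : LinearMap.ker α = LinearMap.range ι) {E : Multiset ℕ} {w : W} {x : ℕ}
    (hW : FormsFlagAccurate (pullForms ι Φ) E w) (hV : FormsIndFree Φ (x ::ₘ E))
    (hx : ∀ e ∈ E, e ≤ x) : FormsFlagAccurate Φ (x ::ₘ E) (ι w) := by
  obtain ⟨hpos, X, e, he, hX, rfl, hXw, h⟩ := hW
  have hn : finrank K V = finrank K W + 1 := by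
    rw [← Module.Dual.finrank_ker_add_one_of_ne_zero h0, hker, LinearMap.finrank_range_of_inj hι]
  set n := finrank K W with hndef
  have hmap : ∀ k ≤ n, (Multiset.range k).map (fun i => if i < n then e i else x) =
      (Multiset.range k).map e := fun k hk =>
    Multiset.map_congr rfl fun i hi => if_pos ((Multiset.mem_range.1 hi).trans_le hk)
  have htot : (Multiset.range (n + 1)).map (fun i => if i < n then e i else x) =
      x ::ₘ (Multiset.range n).map e := by
    rw [Multiset.range_succ, Multiset.map_cons, hmap n le_rfl, if_neg (lt_irrefl n)]
  refine ⟨by omega, fun i => if i < n then (X i).map ι else ⊤, fun i => if i < n then e i else x,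
    monotone_nat_of_le_succ fun i => ?_, monotone_nat_of_le_succ fun i => ?_, ?_, ?_, ?_⟩
  · rcases lt_trichotomy (i + 1) n with h1 | h1 | h1
    · simpa [h1, (Nat.lt_succ_self i).trans h1] using he (Nat.le_succ i)
    · have h2 : i < n := by omega
      simpa [h1, h2] using hx _ (Multiset.mem_map_of_mem e (Multiset.mem_range.2 h2))
    · have h2 : ¬ i < n := by omega
      have h3 : ¬ i + 1 < n := by omega
      simp [h2, h3]
  · by_cases h1 : i + 1 < n
    · simpa [h1, (Nat.lt_succ_self i).trans h1] using Submodule.map_mono (hX (Nat.le_succ i))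
    · simp [h1]
  · rw [hn, htot]
  · beta_reduce
    rw [if_pos hpos, hXw, Submodule.map_span, Set.image_singleton]
  · intro i hi
    beta_reduce
    by_cases h1 : i < n
    · obtain ⟨hf, hd, hE⟩ := h i h1
      rw [if_pos h1, hmap (i + 1) h1]
      refine ⟨hf.map hα hker, ?_, hE.restrict_map hι⟩
      rw [← (Submodule.equivMapOfInjective ι hι (X i)).finrank_eq, hd]
    · obtain rfl : i = n := by omega
      rw [if_neg h1, htot]
      exact ⟨FormsFlat.top Φ, by rw [finrank_top, hn], hV.restrict_top⟩

end Fibers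

/-! ### Transport of flags, and lifting them over a modular coatom. -/

section FlagTransport

variable {K : Type u} [Field K] {V W : Type u} [AddCommGroup V] [Module K V]
  [AddCommGroup W] [Module K W]

theorem FormsFlat.congr {Φ Φ' : Set (Dual K V)} {X : Submodule K V} (h : FormsFlat Φ X)
    (hΦ : hypSet Φ ⊆ hypSet Φ') : FormsFlat Φ' X := by
  obtain ⟨Ψ, hΨ, hX⟩ := h
  refine ⟨{β ∈ Φ' | ∀ x ∈ X, β x = 0}, fun β hβ => hβ.1, fun x => ⟨fun hx β hβ => hβ.2 x hx,
    fun hx => (hX x).2 fun α hα => ?_⟩⟩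
  by_cases h0 : α = 0
  · simp [h0]
  · obtain ⟨β, hβ, -, hker⟩ := hΦ ⟨α, hΨ hα, h0, rfl⟩
    have : x ∈ LinearMap.ker α := by
      rw [← hker]
      refine hx β ⟨hβ, fun y hy => ?_⟩
      have : y ∈ LinearMap.ker α := (hX y).1 hy α hα
      rwa [← hker] at this
    exact this

theorem FormsFlagAccurate.congr {Φ Φ' : Set (Dual K V)} {E : Multiset ℕ} {w : V}
    (h : FormsFlagAccurate Φ E w) (hΦ : hypSet Φ = hypSet Φ') : FormsFlagAccurate Φ' E w := by
  obtain ⟨hpos, X, e, he, hX, hE, hXw, h⟩ := h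
  refine ⟨hpos, X, e, he, hX, hE, hXw, fun i hi => ?_⟩
  obtain ⟨h1, h2, h3⟩ := h i hi
  exact ⟨h1.congr hΦ.le, h2, h3.congr (hypSet_pullForms_congr _ hΦ)⟩

theorem FormsFlat.comap {Φ : Set (Dual K V)} {X : Submodule K V} (h : FormsFlat Φ X)
    (f : W →ₗ[K] V) : FormsFlat (pullForms f Φ) (X.comap f) := by
  obtain ⟨Ψ, hΨ, hX⟩ := h
  refine ⟨pullForms f Ψ, Set.image_mono hΨ, fun x => ?_⟩
  rw [Submodule.mem_comap, hX]
  constructor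
  · rintro h _ ⟨α, hα, rfl⟩
    exact h α hα
  · intro h α hα
    exact h _ ⟨α, hα, rfl⟩

theorem FormsFlagAccurate.pull_equiv [FiniteDimensional K V] [FiniteDimensional K W]
    {Φ : Set (Dual K V)} {E : Multiset ℕ} {w : V}
    (h : FormsFlagAccurate Φ E w) (f : W ≃ₗ[K] V) :
    FormsFlagAccurate (pullForms f.toLinearMap Φ) E (f.symm w) := by
  obtain ⟨hpos, X, e, he, hX, hE, hXw, h⟩ := h
  rw [← f.finrank_eq] at *
  refine ⟨hpos, fun i => (X i).comap f.toLinearMap, e, he, fun i j hij =>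
    Submodule.comap_mono (hX hij), hE, ?_, fun i hi => ?_⟩
  · beta_reduce
    rw [hXw]
    ext x
    simp only [Submodule.mem_comap, Submodule.mem_span_singleton, LinearEquiv.coe_coe]
    refine exists_congr fun a => ?_
    rw [← map_smul, LinearEquiv.symm_apply_eq]
  · obtain ⟨h1, h2, h3⟩ := h i hi
    let g : (X i).comap f.toLinearMap ≃ₗ[K] X i := f.ofSubmodule' (X i)
    refine ⟨h1.comap _, by rw [g.finrank_eq, h2], ?_⟩
    have h4 := h3.pull_equiv g
    rw [pullForms_comp] at h4 ⊢
    exact h4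

theorem range_succ_map (e : ℕ → ℕ) (n : ℕ) :
    (Multiset.range (n + 1)).map e = e 0 ::ₘ (Multiset.range n).map fun i => e (i + 1) := by
  have : Multiset.range (n + 1) = 0 ::ₘ (Multiset.range n).map Nat.succ := by
    simp only [Multiset.range, List.range_succ_eq_map]
    rfl
  rw [this, Multiset.map_cons, Multiset.map_map]
  rfl

/-- The decomposition of the preimage of `X` in `W × K`. -/
def comapFstEquiv (X : Submodule K W) : X.comap (LinearMap.fst K W K) ≃ₗ[K] X × K where
  toFun x := (⟨x.1.1, x.2⟩, x.1.2)
  invFun x := ⟨(x.1, x.2), x.1.2⟩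
  map_add' _ _ := rfl
  map_smul' _ _ := rfl
  left_inv _ := rfl
  right_inv _ := rfl

/-- Restricted to X × K, the coatom is again a modular coatom over X. Since a vector of X separates
the elements of Γ, they stay distinct on X and the exponent is still the full cardinality. -/
theorem FormsIndFree.fiber_restrict [FiniteDimensional K W] {Φ : Set (Dual K W)} {E : Multiset ℕ}
    {X : Submodule K W} (h : FormsIndFree (pullForms X.subtype Φ) E) (Γ : Finset (Dual K W))
    (hΓ : ∀ γ ∈ Γ, ∀ δ ∈ Γ, γ ≠ δ → LinearMap.ker (γ - δ) ∈ hypSet Φ) {w : W} (hw : w ∈ X)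
    (hwΓ : ∀ γ ∈ Γ, ∀ δ ∈ Γ, γ w = δ w → γ = δ) :
    FormsIndFree (pullForms (X.comap (LinearMap.fst K W K)).subtype (fiberForms Φ Γ))
      (Γ.card ::ₘ E) := by
  classical
  let Γ' : Finset (Dual K X) := Γ.image fun γ => γ ∘ₗ X.subtype
  have hinj : ∀ γ ∈ Γ, ∀ δ ∈ Γ, γ ∘ₗ X.subtype = δ ∘ₗ X.subtype → γ = δ := fun γ hγ δ hδ h =>
    hwΓ γ hγ δ hδ (LinearMap.congr_fun h ⟨w, hw⟩)
  have hcard : Γ'.card = Γ.card :=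
    Finset.card_image_of_injOn fun γ hγ δ hδ h => hinj γ hγ δ hδ h
  have h1 := h.fiber Γ' ?_
  · rw [hcard] at h1
    have h2 := h1.pull_equiv (comapFstEquiv X)
    convert h2 using 1
    simp only [fiberForms, pullForms, Γ', Finset.coe_image, Set.image_union, Set.image_image]
    rfl
  · intro a ha b hb hab
    obtain ⟨γ, hγ, rfl⟩ := Finset.mem_image.1 ha
    obtain ⟨δ, hδ, rfl⟩ := Finset.mem_image.1 hb
    obtain ⟨-, φ, hφ, hker⟩ := mem_hypSet_iff.1 (hΓ γ hγ δ hδ fun h => hab (by rw [h]))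
    refine mem_hypSet_iff.2 ⟨fun htop => hab (sub_eq_zero.1 (LinearMap.ker_eq_top.1 htop)), _,
      ⟨φ, hφ, rfl⟩, ?_⟩
    rw [← LinearMap.sub_comp, LinearMap.ker_comp, LinearMap.ker_comp, hker]

/-- A modular coatom whose exponent is the smallest one after `1` preserves flag-accuracy. -/
theorem FormsFlagAccurate.fiber [FiniteDimensional K W] {Φ : Set (Dual K W)} {E : Multiset ℕ}
    {w : W} (h : FormsFlagAccurate Φ (1 ::ₘ E) w) (Γ : Finset (Dual K W))
    (hΓ : ∀ γ ∈ Γ, ∀ δ ∈ Γ, γ ≠ δ → LinearMap.ker (γ - δ) ∈ hypSet Φ)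
    (hwΓ : ∀ γ ∈ Γ, ∀ δ ∈ Γ, γ w = δ w → γ = δ) {γ : Dual K W} (hγ : γ ∈ Γ)
    (hE0 : E ≠ 0) (hE : ∀ e ∈ E, Γ.card ≤ e) :
    FormsFlagAccurate (fiberForms Φ Γ) (1 ::ₘ Γ.card ::ₘ E) (w, γ w) := by
  classical
  obtain ⟨hpos, X, e, he, hX, hEe, hXw, h⟩ := h
  obtain ⟨n, hn⟩ := Nat.exists_eq_succ_of_ne_zero hpos.ne'
  rw [Nat.succ_eq_add_one] at hn
  have hcard : 1 ≤ Γ.card := Finset.card_pos.2 ⟨γ, hγ⟩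
  rw [hn] at hEe h
  -- The exponent 1 occurs, and all the others are at least |Γ| ≥ 1.
  have he0 : e 0 = 1 := by
    have h1 : (1 : ℕ) ∈ (Multiset.range (n + 1)).map e := hEe ▸ Multiset.mem_cons_self _ _
    obtain ⟨i, -, hi⟩ := Multiset.mem_map.1 h1
    have h2 : e 0 ∈ 1 ::ₘ E := by
      rw [hEe]
      exact Multiset.mem_map_of_mem e (Multiset.mem_range.2 (Nat.succ_pos n))
    have h3 := he (Nat.zero_le i)
    rcases Multiset.mem_cons.1 h2 with h2 | h2
    · exact h2
    · have := hE _ h2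
      omega
  rw [range_succ_map, he0, Multiset.cons_inj_right] at hEe
  have hV : finrank K (W × K) = n + 2 := by rw [finrank_prod, hn, finrank_self]
  have hwX : ∀ i, w ∈ X i := fun i => hX (Nat.zero_le i) (hXw ▸ Submodule.mem_span_singleton_self w)
  -- The new exponents are 1, |Γ|, e_1, e_2, …. The new flag starts with the lift of the line into
  -- the hyperplane z = γ and continues with the products of the old members with K.
  let e' : ℕ → ℕ := fun i => i.casesOn 1 fun i => i.casesOn Γ.card fun i => e (i + 1)
  let ι : W →ₗ[K] W × K := LinearMap.prod LinearMap.id γ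
  let X' : ℕ → Submodule K (W × K) := fun i =>
    i.casesOn ((X 0).map ι) fun i => (X i).comap (LinearMap.fst K W K)
  have hmap : ∀ i, (Multiset.range (i + 2)).map e' =
      Γ.card ::ₘ (Multiset.range (i + 1)).map e := by
    intro i
    rw [range_succ_map, range_succ_map, range_succ_map, he0, Multiset.cons_swap]
    rfl
  refine ⟨by omega, X', e', monotone_nat_of_le_succ ?_, monotone_nat_of_le_succ ?_, ?_, ?_, ?_⟩
  · rintro (_ | _ | i)
    · exact hcard
    · change Γ.card ≤ e 1
      -- If E were empty, `e 1` would be an irrelevant value about which nothing is known.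
      cases n with
      | zero => exact absurd hEe hE0
      | succ n =>
        apply hE
        rw [hEe]
        exact Multiset.mem_map.2 ⟨0, Multiset.mem_range.2 (Nat.succ_pos n), rfl⟩
    · exact he (Nat.le_succ _)
  · rintro (_ | i)
    · rintro _ ⟨x, hx, rfl⟩
      exact hx
    · exact Submodule.comap_mono (hX (Nat.le_succ i))
  · rw [hV, hmap, range_succ_map, he0, ← hEe, Multiset.cons_swap]
  · change (X 0).map ι = _
    rw [hXw, Submodule.map_span, Set.image_singleton]
    rfl
  · rw [hV]
    rintro (_ | i) hi
    · obtain ⟨h1, h2, h3⟩ := h 0 (Nat.succ_pos n)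
      refine ⟨?_, ?_, ?_⟩
      · refine FormsFlat.map (Or.inr ⟨γ, hγ, rfl⟩) (range_prod_id γ) (h1.congr ?_)
        exact (hypSet_section_fiberForms fun δ hδ => hΓ γ hγ δ hδ).ge
      · rw [← h2]
        exact (Submodule.equivMapOfInjective ι (prod_id_injective γ) (X 0)).finrank_eq.symm
      · have h4 : (Multiset.range 1).map e' = (Multiset.range (0 + 1)).map e := by
          rw [range_succ_map, range_succ_map, he0]
          rfl
        rw [h4]
        refine FormsIndFree.restrict_map (prod_id_injective γ) (h3.congr ?_)
        exact hypSet_pullForms_congr _ (hypSet_section_fiberForms fun δ hδ => hΓ γ hγ δ hδ).symm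
    · obtain ⟨h1, h2, h3⟩ := h i (by omega)
      refine ⟨?_, ?_, ?_⟩
      · exact (h1.comap _).congr fun H ⟨α, hα, h0⟩ => ⟨α, Or.inl hα, h0⟩
      · change finrank K ((X i).comap (LinearMap.fst K W K)) = _
        rw [(comapFstEquiv (X i)).finrank_eq, finrank_prod, h2, finrank_self]
      · rw [hmap]
        exact h3.fiber_restrict Γ hΓ (hwX i) hwΓ

theorem univ_val_map_fin (n : ℕ) (e : ℕ → ℕ) :
    (Finset.univ : Finset (Fin n)).val.map (fun i : Fin n => e i) = (Multiset.range n).map e := by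
  have := congrArg (fun s : Finset ℕ => s.val.map e) (Fin.map_valEmbedding_univ (n := n))
  rw [Nat.Iio_eq_range] at this
  rw [← Finset.range_val, ← this]
  simp only [Finset.map_val, Multiset.map_map]
  rfl

theorem Iic_val_map_fin {n : ℕ} (i : Fin n) (e : ℕ → ℕ) :
    (Finset.Iic i).val.map (fun i : Fin n => e i) = (Multiset.range (i + 1)).map e := by
  have := congrArg (fun s : Finset ℕ => s.val.map e) (Fin.map_valEmbedding_Iic i)
  rw [← Nat.range_succ_eq_Iic] at this
  rw [← Finset.range_val, ← this]
  simp only [Finset.map_val, Multiset.map_map]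
  rfl

theorem FormsFlat.isFlat {Φ : Set (Dual K V)} {X : Submodule K V} (h : FormsFlat Φ X)
    {A : CentralArrangement K V} (hA : (A.hyps : Set (Submodule K V)) = hypSet Φ) :
    A.IsFlat X := by
  classical
  obtain ⟨Ψ, hΨ, hX⟩ := h
  refine ⟨A.hyps.filter fun H => X ≤ H, Finset.filter_subset _ _, le_antisymm ?_ fun x hx => ?_⟩
  · exact Finset.le_inf fun H hH => (Finset.mem_filter.1 hH).2
  · refine (hX x).2 fun α hα => ?_
    by_cases h0 : α = 0
    · simp [h0]
    · have h1 : LinearMap.ker α ∈ A.hyps := by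
        rw [← Finset.mem_coe, hA]
        exact ⟨α, hΨ hα, h0, rfl⟩
      exact (Finset.inf_le (f := id) (Finset.mem_filter.2 ⟨h1, fun y hy => (hX y).1 hy α hα⟩)) hx

/-- The last member of the flag has full dimension, so the data attached to it already contain the
inductive freeness and the exponents of the whole arrangement. -/
theorem FormsFlagAccurate.isIndFlagAccurate [FiniteDimensional K V] {Φ : Set (Dual K V)}
    {E : Multiset ℕ} {w : V} (h : FormsFlagAccurate Φ E w)
    {A : CentralArrangement K V} (hA : (A.hyps : Set (Submodule K V)) = hypSet Φ) :
    A.IsIndFlagAccurate ∧ A.IsFreeWithExp E := by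
  obtain ⟨hpos, X, e, he, hX, rfl, -, h⟩ := h
  have hind : IsIndFree A ((Multiset.range (finrank K V)).map e) := by
    obtain ⟨-, h2, h3⟩ := h (finrank K V - 1) (by omega)
    rw [Nat.sub_add_cancel hpos] at h2 h3
    rw [Submodule.eq_top_of_finrank_eq h2] at h3
    exact h3.of_restrict_top.isIndFree hA
  obtain ⟨h1, h2, -⟩ := hind.isInductivelyFree_and
  have hres : ∀ i : Fin (finrank K V), IsIndFree (A.restrict (X i))
      ((Multiset.range (i + 1)).map e) := fun i =>
    (h i i.2).2.2.isIndFree (hypSet_restrict hA _)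
  have hw : A.IsFlagAccuracyWitness fun i => X i := by
    refine ⟨⟨fun i => e i, fun i j hij => he hij, ?_, fun i => ⟨?_, ?_, ?_⟩⟩, fun i j hij => hX hij⟩
    · rwa [univ_val_map_fin]
    · exact (h i i.2).1.isFlat hA
    · exact (h i i.2).2.1
    · rw [Iic_val_map_fin]
      exact (hres i).isInductivelyFree_and.2.1
  exact ⟨⟨h1, ⟨_, hw⟩, _, hw, fun i => (hres i).isInductivelyFree_and.1⟩, h2⟩

end FlagTransport

section HypSet

variable {K : Type u} [Field K] {V : Type v} [AddCommGroup V] [Module K V]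

theorem hypSet_subset {Φ Ψ : Set (Dual K V)}
    (h : ∀ α ∈ Φ, α = 0 ∨ ∃ β ∈ Ψ, ∃ c : K, c ≠ 0 ∧ α = c • β) : hypSet Φ ⊆ hypSet Ψ := by
  rintro _ ⟨α, hα, h0, rfl⟩
  obtain h1 | ⟨β, hβ, c, hc, rfl⟩ := h α hα
  · exact absurd h1 h0
  · exact ⟨β, hβ, fun h => h0 (by rw [h, smul_zero]), (LinearMap.ker_smul β c hc).symm⟩

end HypSet

/-! ### Cones over digraphic arrangements and their restrictions to x_i = a z. -/

section Digraphs

/-- The ambient space of the cone over an arrangement in `ℝ^n`. -/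
abbrev ConeSpace (n : ℕ) : Type := (Fin n → ℝ) × ℝ

/-- The form `x_i` on the cone space. -/
def xForm {n : ℕ} (i : Fin n) : Dual ℝ (ConeSpace n) := coord i ∘ₗ LinearMap.fst ℝ _ _

/-- The form `z` on the cone space. -/
def zForm {n : ℕ} : Dual ℝ (ConeSpace n) := LinearMap.snd ℝ _ _

@[simp] theorem xForm_apply {n : ℕ} (i : Fin n) (x : ConeSpace n) : xForm i x = x.1 i := rfl

@[simp] theorem zForm_apply {n : ℕ} (x : ConeSpace n) : zForm x = x.2 := rfl

theorem finrank_coneSpace (n : ℕ) : finrank ℝ (ConeSpace n) = n + 1 := by simp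

/-- Forms defining the cone over a digraphic arrangement. -/
inductive IsDigraphForm {n : ℕ} (G : Fin n → Fin n → Prop) (ψ : Fin n → Set ℤ) :
    Dual ℝ (ConeSpace n) → Prop
  | infinity : IsDigraphForm G ψ zForm
  | diag (i j : Fin n) (hij : i ≠ j) : IsDigraphForm G ψ (xForm i - xForm j)
  | edge (i j : Fin n) (hij : i ≠ j) (h : G i j) : IsDigraphForm G ψ (xForm i - xForm j - zForm)
  | level (i : Fin n) (a : ℤ) (ha : a ∈ ψ i) : IsDigraphForm G ψ (xForm i - (a : ℝ) • zForm)

/-- The set of forms defining the cone over a digraphic arrangement. -/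
def digraphForms {n : ℕ} (G : Fin n → Fin n → Prop) (ψ : Fin n → Set ℤ) :
    Set (Dual ℝ (ConeSpace n)) := {α | IsDigraphForm G ψ α}

theorem digraphForms_congr {n : ℕ} {G G' : Fin n → Fin n → Prop} {ψ ψ' : Fin n → Set ℤ}
    (hG : ∀ i j, i ≠ j → (G i j ↔ G' i j)) (hψ : ∀ i, ψ i = ψ' i) :
    digraphForms G ψ = digraphForms G' ψ' := by
  obtain rfl : ψ = ψ' := funext hψ
  ext α
  constructor
  · rintro (_ | ⟨i, j, hij⟩ | ⟨i, j, hij, h⟩ | ⟨i, a, ha⟩)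
    exacts [.infinity, .diag i j hij, .edge i j hij ((hG i j hij).1 h), .level i a ha]
  · rintro (_ | ⟨i, j, hij⟩ | ⟨i, j, hij, h⟩ | ⟨i, a, ha⟩)
    exacts [.infinity, .diag i j hij, .edge i j hij ((hG i j hij).2 h), .level i a ha]

theorem cone_digraphicArrangement_hyps {n : ℕ} (G : Digraph (Fin n)) (ψ : Fin n → Finset ℤ) :
    ((digraphicArrangement G ψ).cone.hyps : Set (Submodule ℝ (ConeSpace n))) =
      hypSet (digraphForms G.Adj fun i => (ψ i : Set ℤ)) := by
  classical
  have hd : ∀ i j : Fin n, (coord i - coord j) ∘ₗ LinearMap.fst ℝ (Fin n → ℝ) ℝ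
      - (0 : ℝ) • LinearMap.snd ℝ (Fin n → ℝ) ℝ = xForm i - xForm j := fun i j => by
    rw [zero_smul, sub_zero]; rfl
  have he : ∀ i j : Fin n, (coord i - coord j) ∘ₗ LinearMap.fst ℝ (Fin n → ℝ) ℝ
      - (1 : ℝ) • LinearMap.snd ℝ (Fin n → ℝ) ℝ = xForm i - xForm j - zForm := fun i j => by
    rw [one_smul]; rfl
  have hmem : ∀ H, H ∈ (digraphicArrangement G ψ).cone.hyps ↔
      H = LinearMap.ker zForm ∨ ∃ H₀ ∈ (digraphicArrangement G ψ).hyps, coneHyperplane H₀ = H :=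
    fun H => by
      rw [AffineArrangement.cone, Finset.mem_insert, Finset.mem_image]
      rfl
  have hmem' : ∀ H₀, H₀ ∈ (digraphicArrangement G ψ).hyps ↔
      ((∃ i j, i < j ∧ affineLevel (coord i - coord j) 0 = H₀) ∨
        (∃ i j, (i ≠ j ∧ G.Adj i j) ∧ affineLevel (coord i - coord j) 1 = H₀)) ∨
      ∃ i, ∃ a ∈ ψ i, affineLevel (coord i) (a : ℝ) = H₀ := fun H₀ => by
    simp [digraphicArrangement, or_assoc]
  ext H
  rw [Finset.mem_coe, mem_hypSet_iff]
  constructor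
  · intro hH
    refine ⟨?_, ?_⟩
    · obtain ⟨α, h0, rfl⟩ := (digraphicArrangement G ψ).cone.isHyperplane H hH
      exact fun h => h0 (LinearMap.ker_eq_top.1 h)
    · obtain rfl | ⟨_, h, rfl⟩ := (hmem H).1 hH
      · exact ⟨_, .infinity, rfl⟩
      obtain (⟨i, j, hij, rfl⟩ | ⟨i, j, ⟨hij, h'⟩, rfl⟩) | ⟨i, a, ha, rfl⟩ := (hmem' _).1 h
      · exact ⟨_, .diag i j hij.ne, by
          rw [coneHyperplane_affineLevel _ _ (coord_sub_coord_ne_zero hij.ne), hd]⟩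
      · exact ⟨_, .edge i j hij h', by
          rw [coneHyperplane_affineLevel _ _ (coord_sub_coord_ne_zero hij), he]⟩
      · exact ⟨_, .level i a ha, by
          rw [coneHyperplane_affineLevel _ _ (coord_ne_zero i)]; rfl⟩
  · rintro ⟨-, _, _ | ⟨i, j, hij⟩ | ⟨i, j, hij, h⟩ | ⟨i, a, ha⟩, rfl⟩ <;> rw [hmem]
    · exact Or.inl rfl
    · refine Or.inr ?_
      rcases hij.lt_or_gt with hlt | hlt
      · exact ⟨_, (hmem' _).2 (Or.inl (Or.inl ⟨i, j, hlt, rfl⟩)), by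
          rw [coneHyperplane_affineLevel _ _ (coord_sub_coord_ne_zero hij), hd]⟩
      -- The list of forms contains both signs of each difference, the arrangement only the one with
      -- i < j.
      · exact ⟨_, (hmem' _).2 (Or.inl (Or.inl ⟨j, i, hlt, rfl⟩)), by
          rw [coneHyperplane_affineLevel _ _ (coord_sub_coord_ne_zero hij.symm), hd,
            ← neg_sub, LinearMap.ker_neg]⟩
    · exact Or.inr ⟨_, (hmem' _).2 (Or.inl (Or.inr ⟨i, j, ⟨hij, h⟩, rfl⟩)), by
          rw [coneHyperplane_affineLevel _ _ (coord_sub_coord_ne_zero hij), he]⟩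
    · exact Or.inr ⟨_, (hmem' _).2 (Or.inr ⟨i, a, ha, rfl⟩), by
          rw [coneHyperplane_affineLevel _ _ (coord_ne_zero i)]; rfl⟩

/-- The parametrization of `x_i = a z` by the other coordinates. -/
def insertCoord {n : ℕ} (i : Fin (n + 1)) (a : ℤ) : ConeSpace n →ₗ[ℝ] ConeSpace (n + 1) :=
  LinearMap.prod (LinearMap.pi (i.insertNth ((a : ℝ) • zForm) xForm)) zForm

section insertCoord

variable {n : ℕ} (i : Fin (n + 1)) (a : ℤ)

@[simp] theorem zForm_comp_insertCoord : zForm ∘ₗ insertCoord i a = zForm := rfl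

@[simp] theorem xForm_comp_insertCoord_same :
    xForm i ∘ₗ insertCoord i a = (a : ℝ) • zForm := by
  ext x <;> simp [insertCoord]

@[simp] theorem xForm_comp_insertCoord_succAbove (j : Fin n) :
    xForm (i.succAbove j) ∘ₗ insertCoord i a = xForm j := by
  ext x <;> simp [insertCoord]

theorem insertCoord_injective : Function.Injective (insertCoord i a) := by
  intro x y h
  ext j
  · have := congrArg (xForm (i.succAbove j)) h
    simp only [← LinearMap.comp_apply, xForm_comp_insertCoord_succAbove] at this
    exact this
  · have := congrArg zForm h
    simp only [← LinearMap.comp_apply, zForm_comp_insertCoord] at this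
    exact this

theorem insertCoord_apply (w : Fin n → ℤ) :
    insertCoord i a (fun j => (w j : ℝ), 1) =
      (fun j => ((i.insertNth a w : Fin (n + 1) → ℤ) j : ℝ), 1) := by
  refine Prod.ext (funext fun j => ?_) rfl
  refine Fin.succAboveCases i ?_ (fun j => ?_) j <;> simp [insertCoord]

theorem ker_level_eq_range :
    LinearMap.ker (xForm i - (a : ℝ) • zForm) = LinearMap.range (insertCoord i a) := by
  ext x
  constructor
  · intro hx
    have hx' : x.1 i = a * x.2 := by simpa [sub_eq_zero] using hx
    refine ⟨(fun j => x.1 (i.succAbove j), x.2), Prod.ext (funext fun j => ?_) rfl⟩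
    refine Fin.succAboveCases i ?_ (fun j => ?_) j <;> simp [insertCoord, hx']
  · rintro ⟨y, rfl⟩
    simp [insertCoord]

theorem level_ne_zero : xForm i - (a : ℝ) • zForm ≠ 0 := by
  intro h
  simpa using LinearMap.congr_fun h (Pi.single i 1, 0)

/-- The weights of the restriction to `x_i = a`. -/
def restrictWeights (G : Fin (n + 1) → Fin (n + 1) → Prop) (ψ : Fin (n + 1) → Set ℤ) (j : Fin n) :
    Set ℤ :=
  {b | b ∈ ψ (i.succAbove j) ∨ b = a ∨ (b = a + 1 ∧ G (i.succAbove j) i) ∨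
    (b = a - 1 ∧ G i (i.succAbove j))}

/-- The restriction of the cone over a digraphic arrangement to `x_i = a z`. -/
theorem hypSet_pullForms_insertCoord (G : Fin (n + 1) → Fin (n + 1) → Prop)
    (ψ : Fin (n + 1) → Set ℤ) :
    hypSet (pullForms (insertCoord i a) (digraphForms G ψ)) =
      hypSet (digraphForms (fun j k => G (i.succAbove j) (i.succAbove k))
        (restrictWeights i a G ψ)) := by
  apply subset_antisymm <;> apply hypSet_subset
  · have hz : ∀ c : ℝ, c • zForm = (0 : Dual ℝ (ConeSpace n)) ∨
        ∃ β ∈ digraphForms (fun j k => G (i.succAbove j) (i.succAbove k))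
          (restrictWeights i a G ψ), ∃ d : ℝ, d ≠ 0 ∧ c • zForm = d • β := fun c => by
      by_cases hc : c = 0
      · exact Or.inl (by rw [hc, zero_smul])
      · exact Or.inr ⟨_, .infinity, c, hc, rfl⟩
    rintro _ ⟨_, (_ | ⟨j, k, hjk⟩ | ⟨j, k, hjk, h⟩ | ⟨j, b, hb⟩), rfl⟩
    · exact Or.inr ⟨_, .infinity, 1, one_ne_zero, (one_smul _ _).symm⟩
    · obtain rfl | ⟨j, rfl⟩ := i.eq_self_or_eq_succAbove j
      · obtain ⟨k, rfl⟩ := Fin.exists_succAbove_eq hjk.symm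
        refine Or.inr ⟨_, .level k a (Or.inr (Or.inl rfl)), -1, by norm_num, ?_⟩
        simp only [LinearMap.sub_comp, xForm_comp_insertCoord_same,
          xForm_comp_insertCoord_succAbove]
        module
      · obtain rfl | ⟨k, rfl⟩ := i.eq_self_or_eq_succAbove k
        · refine Or.inr ⟨_, .level j a (Or.inr (Or.inl rfl)), 1, by norm_num, ?_⟩
          simp only [LinearMap.sub_comp, xForm_comp_insertCoord_same,
            xForm_comp_insertCoord_succAbove, one_smul]
        · refine Or.inr ⟨_, .diag j k (fun h => hjk (by rw [h])), 1, by norm_num, ?_⟩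
          simp only [LinearMap.sub_comp, xForm_comp_insertCoord_succAbove, one_smul]
    · obtain rfl | ⟨j, rfl⟩ := i.eq_self_or_eq_succAbove j
      · obtain ⟨k, rfl⟩ := Fin.exists_succAbove_eq hjk.symm
        refine Or.inr ⟨_, .level k (a - 1) (Or.inr (Or.inr (Or.inr ⟨rfl, h⟩))), -1,
          by norm_num, ?_⟩
        simp only [LinearMap.sub_comp, xForm_comp_insertCoord_same,
          xForm_comp_insertCoord_succAbove, zForm_comp_insertCoord]
        push_cast
        module
      · obtain rfl | ⟨k, rfl⟩ := i.eq_self_or_eq_succAbove k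
        · refine Or.inr ⟨_, .level j (a + 1) (Or.inr (Or.inr (Or.inl ⟨rfl, h⟩))), 1,
            by norm_num, ?_⟩
          simp only [LinearMap.sub_comp, xForm_comp_insertCoord_same,
            xForm_comp_insertCoord_succAbove, zForm_comp_insertCoord]
          push_cast
          module
        · refine Or.inr ⟨_, .edge j k (fun h => hjk (by rw [h])) h, 1, by norm_num, ?_⟩
          simp only [LinearMap.sub_comp, xForm_comp_insertCoord_succAbove,
            zForm_comp_insertCoord, one_smul]
    · obtain rfl | ⟨j, rfl⟩ := i.eq_self_or_eq_succAbove j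
      · simp only [LinearMap.sub_comp, xForm_comp_insertCoord_same, LinearMap.smul_comp,
          zForm_comp_insertCoord]
        rw [show (a : ℝ) • (zForm : Dual ℝ (ConeSpace n)) - (b : ℝ) • zForm =
          ((a : ℝ) - b) • zForm by module]
        exact hz _
      · refine Or.inr ⟨_, .level j b (Or.inl hb), 1, by norm_num, ?_⟩
        simp only [LinearMap.sub_comp, xForm_comp_insertCoord_succAbove, LinearMap.smul_comp,
          zForm_comp_insertCoord, one_smul]
  · have hs : ∀ j, i.succAbove j ≠ i := fun j => i.succAbove_ne j
    rintro _ (_ | ⟨j, k, hjk⟩ | ⟨j, k, hjk, h⟩ | ⟨j, b, (hb | rfl | ⟨rfl, h⟩ | ⟨rfl, h⟩)⟩)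
    · exact Or.inr ⟨_, ⟨_, .infinity, rfl⟩, 1, one_ne_zero, (one_smul _ _).symm⟩
    · refine Or.inr ⟨_, ⟨_, .diag (i.succAbove j) (i.succAbove k)
        (fun h => hjk (Fin.succAbove_right_injective h)), rfl⟩, 1, one_ne_zero, ?_⟩
      simp only [LinearMap.sub_comp, xForm_comp_insertCoord_succAbove, one_smul]
    · refine Or.inr ⟨_, ⟨_, .edge (i.succAbove j) (i.succAbove k)
        (fun h => hjk (Fin.succAbove_right_injective h)) h, rfl⟩, 1, one_ne_zero, ?_⟩
      simp only [LinearMap.sub_comp, xForm_comp_insertCoord_succAbove, zForm_comp_insertCoord,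
        one_smul]
    · refine Or.inr ⟨_, ⟨_, .level (i.succAbove j) b hb, rfl⟩, 1, one_ne_zero, ?_⟩
      simp only [LinearMap.sub_comp, xForm_comp_insertCoord_succAbove, LinearMap.smul_comp,
        zForm_comp_insertCoord, one_smul]
    · refine Or.inr ⟨_, ⟨_, .diag (i.succAbove j) i (hs j), rfl⟩, 1, one_ne_zero, ?_⟩
      simp only [LinearMap.sub_comp, xForm_comp_insertCoord_succAbove,
        xForm_comp_insertCoord_same, one_smul]
    · refine Or.inr ⟨_, ⟨_, .edge (i.succAbove j) i (hs j) h, rfl⟩, 1, one_ne_zero, ?_⟩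
      simp only [LinearMap.sub_comp, xForm_comp_insertCoord_succAbove,
        xForm_comp_insertCoord_same, zForm_comp_insertCoord]
      push_cast
      module
    · refine Or.inr ⟨_, ⟨_, .edge i (i.succAbove j) (hs j).symm h, rfl⟩, -1, by norm_num, ?_⟩
      simp only [LinearMap.sub_comp, xForm_comp_insertCoord_succAbove,
        xForm_comp_insertCoord_same, zForm_comp_insertCoord]
      push_cast
      module

/-- The hyperplane contains all unit vectors except the i-th, and the point with x_i = a and z = 1.
Among the defining forms, only a level at i with value a vanishes on all of these. -/
theorem ker_level_notMem_hypSet {G : Fin (n + 1) → Fin (n + 1) → Prop} {ψ : Fin (n + 1) → Set ℤ}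
    (ha : a ∉ ψ i) : LinearMap.ker (xForm i - (a : ℝ) • zForm) ∉ hypSet (digraphForms G ψ) := by
  rintro ⟨α, hα, -, hker⟩
  have h1 : ∀ j, j ≠ i → α (Pi.single j 1, 0) = 0 := fun j hj => by
    have : ((Pi.single j 1, 0) : ConeSpace (n + 1)) ∈ LinearMap.ker α := by
      rw [hker]
      simp [hj.symm]
    exact this
  have h2 : α (Pi.single i (a : ℝ), 1) = 0 := by
    have : ((Pi.single i (a : ℝ), 1) : ConeSpace (n + 1)) ∈ LinearMap.ker α := by
      rw [hker]
      simp
    exact this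
  obtain _ | ⟨j, k, hjk⟩ | ⟨j, k, hjk, h⟩ | ⟨j, b, hb⟩ := hα
  · simp at h2
  · by_cases hj : j = i
    · have := h1 k (hj ▸ hjk.symm)
      simp [hjk] at this
    · have := h1 j hj
      simp [hjk.symm] at this
  · by_cases hj : j = i
    · have := h1 k (hj ▸ hjk.symm)
      simp [hjk] at this
    · have := h1 j hj
      simp [hjk.symm] at this
  · by_cases hj : j = i
    · subst hj
      have h3 : (a : ℝ) = b := by simpa [sub_eq_zero] using h2
      rw [Int.cast_inj] at h3
      exact ha (h3 ▸ hb)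
    · have := h1 j hj
      simp at this

theorem FormsIndFree.addLevel {G : Fin (n + 1) → Fin (n + 1) → Prop} {ψ ψ' : Fin (n + 1) → Set ℤ}
    {E : Multiset ℕ} {d : ℕ} (h : FormsIndFree (digraphForms G ψ) (d ::ₘ E)) (ha : a ∉ ψ i)
    (hres : FormsIndFree (digraphForms (fun j k => G (i.succAbove j) (i.succAbove k))
      (restrictWeights i a G ψ)) E)
    (hψ' : ∀ j b, b ∈ ψ' j ↔ b ∈ ψ j ∨ (j = i ∧ b = a)) :
    FormsIndFree (digraphForms G ψ') ((d + 1) ::ₘ E) := by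
  have h1 := h.addForm (insertCoord_injective i a)
    (hres.congr (hypSet_pullForms_insertCoord i a G ψ).symm) (level_ne_zero i a)
    (ker_level_eq_range i a) (ker_level_notMem_hypSet i a ha)
  convert h1 using 1
  ext α
  constructor
  · rintro (_ | ⟨j, k, hjk⟩ | ⟨j, k, hjk, h⟩ | ⟨j, b, hb⟩)
    · exact Or.inr .infinity
    · exact Or.inr (.diag j k hjk)
    · exact Or.inr (.edge j k hjk h)
    · obtain hb | ⟨rfl, rfl⟩ := (hψ' j b).1 hb
      · exact Or.inr (.level j b hb)
      · exact Or.inl rfl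
  · rintro (rfl | _ | ⟨j, k, hjk⟩ | ⟨j, k, hjk, h⟩ | ⟨j, b, hb⟩)
    · exact .level i a ((hψ' i a).2 (Or.inr ⟨rfl, rfl⟩))
    · exact .infinity
    · exact .diag j k hjk
    · exact .edge j k hjk h
    · exact .level j b ((hψ' j b).2 (Or.inl hb))

theorem FormsFlagAccurate.addLevel {G : Fin (n + 1) → Fin (n + 1) → Prop}
    {ψ : Fin (n + 1) → Set ℤ} {E : Multiset ℕ} {x : ℕ} {w : Fin n → ℤ} (ha : a ∈ ψ i)
    (hres : FormsFlagAccurate (digraphForms (fun j k => G (i.succAbove j) (i.succAbove k))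
      (restrictWeights i a G ψ)) E (fun j => (w j : ℝ), 1))
    (h : FormsIndFree (digraphForms G ψ) (x ::ₘ E)) (hx : ∀ e ∈ E, e ≤ x) :
    FormsFlagAccurate (digraphForms G ψ) (x ::ₘ E)
      (fun j => ((i.insertNth a w : Fin (n + 1) → ℤ) j : ℝ), 1) := by
  rw [← insertCoord_apply]
  exact FormsFlagAccurate.addTop (insertCoord_injective i a) (.level i a ha) (level_ne_zero i a)
    (ker_level_eq_range i a) (hres.congr (hypSet_pullForms_insertCoord i a G ψ).symm) h hx

end insertCoord

end Digraphs

/-! ### A last vertex without incoming edges as a modular coatom. -/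

section SnocFiber

/-- Splitting off the last coordinate. -/
def snocEquiv (n : ℕ) : ConeSpace (n + 1) ≃ₗ[ℝ] ConeSpace n × ℝ where
  toFun x := ((fun i => x.1 i.castSucc, x.2), x.1 (Fin.last n))
  invFun y := (Fin.snoc (α := fun _ => ℝ) y.1.1 y.2, y.1.2)
  map_add' _ _ := rfl
  map_smul' _ _ := rfl
  left_inv x := by
    refine Prod.ext (funext fun i => ?_) rfl
    refine Fin.lastCases ?_ (fun i => ?_) i <;> simp
  right_inv y := by
    refine Prod.ext (Prod.ext (funext fun i => ?_) rfl) ?_ <;> simp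

variable {n : ℕ}

/-- The fibre coordinates of the hyperplanes `x_last = x_i`, `x_last = x_i + z` and
`x_last = a z`. -/
def fiberForm (T : Finset (Fin n)) (S : Finset ℤ) : Fin n ⊕ T ⊕ S → Dual ℝ (ConeSpace n) :=
  Sum.elim xForm (Sum.elim (fun i => xForm i.1 + zForm) fun a => (a.1 : ℝ) • zForm)

theorem fiberForm_injective (T : Finset (Fin n)) (S : Finset ℤ) :
    Function.Injective (fiberForm T S) := by
  have hz : ∀ i : Fin n, ((i : ℕ) : ℝ) + 1 ≠ 0 := fun i => by positivity
  intro a b h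
  -- Two test vectors suffice: distinct non-zero coordinates at z = 0 identify the vertex, and the
  -- vector with x = 0 and z = 1 reads off the multiple of z.
  have h1 := LinearMap.congr_fun h (fun j => ((j : ℕ) : ℝ) + 1, 0)
  have h2 := LinearMap.congr_fun h (0, 1)
  rcases a with i | ⟨i, hi⟩ | ⟨a, ha⟩ <;> rcases b with j | ⟨j, hj⟩ | ⟨b, hb⟩ <;>
    simp [fiberForm, Fin.ext_iff, hz, (hz _).symm] at h1 h2 ⊢ <;> assumption

/-- The set of all `fiberForm`s. -/
def fiberFormSet (T : Finset (Fin n)) (S : Finset ℤ) : Finset (Dual ℝ (ConeSpace n)) :=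
  Finset.univ.map ⟨fiberForm T S, fiberForm_injective T S⟩

theorem card_fiberFormSet (T : Finset (Fin n)) (S : Finset ℤ) :
    (fiberFormSet T S).card = n + (T.card + S.card) := by
  simp [fiberFormSet]

theorem mem_fiberFormSet {T : Finset (Fin n)} {S : Finset ℤ} {γ : Dual ℝ (ConeSpace n)} :
    γ ∈ fiberFormSet T S ↔
      (∃ i, γ = xForm i) ∨ (∃ i ∈ T, γ = xForm i + zForm) ∨ ∃ a ∈ S, γ = (a : ℝ) • zForm := by
  simp [fiberFormSet, fiberForm, eq_comm]

theorem ker_sub_mem_hypSet {V : Type*} [AddCommGroup V] [Module ℝ V] {Φ : Set (Dual ℝ V)}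
    {γ δ β : Dual ℝ V} (hne : γ ≠ δ) (hβ : β ∈ Φ) (c : ℝ) (h : γ - δ = c • β) :
    LinearMap.ker (γ - δ) ∈ hypSet Φ := by
  have hc : c ≠ 0 := by
    rintro rfl
    exact hne (sub_eq_zero.1 (by rw [h, zero_smul]))
  refine ⟨β, hβ, fun h0 => hne (sub_eq_zero.1 (by rw [h, h0, smul_zero])), ?_⟩
  rw [h, LinearMap.ker_smul _ _ hc]

variable {G : Fin (n + 1) → Fin (n + 1) → Prop} {ψ : Fin (n + 1) → Set ℤ} {T : Finset (Fin n)}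
  {S : Finset ℤ}

theorem hypSet_pullForms_snocEquiv (hG : ∀ i : Fin n, ¬ G i.castSucc (Fin.last n))
    (hT : ∀ i : Fin n, i ∈ T ↔ G (Fin.last n) i.castSucc) (hS : (S : Set ℤ) = ψ (Fin.last n)) :
    hypSet (pullForms (snocEquiv n).toLinearMap (fiberForms
      (digraphForms (fun i j => G i.castSucc j.castSucc) fun i => ψ i.castSucc)
      (fiberFormSet T S))) = hypSet (digraphForms G ψ) := by
  have hS' : ∀ a, a ∈ S ↔ a ∈ ψ (Fin.last n) := fun a => by rw [← hS, Finset.mem_coe]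
  have hx : ∀ i : Fin n, (xForm i ∘ₗ LinearMap.fst ℝ (ConeSpace n) ℝ) ∘ₗ
      (snocEquiv n).toLinearMap = xForm i.castSucc := fun i => rfl
  have hz : (zForm ∘ₗ LinearMap.fst ℝ (ConeSpace n) ℝ) ∘ₗ
      (snocEquiv n).toLinearMap = zForm := rfl
  have hl : LinearMap.snd ℝ (ConeSpace n) ℝ ∘ₗ (snocEquiv n).toLinearMap =
      xForm (Fin.last n) := rfl
  apply subset_antisymm <;> apply hypSet_subset
  · rintro _ ⟨_, ⟨_, (_ | ⟨i, j, hij⟩ | ⟨i, j, hij, h⟩ | ⟨i, a, ha⟩), rfl⟩ | ⟨γ, hγ, rfl⟩, rfl⟩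
    · exact Or.inr ⟨_, .infinity, 1, one_ne_zero, (one_smul _ _).symm⟩
    · exact Or.inr ⟨_, .diag i.castSucc j.castSucc (fun h => hij (Fin.castSucc_injective n h)), 1,
        one_ne_zero, (one_smul _ _).symm⟩
    · exact Or.inr ⟨_, .edge i.castSucc j.castSucc (fun h => hij (Fin.castSucc_injective n h)) h, 1,
        one_ne_zero, (one_smul _ _).symm⟩
    · exact Or.inr ⟨_, .level i.castSucc a ha, 1, one_ne_zero, (one_smul _ _).symm⟩
    · have hne : ∀ i : Fin n, Fin.last n ≠ i.castSucc := fun i => (Fin.castSucc_lt_last i).ne'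
      obtain ⟨i, rfl⟩ | ⟨i, hi, rfl⟩ | ⟨a, ha, rfl⟩ := mem_fiberFormSet.1 hγ
      · refine Or.inr ⟨_, .diag (Fin.last n) i.castSucc (hne i), 1, one_ne_zero, ?_⟩
        simp only [LinearMap.sub_comp, hx, hl, one_smul]
      · refine Or.inr ⟨_, .edge (Fin.last n) i.castSucc (hne i) ((hT i).1 hi), 1, one_ne_zero, ?_⟩
        simp only [LinearMap.sub_comp, LinearMap.add_comp, hx, hl, hz, one_smul]
        abel
      · refine Or.inr ⟨_, .level (Fin.last n) a ((hS' a).1 ha), 1, one_ne_zero, ?_⟩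
        simp only [LinearMap.sub_comp, LinearMap.smul_comp, hz, hl, one_smul]
  · have h1 : ∀ α ∈ digraphForms (fun i j => G i.castSucc j.castSucc) (fun i => ψ i.castSucc),
        (α ∘ₗ LinearMap.fst ℝ (ConeSpace n) ℝ) ∘ₗ (snocEquiv n).toLinearMap ∈
          pullForms (snocEquiv n).toLinearMap (fiberForms
            (digraphForms (fun i j => G i.castSucc j.castSucc) fun i => ψ i.castSucc)
            (fiberFormSet T S)) := fun α hα => ⟨_, Or.inl ⟨α, hα, rfl⟩, rfl⟩
    have h2 : ∀ γ ∈ fiberFormSet T S, (LinearMap.snd ℝ (ConeSpace n) ℝ -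
        γ ∘ₗ LinearMap.fst ℝ (ConeSpace n) ℝ) ∘ₗ (snocEquiv n).toLinearMap ∈
          pullForms (snocEquiv n).toLinearMap (fiberForms
            (digraphForms (fun i j => G i.castSucc j.castSucc) fun i => ψ i.castSucc)
            (fiberFormSet T S)) := fun γ hγ => ⟨_, Or.inr ⟨γ, hγ, rfl⟩, rfl⟩
    rintro _ (_ | ⟨i, j, hij⟩ | ⟨i, j, hij, h⟩ | ⟨i, a, ha⟩)
    · exact Or.inr ⟨_, h1 _ .infinity, 1, one_ne_zero, (one_smul _ _).symm⟩
    · cases i using Fin.lastCases with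
      | last =>
        obtain ⟨j, rfl⟩ := Fin.exists_castSucc_eq.2 hij.symm
        refine Or.inr ⟨_, h2 (xForm j) (mem_fiberFormSet.2 (Or.inl ⟨j, rfl⟩)), 1, one_ne_zero, ?_⟩
        simp only [LinearMap.sub_comp, hx, hl, one_smul]
      | cast i =>
        cases j using Fin.lastCases with
        | last =>
          refine Or.inr ⟨_, h2 (xForm i) (mem_fiberFormSet.2 (Or.inl ⟨i, rfl⟩)), -1,
            by norm_num, ?_⟩
          simp only [LinearMap.sub_comp, hx, hl]
          module
        | cast j =>
          exact Or.inr ⟨_, h1 _ (.diag i j fun h => hij (by rw [h])), 1, one_ne_zero,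
            (one_smul _ _).symm⟩
    · cases i using Fin.lastCases with
      | last =>
        obtain ⟨j, rfl⟩ := Fin.exists_castSucc_eq.2 hij.symm
        refine Or.inr ⟨_, h2 (xForm j + zForm) (mem_fiberFormSet.2
          (Or.inr (Or.inl ⟨j, (hT j).2 h, rfl⟩))), 1, one_ne_zero, ?_⟩
        simp only [LinearMap.sub_comp, LinearMap.add_comp, hx, hl, hz, one_smul]
        abel
      | cast i =>
        cases j using Fin.lastCases with
        | last => exact absurd h (hG i)
        | cast j =>
          exact Or.inr ⟨_, h1 _ (.edge i j (fun h => hij (by rw [h])) h), 1, one_ne_zero,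
            (one_smul _ _).symm⟩
    · cases i using Fin.lastCases with
      | last =>
        refine Or.inr ⟨_, h2 ((a : ℝ) • zForm) (mem_fiberFormSet.2
          (Or.inr (Or.inr ⟨a, (hS' a).2 ha, rfl⟩))), 1, one_ne_zero, ?_⟩
        simp only [LinearMap.sub_comp, LinearMap.smul_comp, hz, hl, one_smul]
      | cast i => exact Or.inr ⟨_, h1 _ (.level i a ha), 1, one_ne_zero, (one_smul _ _).symm⟩

/-- Differences of fibre coordinates are, up to scalars, z, diagonals, edges into T, levels a from
S, and levels a - 1 at vertices of T; the hypotheses say that these are all present. -/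
theorem ker_fiberForm_sub_mem {G' : Fin n → Fin n → Prop} {ψ' : Fin n → Set ℤ}
    (h1 : ∀ i, ∀ a ∈ S, a ∈ ψ' i) (h2 : ∀ j ∈ T, ∀ i, G' i j)
    (h3 : ∀ i ∈ T, ∀ a ∈ S, a - 1 ∈ ψ' i) :
    ∀ γ ∈ fiberFormSet T S, ∀ δ ∈ fiberFormSet T S, γ ≠ δ →
      LinearMap.ker (γ - δ) ∈ hypSet (digraphForms G' ψ') := by
  intro γ hγ δ hδ hne
  obtain ⟨i, rfl⟩ | ⟨i, hi, rfl⟩ | ⟨a, ha, rfl⟩ := mem_fiberFormSet.1 hγ <;>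
    obtain ⟨j, rfl⟩ | ⟨j, hj, rfl⟩ | ⟨b, hb, rfl⟩ := mem_fiberFormSet.1 hδ
  · refine ker_sub_mem_hypSet hne (.diag i j fun h => hne (by rw [h])) 1 (by module)
  · by_cases hij : i = j
    · subst hij
      exact ker_sub_mem_hypSet hne .infinity (-1) (by module)
    · exact ker_sub_mem_hypSet hne (.edge i j hij (h2 j hj i)) 1 (by module)
  · exact ker_sub_mem_hypSet hne (.level i b (h1 i b hb)) 1 (by module)
  · by_cases hij : j = i
    · subst hij
      exact ker_sub_mem_hypSet hne .infinity 1 (by module)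
    · exact ker_sub_mem_hypSet hne (.edge j i hij (h2 i hi j)) (-1) (by module)
  · refine ker_sub_mem_hypSet hne (.diag i j fun h => hne (by rw [h])) 1 (by module)
  · exact ker_sub_mem_hypSet hne (.level i (b - 1) (h3 i hi b hb)) 1 (by push_cast; module)
  · exact ker_sub_mem_hypSet hne (.level j a (h1 j a ha)) (-1) (by module)
  · exact ker_sub_mem_hypSet hne (.level j (a - 1) (h3 j hj a ha)) (-1) (by push_cast; module)
  · exact ker_sub_mem_hypSet hne .infinity ((a : ℝ) - b) (by module)

/-- Adding a last vertex without incoming edges whose hyperplanes form a modular coatom. -/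
theorem FormsIndFree.addSnoc {E : Multiset ℕ}
    (h : FormsIndFree (digraphForms (fun i j => G i.castSucc j.castSucc)
      fun i => ψ i.castSucc) E) (hG : ∀ i : Fin n, ¬ G i.castSucc (Fin.last n))
    (hT : ∀ i : Fin n, i ∈ T ↔ G (Fin.last n) i.castSucc) (hS : (S : Set ℤ) = ψ (Fin.last n))
    (h1 : ∀ i : Fin n, ∀ a ∈ S, a ∈ ψ i.castSucc)
    (h2 : ∀ j ∈ T, ∀ i : Fin n, G i.castSucc j.castSucc)
    (h3 : ∀ i ∈ T, ∀ a ∈ S, a - 1 ∈ ψ i.castSucc) :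
    FormsIndFree (digraphForms G ψ) ((n + (T.card + S.card)) ::ₘ E) := by
  rw [← card_fiberFormSet]
  exact ((h.fiber (fiberFormSet T S) (ker_fiberForm_sub_mem h1 h2 h3)).pull_equiv
    (snocEquiv n)).congr (hypSet_pullForms_snocEquiv hG hT hS)

/-- Adding an isolated last vertex with a small weight. -/
theorem FormsFlagAccurate.addSnoc {E : Multiset ℕ} {w : Fin n → ℤ}
    (h : FormsFlagAccurate (digraphForms (fun i j => G i.castSucc j.castSucc)
      fun i => ψ i.castSucc) (1 ::ₘ E) (fun i => (w i : ℝ), 1))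
    (hG : ∀ i : Fin n, ¬ G i.castSucc (Fin.last n))
    (hG' : ∀ i : Fin n, ¬ G (Fin.last n) i.castSucc) (hS : (S : Set ℤ) = ψ (Fin.last n))
    (h1 : ∀ i : Fin n, ∀ a ∈ S, a ∈ ψ i.castSucc) (hw : Function.Injective w)
    (hwS : ∀ i, w i ∉ S) {a : ℤ} (ha : a ∈ S) (hE0 : E ≠ 0) (hE : ∀ e ∈ E, n + S.card ≤ e) :
    FormsFlagAccurate (digraphForms G ψ) (1 ::ₘ (n + S.card) ::ₘ E)
      (fun i => ((Fin.snoc w a : Fin (n + 1) → ℤ) i : ℝ), 1) := by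
  have hcard : (fiberFormSet (∅ : Finset (Fin n)) S).card = n + S.card := by
    rw [card_fiberFormSet, Finset.card_empty, zero_add]
  have h2 := (h.fiber (fiberFormSet ∅ S) (ker_fiberForm_sub_mem h1 (by simp) (by simp))
    ?_ (γ := (a : ℝ) • zForm) (mem_fiberFormSet.2 (Or.inr (Or.inr ⟨a, ha, rfl⟩))) hE0
    (by rwa [hcard])).pull_equiv (snocEquiv n)
  · rw [hcard] at h2
    convert h2.congr (hypSet_pullForms_snocEquiv hG (by simpa using hG') hS) using 1
    refine Prod.ext (funext fun i => ?_) rfl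
    refine Fin.lastCases ?_ (fun i => ?_) i <;> simp [snocEquiv]
  -- At (w, 1) the fibre coordinates take the values w_i and the elements of S, which are pairwise
  -- distinct.
  · intro γ hγ δ hδ heq
    obtain ⟨i, rfl⟩ | ⟨i, hi, rfl⟩ | ⟨b, hb, rfl⟩ := mem_fiberFormSet.1 hγ <;>
      obtain ⟨j, rfl⟩ | ⟨j, hj, rfl⟩ | ⟨b', hb', rfl⟩ := mem_fiberFormSet.1 hδ
    · have : w i = w j := by simpa using heq
      rw [hw this]
    · simp at hj
    · have : w i = b' := by
        have : (w i : ℝ) = b' := by simpa using heq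
        exact_mod_cast this
      exact absurd (this ▸ hb') (hwS i)
    · simp at hi
    · simp at hi
    · simp at hi
    · have : w j = b := by
        have : (b : ℝ) = w j := by simpa using heq
        exact_mod_cast this.symm
      exact absurd (this ▸ hb) (hwS j)
    · simp at hj
    · have : (b : ℝ) = b' := by simpa using heq
      rw [this]

end SnocFiber

/-! ### Inductive freeness for the complete digraph and its first sink mutation. -/

section Catalan

theorem Ico_val_eq_cons_left {a b : ℕ} (h : a < b) :
    (Finset.Ico a b).val = a ::ₘ (Finset.Ico (a + 1) b).val := by
  rw [← Finset.insert_val_of_notMem (by simp)]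
  congr 1
  ext x
  simp only [Finset.mem_Ico, Finset.mem_insert]
  omega

theorem Ico_val_eq_cons_right {a b : ℕ} (h : a ≤ b) :
    (Finset.Ico a (b + 1)).val = b ::ₘ (Finset.Ico a b).val := by
  rw [← Finset.insert_val_of_notMem (by simp)]
  congr 1
  ext x
  simp only [Finset.mem_Ico, Finset.mem_insert]
  omega

/-- The weight `[lo i, hi i)`, enlarged by one point for `i ≥ p`. -/
def stepWeights {n : ℕ} (lo hi : Fin n → ℤ) (p : ℕ) (i : Fin n) : Set ℤ :=
  Set.Ico (lo i) (if p ≤ i then hi i + 1 else hi i)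

/-- Adding the hyperplanes `x_i = hi i` in decreasing order of `i`. -/
theorem FormsIndFree.stepWeights {n : ℕ} (G : Fin (n + 1) → Fin (n + 1) → Prop)
    (lo hi : Fin (n + 1) → ℤ) (hle : ∀ i, lo i ≤ hi i) {d : ℕ} {E : Multiset ℕ}
    (hbase : FormsIndFree (digraphForms G (stepWeights lo hi (n + 1))) (d ::ₘ E))
    (hres : ∀ q : Fin (n + 1), FormsIndFree
      (digraphForms (fun j k => G (q.succAbove j) (q.succAbove k))
        (restrictWeights q (hi q) G (Arr.stepWeights lo hi (q + 1)))) E) (p : ℕ)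
    (hp : p ≤ n + 1) :
    FormsIndFree (digraphForms G (Arr.stepWeights lo hi p)) ((d + (n + 1 - p)) ::ₘ E) := by
  -- All restrictions share the exponents E, so each new hyperplane raises the one remaining
  -- exponent by 1.
  induction hp using Nat.decreasingInduction with
  | self => simpa using hbase
  | of_succ q hq ih =>
    have h1 : d + (n + 1 - q) = d + (n + 1 - (q + 1)) + 1 := by omega
    rw [h1]
    refine ih.addLevel ⟨q, hq⟩ (hi ⟨q, hq⟩) ?_ (hres ⟨q, hq⟩) fun j b => ?_
    · simp [Arr.stepWeights]
    · have hj := hle j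
      by_cases hjq : j = ⟨q, hq⟩
      · subst hjq
        simp only [Arr.stepWeights, Set.mem_Ico, le_refl, if_true, Nat.not_succ_le_self, if_false,
          true_and]
        omega
      · have h2 : q ≤ j ↔ q + 1 ≤ j := by
          have : (j : ℕ) ≠ q := fun h => hjq (Fin.ext h)
          omega
        simp [Arr.stepWeights, hjq, h2]

theorem stepWeights_const_top {n : ℕ} (lo hi : ℤ) :
    stepWeights (fun _ : Fin n => lo) (fun _ => hi) n = fun _ => Set.Ico lo hi := by
  funext i
  simp only [stepWeights, if_neg (not_le.2 i.2)]

theorem stepWeights_const_zero {n : ℕ} (lo hi : ℤ) :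
    stepWeights (fun _ : Fin n => lo) (fun _ => hi) 0 = fun _ => Set.Ico lo (hi + 1) := by
  funext i
  simp [stepWeights]

/-- Restriction of a complete digraph with interval weights. -/
theorem restrictWeights_complete {n : ℕ} (lo : ℤ) (L : ℕ) (q : Fin (n + 1)) (hL : 1 ≤ L) :
    restrictWeights q (lo + L) (fun _ _ => True)
      (stepWeights (fun _ => lo) (fun _ => lo + L) (q + 1)) =
        fun _ => Set.Ico lo (lo + (L + 2 : ℕ)) := by
  funext j
  ext b
  simp only [restrictWeights, stepWeights, Set.mem_ofPred_eq, Set.mem_Ico, and_true]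
  push_cast
  split_ifs <;> omega

/-- For empty weights, the first level creates the three values lo - 1, lo, lo + 1 at every other
vertex. This has length 3 rather than 2, so the case is separate. -/
theorem restrictWeights_complete_empty {n : ℕ} (lo : ℤ) (q : Fin (n + 1)) :
    restrictWeights q lo (fun _ _ => True)
      (stepWeights (fun _ => lo) (fun _ => lo) (q + 1)) =
        fun _ => Set.Ico (lo - 1) (lo - 1 + (3 : ℕ)) := by
  funext j
  ext b
  simp only [restrictWeights, stepWeights, Set.mem_ofPred_eq, Set.mem_Ico, and_true]
  push_cast
  split_ifs <;> omega

theorem isIndFree_zForm :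
    FormsIndFree (digraphForms (n := 0) (fun _ _ => True) fun _ => ∅) {1} := by
  have h1 : FormsIndFree (∅ : Set (Dual ℝ (ConeSpace 0))) (0 ::ₘ 0) := by
    refine ⟨⟨∅, by simp⟩, by simp [hypSet], ?_⟩
    have := IsIndFree.empty (⟨∅, by simp⟩ : CentralArrangement ℝ (ConeSpace 0)) rfl
    rwa [finrank_coneSpace] at this
  have h2 : FormsIndFree (∅ : Set (Dual ℝ (LinearMap.ker (zForm (n := 0))))) 0 := by
    refine ⟨⟨∅, by simp⟩, by simp [hypSet], ?_⟩
    have := IsIndFree.empty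
      (⟨∅, by simp⟩ : CentralArrangement ℝ (LinearMap.ker (zForm (n := 0)))) rfl
    have h3 : finrank ℝ (LinearMap.ker (zForm (n := 0))) + 1 = 1 := by
      rw [Module.Dual.finrank_ker_add_one_of_ne_zero, finrank_coneSpace]
      intro h
      simpa using LinearMap.congr_fun h (0, 1)
    rwa [Nat.add_eq_right.1 h3] at this
  have h3 := h1.addForm (Submodule.subtype_injective (LinearMap.ker (zForm (n := 0))))
    (by simpa [pullForms] using h2) (α := zForm) (fun h => by
      simpa using LinearMap.congr_fun h (0, 1)) (by simp) (by simp [hypSet])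
  refine h3.congr (congrArg hypSet ?_)
  ext α
  constructor
  · rintro (rfl | h)
    · exact .infinity
    · exact absurd h (Set.notMem_empty α)
  · rintro (_ | ⟨i, _⟩ | ⟨i, _⟩ | ⟨i, _⟩)
    · exact Or.inl rfl
    all_goals exact i.elim0

/-- The essentialization of the cone over the Catalan arrangement. -/
def differenceMap (n : ℕ) : ConeSpace (n + 1) →ₗ[ℝ] ConeSpace n :=
  LinearMap.prod (LinearMap.pi fun i => xForm i.succ - xForm 0) zForm

theorem differenceMap_surjective (n : ℕ) : Function.Surjective (differenceMap n) := by
  intro y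
  refine ⟨(Fin.cons 0 y.1, y.2), Prod.ext (funext fun i => ?_) rfl⟩
  simp [differenceMap]

theorem finrank_ker_differenceMap (n : ℕ) :
    finrank ℝ (LinearMap.ker (differenceMap n)) = 1 := by
  have := LinearMap.finrank_range_add_finrank_ker (differenceMap n)
  rw [LinearMap.range_eq_top.2 (differenceMap_surjective n), finrank_top, finrank_coneSpace,
    finrank_coneSpace] at this
  omega

/-- In the coordinates x_i - x_0, the diagonal and the two edges between 0 and another vertex become
the levels 0, 1 and -1. -/
theorem hypSet_pullForms_differenceMap (n : ℕ) :
    hypSet (pullForms (differenceMap n)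
      (digraphForms (fun _ _ => True) fun _ => Set.Ico (-1) (-1 + (3 : ℕ)))) =
      hypSet (digraphForms (fun _ _ => True) fun _ => ∅) := by
  have hx : ∀ i, xForm i ∘ₗ differenceMap n = xForm i.succ - xForm 0 := fun i => rfl
  have hz : zForm ∘ₗ differenceMap n = zForm := rfl
  apply subset_antisymm <;> apply hypSet_subset
  · rintro _ ⟨_, (_ | ⟨i, j, hij⟩ | ⟨i, j, hij, h⟩ | ⟨i, a, ha⟩), rfl⟩
    · exact Or.inr ⟨_, .infinity, 1, one_ne_zero, (one_smul _ _).symm⟩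
    · refine Or.inr ⟨_, .diag i.succ j.succ fun h => hij (Fin.succ_injective n h), 1,
        one_ne_zero, ?_⟩
      simp only [LinearMap.sub_comp, hx]
      module
    · refine Or.inr ⟨_, .edge i.succ j.succ (fun h => hij (Fin.succ_injective n h)) trivial, 1,
        one_ne_zero, ?_⟩
      simp only [LinearMap.sub_comp, hx, hz]
      module
    · have ha' : a = -1 ∨ a = 0 ∨ a = 1 := by
        simp only [Set.mem_Ico] at ha
        push_cast at ha
        omega
      obtain rfl | rfl | rfl := ha'
      · refine Or.inr ⟨_, .edge 0 i.succ (Fin.succ_ne_zero i).symm trivial, -1, by norm_num, ?_⟩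
        simp only [LinearMap.sub_comp, LinearMap.smul_comp, hx, hz]
        push_cast
        module
      · refine Or.inr ⟨_, .diag i.succ 0 (Fin.succ_ne_zero i), 1, by norm_num, ?_⟩
        simp only [LinearMap.sub_comp, LinearMap.smul_comp, hx, hz]
        push_cast
        module
      · refine Or.inr ⟨_, .edge i.succ 0 (Fin.succ_ne_zero i) trivial, 1, by norm_num, ?_⟩
        simp only [LinearMap.sub_comp, LinearMap.smul_comp, hx, hz]
        push_cast
        module
  · rintro _ (_ | ⟨i, j, hij⟩ | ⟨i, j, hij, h⟩ | ⟨i, a, ha⟩)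
    · exact Or.inr ⟨_, ⟨_, .infinity, rfl⟩, 1, one_ne_zero, (one_smul _ _).symm⟩
    · cases i using Fin.cases with
      | zero =>
        obtain ⟨j, rfl⟩ := Fin.exists_succ_eq.2 hij.symm
        refine Or.inr ⟨_, ⟨_, .level j 0 (by simp), rfl⟩, -1, by norm_num, ?_⟩
        simp only [LinearMap.sub_comp, LinearMap.smul_comp, hx, hz]
        push_cast
        module
      | succ i =>
        cases j using Fin.cases with
        | zero =>
          refine Or.inr ⟨_, ⟨_, .level i 0 (by simp), rfl⟩, 1, by norm_num, ?_⟩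
          simp only [LinearMap.sub_comp, LinearMap.smul_comp, hx, hz]
          push_cast
          module
        | succ j =>
          refine Or.inr ⟨_, ⟨_, .diag i j fun h => hij (by rw [h]), rfl⟩, 1, by norm_num, ?_⟩
          simp only [LinearMap.sub_comp, hx]
          module
    · cases i using Fin.cases with
      | zero =>
        obtain ⟨j, rfl⟩ := Fin.exists_succ_eq.2 hij.symm
        refine Or.inr ⟨_, ⟨_, .level j (-1) (by simp), rfl⟩, -1, by norm_num, ?_⟩
        simp only [LinearMap.sub_comp, LinearMap.smul_comp, hx, hz]
        push_cast
        module
      | succ i =>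
        cases j using Fin.cases with
        | zero =>
          refine Or.inr ⟨_, ⟨_, .level i 1 (by norm_num), rfl⟩, 1, by norm_num, ?_⟩
          simp only [LinearMap.sub_comp, LinearMap.smul_comp, hx, hz]
          push_cast
          module
        | succ j =>
          refine Or.inr ⟨_, ⟨_, .edge i j (fun h => hij (by rw [h])) trivial, rfl⟩, 1,
            by norm_num, ?_⟩
          simp only [LinearMap.sub_comp, hx, hz]
          module
    · exact absurd ha (Set.notMem_empty a)

/-- The cone over the complete digraph with equal interval weights of length `L`. -/
theorem formsIndFree_complete (n : ℕ) : ∀ (lo : ℤ) (L : ℕ), 1 ≤ L →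
    FormsIndFree (digraphForms (n := n) (fun _ _ => True) fun _ => Set.Ico lo (lo + L))
      (1 ::ₘ (Finset.Ico (L + n - 1) (L + 2 * n - 1)).val) := by
  induction n with
  | zero =>
    intro lo L hL
    have h := isIndFree_zForm
    rw [digraphForms_congr (G' := fun _ _ => True) (ψ' := fun _ => Set.Ico lo (lo + L))
      (fun _ _ _ => Iff.rfl) (fun i => i.elim0)] at h
    simpa using h
  | succ n ih =>
    intro lo L hL
    induction L, hL using Nat.le_induction with
    -- Start from empty weights: essentialization gives the exponent 0 besides those of n vertices
    -- with length 3. The n + 1 levels have restrictions with these latter exponents, so 0 grows to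
    -- n + 1.
    | base =>
      have h1 := (ih (-1) 3 (by norm_num)).pull _ (differenceMap_surjective n)
      rw [finrank_ker_differenceMap, Multiset.replicate_one, Multiset.singleton_add] at h1
      have h2 := h1.congr (hypSet_pullForms_differenceMap n)
      have h3 : stepWeights (fun _ : Fin (n + 1) => lo) (fun _ => lo) (n + 1) = fun _ => ∅ := by
        rw [stepWeights_const_top]
        simp
      rw [← h3] at h2
      have h4 := h2.stepWeights _ _ _ (fun _ => le_rfl) (fun q => by
        rw [restrictWeights_complete_empty]
        exact ih (lo - 1) 3 (by norm_num)) 0 (Nat.zero_le _)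
      rw [stepWeights_const_zero] at h4
      rw [Multiset.cons_swap, show 3 + n - 1 = 0 + (n + 1 - 0) + 1 by omega,
        ← Ico_val_eq_cons_left (by omega)] at h4
      rwa [show 1 + (n + 1) - 1 = 0 + (n + 1 - 0) by omega,
        show 1 + 2 * (n + 1) - 1 = 3 + 2 * n - 1 by omega, Nat.cast_one]
    -- Each new level restricts to n vertices with length L + 2. The smallest exponent after 1
    -- therefore grows by n + 1 and becomes the largest.
    | succ L hL ihL =>
      rw [Ico_val_eq_cons_left (by omega), Multiset.cons_swap, ← stepWeights_const_top] at ihL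
      have h4 := ihL.stepWeights _ _ _ (fun _ => by simp) (fun q => by
        rw [restrictWeights_complete _ _ _ hL]
        rw [show L + (n + 1) - 1 + 1 = L + 2 + n - 1 by omega,
          show L + 2 * (n + 1) - 1 = L + 2 + 2 * n - 1 by omega]
        exact ih lo (L + 2) (by omega)) 0 (Nat.zero_le _)
      rw [stepWeights_const_zero, Multiset.cons_swap,
        show L + (n + 1) - 1 + (n + 1 - 0) = L + 2 * (n + 1) - 1 by omega,
        ← Ico_val_eq_cons_right (by omega)] at h4
      rwa [show L + 1 + (n + 1) - 1 = L + (n + 1) - 1 + 1 by omega,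
        show L + 1 + 2 * (n + 1) - 1 = L + 2 * (n + 1) - 1 + 1 by omega, Nat.cast_succ,
        ← add_assoc]

/-- Exponents of the arrangements below: `n` vertices, `p` intervals of length `L` and
`n - p` intervals of length `L + 1`. -/
def stepExponents (n L p : ℕ) : Multiset ℕ :=
  (L + 2 * n - 1 - p) ::ₘ (Finset.Ico (L + n) (L + 2 * n - 1)).val

theorem formsIndFree_complete_step (n : ℕ) (lo : ℤ) (L p : ℕ) (hL : 1 ≤ L) (hp : p ≤ n + 1) :
    FormsIndFree (digraphForms (n := n + 1) (fun _ _ => True)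
      (stepWeights (fun _ => lo) (fun _ => lo + L) p)) (1 ::ₘ stepExponents (n + 1) L p) := by
  have h1 := formsIndFree_complete (n + 1) lo L hL
  rw [Ico_val_eq_cons_left (by omega), Multiset.cons_swap, ← stepWeights_const_top] at h1
  have h4 := h1.stepWeights _ _ _ (fun _ => by simp) (fun q => by
    rw [restrictWeights_complete _ _ _ hL]
    rw [show L + (n + 1) - 1 + 1 = L + 2 + n - 1 by omega,
      show L + 2 * (n + 1) - 1 = L + 2 + 2 * n - 1 by omega]
    exact formsIndFree_complete n lo (L + 2) (by omega)) p hp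
  rwa [Multiset.cons_swap, show L + (n + 1) - 1 + (n + 1 - p) = L + 2 * (n + 1) - 1 - p by omega,
    show L + (n + 1) - 1 + 1 = L + (n + 1) by omega] at h4

theorem stepWeights_top {n : ℕ} (lo hi : Fin n → ℤ) :
    stepWeights lo hi n = fun i => Set.Ico (lo i) (hi i) := by
  funext i
  simp only [stepWeights, if_neg (not_le.2 i.2)]

/-- The case p = 0 at length L is the case of maximal p at length L + 1. This allows p ≥ 1 to be
assumed when the first vertex is removed. -/
theorem stepWeights_zero_eq_top {n : ℕ} (lo : Fin n → ℤ) (a : ℤ) (L : ℕ) :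
    stepWeights lo (fun _ => a + L) 0 = stepWeights lo (fun _ => a + (L + 1 : ℕ)) n := by
  rw [stepWeights_top]
  funext i
  simp [stepWeights, add_assoc]

theorem stepExponents_self (n L : ℕ) :
    stepExponents (n + 1) L (n + 1) = (Finset.Ico (L + n) (L + 2 * n + 1)).val := by
  rw [Ico_val_eq_cons_left (by omega), stepExponents]
  congr 3; omega

theorem stepExponents_zero (n L : ℕ) :
    stepExponents (n + 1) L 0 = stepExponents (n + 1) (L + 1) (n + 1) := by
  rw [stepExponents_self, stepExponents,
    show L + 1 + 2 * n + 1 = L + 2 * (n + 1) - 1 - 0 + 1 by omega,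
    Ico_val_eq_cons_right (by omega)]
  congr 3; omega

/-- The exponent split off is a largest one; the rest belongs to one vertex less, one short interval
less and length L + 1, as in the restriction at the first vertex. -/
theorem stepExponents_succ_succ (n L p : ℕ) :
    stepExponents (n + 2) L (p + 1) = (L + 2 * n + 2) ::ₘ stepExponents (n + 1) (L + 1) p := by
  rw [stepExponents, stepExponents, Multiset.cons_swap,
    show L + 2 * (n + 2) - 1 = L + 2 * n + 2 + 1 by omega, Ico_val_eq_cons_right (by omega),
    Multiset.cons_swap, show L + 1 + 2 * (n + 1) - 1 = L + 2 * n + 2 by omega,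
    Nat.add_sub_add_right, show L + 1 + (n + 1) = L + (n + 2) by omega, Multiset.cons_swap]

/-- Left end points `lo - 1`, except for `lo` at the last vertex. -/
def sinkLo (n : ℕ) (lo : ℤ) (i : Fin (n + 1)) : ℤ := if i = Fin.last n then lo else lo - 1

/-- For p = n + 1 the last vertex is a modular coatom of n + n + L hyperplanes over a complete
digraph of length L + 1; the lowered left end points are what makes it modular. Smaller p follow by
lengthening intervals as in the complete case. -/
theorem formsIndFree_sink (n : ℕ) : ∀ (lo : ℤ) (L p : ℕ), 1 ≤ L → p ≤ n + 1 →
    FormsIndFree (digraphForms (fun _ j => j ≠ Fin.last n)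
      (stepWeights (sinkLo n lo) (fun _ => lo + L) p)) (1 ::ₘ stepExponents (n + 1) L p) := by
  have hbase : ∀ n, ∀ (lo : ℤ) (L : ℕ), 1 ≤ L →
      FormsIndFree (digraphForms (fun _ j => j ≠ Fin.last n)
      (stepWeights (sinkLo n lo) (fun _ => lo + L) (n + 1)))
        (1 ::ₘ (Finset.Ico (L + n) (L + 2 * n + 1)).val) := by
    intro n lo L hL
    have h1 := formsIndFree_complete n (lo - 1) (L + 1) (by omega)
    rw [Ico_val_eq_cons_right (by omega), Multiset.cons_swap]
    have h2 := FormsIndFree.addSnoc (G := fun _ j => j ≠ Fin.last n)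
      (ψ := stepWeights (sinkLo n lo) (fun _ => lo + L) (n + 1)) (T := Finset.univ)
      (S := Finset.Ico lo (lo + L)) (E := 1 ::ₘ (Finset.Ico (L + n) (L + 2 * n)).val)
      ?_ (by simp) (by simp [Fin.castSucc_ne_last]) (by simp [stepWeights_top, sinkLo]) ?_ ?_ ?_
    · rw [Finset.card_univ, Fintype.card_fin, Int.card_Ico] at h2
      convert h2 using 2
      omega
    · rw [show L + 1 + n - 1 = L + n by omega, show L + 1 + 2 * n - 1 = L + 2 * n by omega] at h1
      rwa [digraphForms_congr (G' := fun _ _ => True)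
        (ψ' := fun _ => Set.Ico (lo - 1) (lo - 1 + (L + 1 : ℕ)))]
      · simp [Fin.castSucc_ne_last]
      · intro i
        simp only [stepWeights_top, sinkLo, Fin.castSucc_ne_last, if_false]
        congr 1; push_cast; ring
    · intro i a
      simp only [stepWeights_top, sinkLo, Fin.castSucc_ne_last, if_false, Finset.mem_Ico,
        Set.mem_Ico]
      omega
    · simp [Fin.castSucc_ne_last]
    · intro i _ a
      simp only [stepWeights_top, sinkLo, Fin.castSucc_ne_last, if_false, Finset.mem_Ico,
        Set.mem_Ico]
      omega
  intro lo L p hL hp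
  have h1 := hbase n lo L hL
  rw [Ico_val_eq_cons_left (by omega), Multiset.cons_swap] at h1
  have h4 := h1.stepWeights _ _ _ (fun i => by simp only [sinkLo]; split_ifs <;> omega) (fun q => by
    cases q using Fin.lastCases with
    -- There is no edge into the last vertex, so the others gain nothing beyond lo + L. With the
    -- lowered left end their length is L + 2.
    | last =>
      have h2 := formsIndFree_complete n (lo - 1) (L + 2) (by omega)
      rw [show L + 2 + n - 1 = L + n + 1 by omega,
        show L + 2 + 2 * n - 1 = L + 2 * n + 1 by omega] at h2
      rwa [digraphForms_congr (G' := fun _ _ => True)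
        (ψ' := fun _ => Set.Ico (lo - 1) (lo - 1 + (L + 2 : ℕ)))]
      · simp [Fin.castSucc_ne_last]
      · intro j
        ext b
        simp only [restrictWeights, stepWeights, sinkLo, Set.mem_ofPred_eq, Set.mem_Ico,
          Fin.succAbove_last, Fin.castSucc_ne_last, Fin.val_last, Fin.val_castSucc, ne_eq]
        have := j.2
        push_cast
        split_ifs <;> first | (exfalso; omega) | (simp; omega)
    -- The restriction is again sink-mutated, with length L + 2: the last vertex still has its edge
    -- to q and so reaches lo + L + 1 like the others.
    | cast q =>
      obtain _ | n := n
      · exact q.elim0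
      have h2 := hbase n lo (L + 2) (by omega)
      rw [show L + 2 + n = L + (n + 1) + 1 by omega,
        show L + 2 + 2 * n + 1 = L + 2 * (n + 1) + 1 by omega] at h2
      have hl : ∀ j : Fin (n + 1), q.castSucc.succAbove j = Fin.last (n + 1) ↔ j = Fin.last n := by
        intro j
        exact Fin.succAbove_eq_last_iff (Fin.castSucc_lt_last q).ne
      rwa [digraphForms_congr (G' := fun _ j => j ≠ Fin.last n)
        (ψ' := stepWeights (sinkLo n lo) (fun _ => lo + (L + 2 : ℕ)) (n + 1))]
      · intro i j _
        exact (hl j).not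
      · intro j
        ext b
        have hq : (q : ℕ) + 1 ≤ n + 1 := q.2
        have hq' := (Fin.castSucc_lt_last q).ne
        rw [stepWeights_top]
        simp only [restrictWeights, stepWeights, sinkLo, Set.mem_ofPred_eq, Set.mem_Ico, hl, ne_eq,
          hq', not_false_iff, and_true, Fin.val_castSucc]
        by_cases hj : j = Fin.last n
        · have h3 := (hl j).2 hj
          rw [h3]
          simp only [hj, if_true, not_true, and_false, Fin.val_last, if_pos hq]
          push_cast
          simp only [or_false]
          omega
        · simp only [hj, if_false, not_false_iff, and_true]
          push_cast
          split_ifs <;> omega) p hp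
  rwa [Multiset.cons_swap, show L + n + (n + 1 - p) = L + 2 * (n + 1) - 1 - p by omega,
    show L + n + 1 = L + (n + 1) by omega,
    show L + 2 * n + 1 = L + 2 * (n + 1) - 1 by omega] at h4

/-! ### Flags before the first source mutation. -/

theorem formsFlagAccurate_zero (G : Fin 0 → Fin 0 → Prop) (ψ : Fin 0 → Set ℤ) (w : Fin 0 → ℤ) :
    FormsFlagAccurate (digraphForms G ψ) {1} (fun i => (w i : ℝ), 1) := by
  refine FormsFlagAccurate.of_finrank_eq_one (finrank_coneSpace 0) ?_ (fun h => by
    simpa using congrArg Prod.snd h)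
  rw [digraphForms_congr (G' := fun _ _ => True) (ψ' := fun _ => ∅) (fun i => i.elim0)
    (fun i => i.elim0)]
  exact isIndFree_zForm

theorem FormsFlagAccurate.single {G : Fin 1 → Fin 1 → Prop} {ψ : Fin 1 → Set ℤ} {x : ℕ} {a : ℤ}
    (ha : a ∈ ψ 0) (hx : 1 ≤ x) (h : FormsIndFree (digraphForms G ψ) (x ::ₘ {1})) {w : Fin 1 → ℤ}
    (hw : w 0 = a) : FormsFlagAccurate (digraphForms G ψ) (x ::ₘ {1}) (fun i => (w i : ℝ), 1) := by
  have h1 := FormsFlagAccurate.addLevel 0 a ha (formsFlagAccurate_zero _ _ Fin.elim0) h (by simpa)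
  convert h1 using 4 with i
  rw [Subsingleton.elim i 0, hw, Fin.insertNth_apply_same]

/-- Restriction to x_0 = lo z lowers the other left end points by 1 and loses a largest exponent; L
≥ 2 ensures that the value lo + 1 is already there. Iteration ends in the line through the points
lo, lo - 1, lo - 2, …. -/
theorem formsFlagAccurate_complete (n : ℕ) : ∀ (lo : ℤ) (L p : ℕ), 2 ≤ L → p ≤ n + 1 →
    FormsFlagAccurate (digraphForms (fun _ _ => True)
      (stepWeights (fun _ : Fin (n + 1) => lo) (fun _ => lo + L) p))
      (1 ::ₘ stepExponents (n + 1) L p) (fun i => ((lo - i : ℤ) : ℝ), 1) := by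
  induction n with
  | zero =>
    have h1 : ∀ (lo : ℤ) (L : ℕ), 2 ≤ L → FormsFlagAccurate (digraphForms (fun _ _ => True)
      (stepWeights (fun _ : Fin 1 => lo) (fun _ => lo + L) 1))
      (1 ::ₘ stepExponents 1 L 1) (fun i => ((lo - i : ℤ) : ℝ), 1) := by
      intro lo L hL
      have h2 := formsIndFree_complete_step 0 lo L 1 (by omega) le_rfl
      have h3 : 1 ::ₘ stepExponents 1 L 1 = L ::ₘ {1} := by
        simp [stepExponents, ← Multiset.cons_zero, Multiset.cons_swap 1]
      rw [h3] at h2 ⊢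
      exact FormsFlagAccurate.single (a := lo) (by simp [stepWeights]; omega) (by omega) h2
        (by simp)
    intro lo L p hL hp
    obtain rfl | rfl : p = 0 ∨ p = 1 := by omega
    · rw [stepWeights_zero_eq_top, stepExponents_zero]
      exact h1 lo (L + 1) (by omega)
    · exact h1 lo L hL
  | succ n ih =>
    have h1 : ∀ (lo : ℤ) (L p : ℕ), 2 ≤ L → p ≤ n + 1 → FormsFlagAccurate
      (digraphForms (fun _ _ => True)
        (stepWeights (fun _ : Fin (n + 2) => lo) (fun _ => lo + L) (p + 1)))
        (1 ::ₘ stepExponents (n + 2) L (p + 1)) (fun i => ((lo - i : ℤ) : ℝ), 1) := by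
      intro lo L p hL hp
      have h2 := formsIndFree_complete_step (n + 1) lo L (p + 1) (by omega) (by omega)
      rw [stepExponents_succ_succ, Multiset.cons_swap] at h2 ⊢
      have h3 := FormsFlagAccurate.addLevel 0 lo (by simp [stepWeights]; omega)
        (w := fun i => lo - 1 - i) ?_ h2 ?_
      · convert h3 using 4 with i
        cases i using Fin.cases with
        | zero => simp
        | succ i => simp; ring
      · have h4 := ih (lo - 1) (L + 1) p (by omega) hp
        rwa [digraphForms_congr (G' := fun _ _ => True)
          (ψ' := stepWeights (fun _ : Fin (n + 1) => lo - 1) (fun _ => lo - 1 + (L + 1 : ℕ)) p)]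
        · simp
        · intro j
          ext b
          simp only [restrictWeights, stepWeights, Set.mem_ofPred_eq, Set.mem_Ico, and_true,
            Fin.zero_succAbove, Fin.val_succ]
          push_cast
          split_ifs <;> omega
      · intro e he
        simp only [stepExponents, Multiset.mem_cons, Finset.mem_val, Finset.mem_Ico] at he
        omega
    intro lo L p hL hp
    obtain _ | p := p
    · rw [stepWeights_zero_eq_top, stepExponents_zero]
      exact h1 lo (L + 1) (n + 1) (by omega) le_rfl
    · exact h1 lo L p hL (by omega)

/-- The first vertex is restricted to its left end point lo - 1. As it has no edge to the last
vertex, all remaining left ends, including the last, drop by exactly 1. The coordinate t of the last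
vertex stays fixed while lo decreases, so the induction needs it arbitrary in its interval. -/
theorem formsFlagAccurate_sink (n : ℕ) : ∀ (lo t : ℤ) (L p : ℕ), 1 ≤ L → p ≤ n + 1 →
    lo ≤ t → t < lo + L →
    FormsFlagAccurate (digraphForms (fun _ j => j ≠ Fin.last n)
      (stepWeights (sinkLo n lo) (fun _ => lo + L) p))
      (1 ::ₘ stepExponents (n + 1) L p)
      (fun i => ((if i = Fin.last n then t else lo - 1 - i : ℤ) : ℝ), 1) := by
  induction n with
  | zero =>
    have h1 : ∀ (lo t : ℤ) (L : ℕ), 1 ≤ L → lo ≤ t → t < lo + L →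
        FormsFlagAccurate (digraphForms (fun _ j => j ≠ Fin.last 0)
      (stepWeights (sinkLo 0 lo) (fun _ => lo + L) 1))
      (1 ::ₘ stepExponents 1 L 1)
      (fun i => ((if i = Fin.last 0 then t else lo - 1 - i : ℤ) : ℝ), 1) := by
      intro lo t L hL ht ht'
      have h2 := formsIndFree_sink 0 lo L 1 (by omega) le_rfl
      have h3 : 1 ::ₘ stepExponents 1 L 1 = L ::ₘ {1} := by
        simp [stepExponents, ← Multiset.cons_zero, Multiset.cons_swap 1]
      rw [h3] at h2 ⊢
      exact FormsFlagAccurate.single (a := t) (by simp [stepWeights, sinkLo]; omega) (by omega) h2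
        (by simp)
    intro lo t L p hL hp ht ht'
    obtain rfl | rfl : p = 0 ∨ p = 1 := by omega
    · rw [stepWeights_zero_eq_top, stepExponents_zero]
      exact h1 lo t (L + 1) (by omega) ht (by push_cast; omega)
    · exact h1 lo t L hL ht ht'
  | succ n ih =>
    have h1 : ∀ (lo t : ℤ) (L p : ℕ), 1 ≤ L → p ≤ n + 1 → lo ≤ t → t < lo + L → FormsFlagAccurate
      (digraphForms (fun _ j => j ≠ Fin.last (n + 1))
        (stepWeights (sinkLo (n + 1) lo) (fun _ => lo + L) (p + 1)))
        (1 ::ₘ stepExponents (n + 2) L (p + 1))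
        (fun i => ((if i = Fin.last (n + 1) then t else lo - 1 - i : ℤ) : ℝ), 1) := by
      intro lo t L p hL hp ht ht'
      have h2 := formsIndFree_sink (n + 1) lo L (p + 1) (by omega) (by omega)
      rw [stepExponents_succ_succ, Multiset.cons_swap] at h2 ⊢
      have h0 : (0 : Fin (n + 2)) ≠ Fin.last (n + 1) := (Fin.last_pos).ne
      have h3 := FormsFlagAccurate.addLevel 0 (lo - 1) (by simp [stepWeights, sinkLo, h0])
        (w := fun i => if i = Fin.last n then t else lo - 1 - 1 - i) ?_ h2 ?_
      · convert h3 using 4 with i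
        cases i using Fin.cases with
        | zero => simp [h0]
        | succ i =>
          simp only [Fin.insertNth_zero', Fin.cons_succ, ← Fin.succ_last, Fin.succ_inj]
          split_ifs
          · rfl
          · simp; ring
      · have h4 := ih (lo - 1) t (L + 1) p (by omega) hp (by omega) (by push_cast; omega)
        have hl : ∀ j : Fin (n + 1), j.succ = Fin.last (n + 1) ↔ j = Fin.last n := fun j => by
          rw [← Fin.succ_last, Fin.succ_inj]
        rwa [digraphForms_congr (G' := fun _ j => j ≠ Fin.last n)
          (ψ' := stepWeights (sinkLo n (lo - 1)) (fun _ => lo - 1 + (L + 1 : ℕ)) p)]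
        · intro i j _
          simp only [Fin.zero_succAbove]
          exact (hl j).not
        · intro j
          ext b
          simp only [restrictWeights, stepWeights, sinkLo, Set.mem_ofPred_eq, Set.mem_Ico,
            Fin.zero_succAbove, Fin.val_succ, hl, ne_eq, h0, not_false_iff, and_true]
          push_cast
          split_ifs <;> simp_all <;> omega
      · intro e he
        simp only [stepExponents, Multiset.mem_cons, Finset.mem_val, Finset.mem_Ico] at he
        omega
    intro lo t L p hL hp ht ht'
    obtain _ | p := p
    · rw [stepWeights_zero_eq_top, stepExponents_zero]
      exact h1 lo t (L + 1) (n + 1) (by omega) le_rfl ht (by push_cast; omega)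
    · exact h1 lo t L p hL (by omega) ht ht'

/-! ### Induction over the mutations. -/

/-- The weights of the Catalan descendants (`s = k`) and of the intermediate ones (`s = k + 1`),
where `k` counts the mutations at sources. -/
def descendantWeights (n : ℕ) (lo : ℤ) (L p k s : ℕ) (i : Fin (n + 1)) : Set ℤ :=
  Set.Ico (lo - (min s (n - i) : ℕ)) (lo + L + (if p ≤ i then 1 else 0) + (min k (n - i) : ℕ))

/-- The digraphs of the Catalan descendants (`s = k`) and of the intermediate ones
(`s = k + 1`). -/
def descendantGraph (n k s : ℕ) (i j : Fin (n + 1)) : Prop :=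
  (i : ℕ) + k ≤ n ∧ (j : ℕ) + s ≤ n

/-- The exponent split off is a smallest one, namely the number of hyperplanes through an isolated
last vertex: n + 1 diagonals and its levels. -/
theorem stepExponents_last (n L p : ℕ) (hp : p ≤ n + 2) :
    stepExponents (n + 2) L p = (n + 1 + (L + if p ≤ n + 1 then 1 else 0)) ::ₘ
      stepExponents (n + 1) (L + 2) (min p (n + 1)) := by
  rw [stepExponents, stepExponents, Ico_val_eq_cons_left (by omega),
    show L + 2 + 2 * (n + 1) - 1 = L + 2 * (n + 2) - 1 by omega,
    show L + 2 + (n + 1) = L + (n + 2) + 1 by omega]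
  split_ifs with h
  · rw [min_eq_left h, Multiset.cons_swap, show n + 1 + (L + 1) = L + (n + 2) by omega]
  · rw [min_eq_right (by omega), show n + 1 + (L + 0) = L + 2 * (n + 2) - 1 - p by omega,
      show L + 2 * (n + 2) - 1 - (n + 1) = L + (n + 2) by omega]

/-- After a source mutation the last vertex is isolated with its original interval. The others form
a descendant with one mutation pair less, left end lo - 1 and length L + 2, so the coatom lemma
applies. Injectivity of w and the bound by lo are carried to meet its separation hypothesis. -/
theorem exists_formsFlagAccurate_descendant (k : ℕ) : ∀ (n : ℕ) (lo : ℤ) (L p s : ℕ),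
    k ≤ n → 2 ≤ L → p ≤ n + 1 → s = k ∨ s = k + 1 →
    ∃ w : Fin (n + 1) → ℤ, Function.Injective w ∧ (∀ i, w i ≤ lo) ∧
      FormsFlagAccurate (digraphForms (descendantGraph n k s) (descendantWeights n lo L p k s))
        (1 ::ₘ stepExponents (n + 1) L p) (fun i => (w i : ℝ), 1) := by
  induction k with
  | zero =>
    rintro n lo L p s - hL hp (rfl | rfl)
    · refine ⟨fun i => lo - i, fun i j h => ?_, fun i => by simp only; omega, ?_⟩
      · ext
        simp only at h
        omega
      · rw [digraphForms_congr (G' := fun _ _ => True)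
          (ψ' := stepWeights (fun _ => lo) (fun _ => lo + L) p)]
        · exact formsFlagAccurate_complete n lo L p hL hp
        · intro i j _
          simp only [descendantGraph, iff_true]
          omega
        · intro i
          simp only [descendantWeights, stepWeights]
          split_ifs <;> simp
    · refine ⟨fun i => if i = Fin.last n then lo else lo - 1 - i, fun i j h => ?_, fun i => ?_, ?_⟩
      · simp only at h
        split_ifs at h with h1 h2 h2
        · rw [h1, h2]
        · omega
        · omega
        · ext
          omega
      · simp only
        split_ifs <;> omega
      · rw [digraphForms_congr (G' := fun _ j => j ≠ Fin.last n)
          (ψ' := stepWeights (sinkLo n lo) (fun _ => lo + L) p)]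
        · exact formsFlagAccurate_sink n lo lo L p (by omega) hp le_rfl (by omega)
        · intro i j _
          simp only [descendantGraph, ne_eq, Fin.ext_iff, Fin.val_last]
          omega
        · intro i
          simp only [descendantWeights, stepWeights, sinkLo, Fin.ext_iff, Fin.val_last]
          ext b
          simp only [Set.mem_Ico]
          split_ifs <;> omega
  | succ k ih =>
    rintro n lo L p s hk hL hp hs
    obtain ⟨n, rfl⟩ : ∃ n', n = n' + 1 := ⟨n - 1, by omega⟩
    obtain ⟨s, rfl⟩ : ∃ s', s = s' + 1 := ⟨s - 1, by omega⟩
    obtain ⟨w, hw, hwlo, h⟩ := ih n (lo - 1) (L + 2) (min p (n + 1)) s (by omega) (by omega)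
      (min_le_right _ _) (by omega)
    -- The old coordinates are at most lo - 1, so they avoid the interval of the last vertex and
    -- differ from the new coordinate lo.
    refine ⟨Fin.snoc w lo, ?_, ?_, ?_⟩
    · intro i j hij
      induction i using Fin.lastCases with
      | last =>
        induction j using Fin.lastCases with
        | last => rfl
        | cast j =>
          simp only [Fin.snoc_last, Fin.snoc_castSucc] at hij
          have := hwlo j
          omega
      | cast i =>
        induction j using Fin.lastCases with
        | last =>
          simp only [Fin.snoc_last, Fin.snoc_castSucc] at hij
          have := hwlo i
          omega
        | cast j =>
          simp only [Fin.snoc_castSucc] at hij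
          rw [hw hij]
    · intro i
      induction i using Fin.lastCases with
      | last => simp
      | cast i =>
        simp only [Fin.snoc_castSucc]
        have := hwlo i
        omega
    · have hcard : (Finset.Ico lo (lo + L + if p ≤ n + 1 then 1 else 0)).card =
          L + if p ≤ n + 1 then 1 else 0 := by
        rw [Int.card_Ico]
        split_ifs <;> omega
      rw [stepExponents_last n L p hp, ← hcard]
      refine FormsFlagAccurate.addSnoc ?_ ?_ ?_ ?_ ?_ hw ?_ ?_ ?_ ?_
      · rwa [digraphForms_congr (G' := descendantGraph n k s)
          (ψ' := descendantWeights n (lo - 1) (L + 2) (min p (n + 1)) k s)]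
        · intro i j _
          simp only [descendantGraph, Fin.val_castSucc]
          omega
        · intro i
          ext b
          simp only [descendantWeights, Fin.val_castSucc, Set.mem_Ico]
          have := i.2
          split_ifs <;> omega
      · intro i
        simp only [descendantGraph, Fin.val_last]
        omega
      · intro i
        simp only [descendantGraph, Fin.val_last]
        omega
      · simp [descendantWeights]
      · intro i a
        simp only [descendantWeights, Fin.val_castSucc, Set.mem_Ico, Finset.mem_Ico]
        have := i.2
        split_ifs <;> omega
      · intro i hi
        have := hwlo i
        have := (Finset.mem_Ico.1 hi).1
        omega
      · rw [Finset.mem_Ico]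
        split_ifs <;> omega
      · exact Multiset.cons_ne_zero
      · intro e he
        rw [hcard]
        simp only [stepExponents, Multiset.mem_cons, Finset.mem_val, Finset.mem_Ico] at he
        split_ifs <;> omega

/-- Closed form of the recursion: each round at a later vertex moves both ends of the interval of i
outwards by 1. Only n - i vertices come later, whence the minimum. -/
theorem catalanDigraph_succ (n p c m k : ℕ) (hk : k ≤ n) :
    (∀ i j, (catalanDigraph (n + 1) p c m (k + 1)).graph.Adj i j ↔
      i ≠ j ∧ descendantGraph n k k i j) ∧
    (∀ i, (catalanDigraph (n + 1) p c m (k + 1)).lo i = -c - (min k (n - i) : ℕ)) ∧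
    ∀ i, (catalanDigraph (n + 1) p c m (k + 1)).hi i =
      m + (if p ≤ i then 1 else 0) + (min k (n - i) : ℕ) := by
  induction k with
  | zero =>
    refine ⟨fun i j => ?_, fun i => ?_, fun i => ?_⟩
    · simp only [catalanDigraph, catalanOrigin, descendantGraph]
      omega
    · simp [catalanDigraph, catalanOrigin]
    · simp only [catalanDigraph, catalanOrigin, label]
      split_ifs <;> omega
  | succ k ih =>
    obtain ⟨hG, hlo, hhi⟩ := ih (by omega)
    refine ⟨fun i j => ?_, fun i => ?_, fun i => ?_⟩
    · simp only [catalanDigraph, IntervalDigraph.sinkMutation, IntervalDigraph.sourceMutation, hG,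
        descendantGraph, label, ne_eq, Fin.ext_iff]
      omega
    · simp only [catalanDigraph, IntervalDigraph.sinkMutation, IntervalDigraph.sourceMutation, hlo,
        label]
      split_ifs <;> omega
    · simp only [catalanDigraph, IntervalDigraph.sinkMutation, IntervalDigraph.sourceMutation, hhi,
        label]
      split_ifs <;> omega

theorem digraphForms_catalanDigraph (n p c m k : ℕ) (hk : k ≤ n) :
    digraphForms (catalanDigraph (n + 1) p c m (k + 1)).graph.Adj
      (fun i => (Finset.Icc ((catalanDigraph (n + 1) p c m (k + 1)).lo i)
        ((catalanDigraph (n + 1) p c m (k + 1)).hi i) : Set ℤ)) =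
      digraphForms (descendantGraph n k k) (descendantWeights n (-c) (c + m + 1) p k k) := by
  obtain ⟨hG, hlo, hhi⟩ := catalanDigraph_succ n p c m k hk
  refine digraphForms_congr (fun i j hij => ?_) fun i => ?_
  · rw [hG]
    exact and_iff_right hij
  · ext b
    rw [hlo, hhi]
    simp only [descendantWeights, Finset.coe_Icc, Set.mem_Icc, Set.mem_Ico]
    omega

theorem digraphForms_catalanDigraphHat (n p c m k : ℕ) (hk : k ≤ n) :
    digraphForms (catalanDigraphHat (n + 1) p c m (k + 1)).graph.Adj
      (fun i => (Finset.Icc ((catalanDigraphHat (n + 1) p c m (k + 1)).lo i)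
        ((catalanDigraphHat (n + 1) p c m (k + 1)).hi i) : Set ℤ)) =
      digraphForms (descendantGraph n k (k + 1))
        (descendantWeights n (-c) (c + m + 1) p k (k + 1)) := by
  obtain ⟨hG, hlo, hhi⟩ := catalanDigraph_succ n p c m k hk
  refine digraphForms_congr (fun i j hij => ?_) fun i => ?_
  · simp only [catalanDigraphHat, IntervalDigraph.sinkMutation, hG, descendantGraph, label, ne_eq,
      Fin.ext_iff]
    rw [ne_eq, Fin.ext_iff] at hij
    omega
  · ext b
    simp only [catalanDigraphHat, IntervalDigraph.sinkMutation, hlo, hhi, label,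
      descendantWeights, Finset.coe_Icc, Set.mem_Icc, Set.mem_Ico]
    split_ifs <;> omega

theorem map_add_Icc_val (n N : ℕ) :
    (Finset.Icc 2 (n + 1)).val.map (fun e => e + N) = (Finset.Ico (N + 2) (N + n + 2)).val := by
  refine (Finset.map_val ⟨_, add_left_injective N⟩ _).symm.trans (congrArg Finset.val ?_)
  ext x
  simp only [Finset.mem_map, Finset.mem_Icc, Finset.mem_Ico, Function.Embedding.coeFn_mk]
  constructor
  · rintro ⟨y, hy, rfl⟩
    omega
  · exact fun h => ⟨x - N, by omega⟩

theorem catalanExponents_eq (n p c m : ℕ) (hc : 1 ≤ c) (hp : p ≤ n + 1) :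
    catalanExponents (n + 1) p c m = 1 ::ₘ stepExponents (n + 1) (c + m + 1) p := by
  rw [catalanExponents, stepExponents, Multiset.map_cons, map_add_Icc_val,
    show n + 1 - p + 1 + (m + (n + 1) + c - 1) = c + m + 1 + 2 * (n + 1) - 1 - p by omega,
    show m + (n + 1) + c - 1 + 2 = c + m + 1 + (n + 1) by omega,
    show m + (n + 1) + c - 1 + n + 2 = c + m + 1 + 2 * (n + 1) - 1 by omega]

end Catalan
end Arr

end

theorem mainTheorem9 (ℓ k p c m : ℕ) (hc : 1 ≤ c) (hk : 1 ≤ k) (hkl : k ≤ ℓ) (hp : p ≤ ℓ) :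
    ((Arr.catalanDescendant ℓ p k c m).cone.IsIndFlagAccurate ∧
      (Arr.catalanDescendant ℓ p k c m).cone.IsFreeWithExp (Arr.catalanExponents ℓ p c m)) ∧
    ((Arr.catalanDescendantHat ℓ p k c m).cone.IsIndFlagAccurate ∧
      (Arr.catalanDescendantHat ℓ p k c m).cone.IsFreeWithExp
        (Arr.catalanExponents ℓ p c m)) := by
  obtain ⟨n, rfl⟩ : ∃ n, ℓ = n + 1 := ⟨ℓ - 1, by omega⟩
  obtain ⟨k, rfl⟩ : ∃ j, k = j + 1 := ⟨k - 1, by omega⟩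
  rw [Arr.catalanExponents_eq n p c m hc hp]
  constructor
  -- The interval [-c, m] has L = c + m + 1 points, and c ≥ 1 gives L ≥ 2.
  · obtain ⟨w, -, -, h⟩ := Arr.exists_formsFlagAccurate_descendant k n (-c) (c + m + 1) p k
      (by omega) (by omega) hp (Or.inl rfl)
    rw [← Arr.digraphForms_catalanDigraph n p c m k (by omega)] at h
    exact h.isIndFlagAccurate (Arr.cone_digraphicArrangement_hyps _ _)
  · obtain ⟨w, -, -, h⟩ := Arr.exists_formsFlagAccurate_descendant k n (-c) (c + m + 1) p (k + 1)
      (by omega) (by omega) hp (Or.inr rfl)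
    rw [← Arr.digraphForms_catalanDigraphHat n p c m k (by omega)] at h
    exact h.isIndFlagAccurate (Arr.cone_digraphicArrangement_hyps _ _)
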